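/- Let $N\ge 1$, $K\ge 0$, and let $f\in C(\mathbf R^N\times(0,\infty)\times\mathbf R\times\mathbf R^N)$ be real-valued. Assume that there are constants $C>0$ and $A>1$ such that $$|f(x,t,p,q)|\le C(1+t)^{-A}\bigl(|p|+(1+t)^{1/2}|q|\bigr)\qquad\text{for all }(x,t,p,q)\in\mathbf R^N\times(0,\infty)\times\mathbf R\times\mathbf R^N .$$ Let $\varphi\in L^1(\mathbf R^N)$ be real-valued with $\int_{\mathbf R^N}(1+|x|)^K|\varphi(x)|\,dx<\infty$. Write $G(x,t)=(4\pi t)^{-N/2}e^{-|x|^2/(4t)}$, $g(x,t)=G(x,1+t)$, $\|\cdot\|_q$ for the norm of $L^q(\mathbf R^N)$, and $|||v|||_l=\int_{\mathbf R^N}(1+|x|)^l|v(x)|\,dx$; $\nabla$ is the gradient in $x$ and $u(t)=u(\cdot,t)$. A solution of the Cauchy problem $$\partial_t u=\Delta u+f(x,t,u,\nabla u)\ \text{ in }\mathbf R^N\times(0,\infty),\qquad u(x,0)=\varphi(x)\ \text{ in }\mathbf R^N$$ is a function $u\in L^\infty_{loc}(0,\infty:W^{1,1}(\mathbf R^N))$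 such that for almost all $(x,t)\in\mathbf R^N\times(0,\infty)$ $$u(x,t)=\int_{\mathbf R^N}G(x-\xi,t)\varphi(\xi)\,d\xi+\int_0^t\!\int_{\mathbf R^N}G(x-\xi,t-s)\,f(\xi,s,u(\xi,s),\nabla u(\xi,s))\,d\xi\,ds,$$ with absolutely convergent integrals. Theorem 3.1. Under these assumptions there exists a solution $u$ with the following properties. (i) For every $t>0$ the function $u(t)$ is differentiable on $\mathbf R^N$, and $u$ and $\nabla u$ are continuous on $\mathbf R^N\times(0,\infty)$. (ii) For all $q\in[1,\infty]$ and $l\in[0,K]$, $$\sup_{0<t<\infty}t^{\frac N2(1-\frac1q)}\bigl[\|u(t)\|_q+t^{\frac12}\|\nabla u(t)\|_q\bigr]<\infty,\qquad \sup_{0<t<\infty}(1+t)^{-\frac l2}\bigl[|||u(t)|||_l+t^{\frac12}|||\nabla u(t)|||_l\bigr]<\infty .$$ (iii) The function $f(x,t,u,\nabla u)$ is integrable on $\mathbf R^N\times(0,\infty)$, and the limit $$M:=\lim_{t\to\infty}\int_{\mathbf R^N}u(x,t)\,dx$$ exists and equals $$\int_{\mathbf R^N}\varphi(x)\,dx+\int_0^\infty\!\int_{\mathbf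 R^N}f(x,t,u(x,t),\nabla u(x,t))\,dx\,dt .$$ Moreover, for all $q\in[1,\infty]$ and $j\in\{0,1\}$, $$\lim_{t\to\infty}t^{\frac N2(1-\frac1q)+\frac j2}\,\|\nabla^j[u(t)-Mg(t)]\|_q=0 .$$ -/

import Mathlib

open MeasureTheory Set Filter Topology
open scoped ENNReal NNReal

namespace SemilinearHeat

/-- The space `ℝᴺ` with its Euclidean norm. -/
abbrev Space (N : ℕ) : Type := EuclideanSpace ℝ (Fin N)

/-- The space-time domain `ℝᴺ × (0, ∞)`, as a subset of `ℝᴺ × ℝ`. -/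
def spaceTime (N : ℕ) : Set (Space N × ℝ) := {z | 0 < z.2}

/-- The Gauss kernel `G(x, t) = (4πt)^(-N/2) exp(-|x|² / (4t))`, used for `t > 0` only. -/
noncomputable def gaussKernel {N : ℕ} (x : Space N) (t : ℝ) : ℝ :=
  (4 * Real.pi * t) ^ (-((N : ℝ) / 2)) * Real.exp (-(‖x‖ ^ 2 / (4 * t)))

/-- `g(x, t) = G(x, 1 + t)`, written as a function of `x` for each time `t`. -/
noncomputable def shiftedGauss {N : ℕ} (t : ℝ) (x : Space N) : ℝ := gaussKernel x (1 + t)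

/-- The norm of `L¹(ℝᴺ, (1 + |x|)^l dx)`, with values in `[0, ∞]`, of a scalar or vector field. -/
noncomputable def weightedL1Norm {N : ℕ} {F : Type*} [NormedAddCommGroup F]
    (l : ℝ) (v : Space N → F) : ℝ≥0∞ :=
  ∫⁻ x, ENNReal.ofReal ((1 + ‖x‖) ^ l) * ‖v x‖ₑ

/-- `φ ∈ L¹_K`: `φ ∈ L¹(ℝᴺ)` and `∫ (1 + |x|)^K |φ(x)| dx < ∞`. -/
def MemWeightedL1 {N : ℕ} (K : ℝ) (φ : Space N → ℝ) : Prop :=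
  Integrable φ ∧ weightedL1Norm K φ < ∞

/-- `w ∈ W^{1,1}(ℝᴺ)` with weak gradient `v`: both are integrable, and
`∫ w ∇ψ dx = - ∫ ψ v dx` for every test function `ψ`. -/
def HasW11Gradient {N : ℕ} (w : Space N → ℝ) (v : Space N → Space N) : Prop :=
  Integrable w ∧ Integrable v ∧
    ∀ ψ : Space N → ℝ, ContDiff ℝ (⊤ : ℕ∞) ψ → HasCompactSupport ψ →
      ∫ x, w x • gradient ψ x = -∫ x, ψ x • v x

/-- `u ∈ L^∞_loc(0, ∞ : W^{1,1}(ℝᴺ))` with weak spatial gradient `v`. The joint measurability of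
`u` and `v` amounts to measurability of `t ↦ u(t)` as a map into the separable space `W^{1,1}`. -/
def MemLocBoundedW11 {N : ℕ} (u : ℝ → Space N → ℝ) (v : ℝ → Space N → Space N) : Prop :=
  AEStronglyMeasurable (fun z : Space N × ℝ => u z.2 z.1) (volume.restrict (spaceTime N)) ∧
  AEStronglyMeasurable (fun z : Space N × ℝ => v z.2 z.1) (volume.restrict (spaceTime N)) ∧
  (∀ᵐ t ∂(volume.restrict (Ioi (0 : ℝ))), HasW11Gradient (u t) (v t)) ∧
  ∀ a b : ℝ, 0 < a → a < b → ∃ C : ℝ≥0,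
    ∀ᵐ t ∂(volume.restrict (Icc a b)), eLpNorm (u t) 1 volume + eLpNorm (v t) 1 volume ≤ C

/-- `u` (written `u t x`) is a solution of the Cauchy problem
`∂ₜu = Δu + F(x, t, u, ∇u)` in `ℝᴺ × (0, ∞)`, `u(x, 0) = φ(x)`:
`u ∈ L^∞_loc(0, ∞ : W^{1,1}(ℝᴺ))` and, with `v` its weak spatial gradient, the integral equation
`u(x,t) = ∫ G(x-ξ,t) φ(ξ) dξ + ∫₀ᵗ ∫ G(x-ξ,t-s) F(ξ,s,u(ξ,s),v(ξ,s)) dξ ds`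
holds, its integrals being absolutely convergent, for almost all `(x, t)`. -/
def IsSolution {N : ℕ} (F : Space N → ℝ → ℝ → Space N → ℝ) (φ : Space N → ℝ)
    (u : ℝ → Space N → ℝ) : Prop :=
  ∃ v : ℝ → Space N → Space N, MemLocBoundedW11 u v ∧
    ∀ᵐ z : Space N × ℝ ∂(volume.restrict (spaceTime N)),
      Integrable (fun ξ => gaussKernel (z.1 - ξ) z.2 * φ ξ) ∧
      IntegrableOn (fun p : Space N × ℝ =>
          gaussKernel (z.1 - p.1) (z.2 - p.2) * F p.1 p.2 (u p.2 p.1) (v p.2 p.1))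
        (univ ×ˢ Ioo 0 z.2) ∧
      u z.2 z.1 = (∫ ξ, gaussKernel (z.1 - ξ) z.2 * φ ξ) +
        ∫ s in Ioo 0 z.2, ∫ ξ,
          gaussKernel (z.1 - ξ) (z.2 - s) * F ξ s (u s ξ) (v s ξ)

/-- The exponent `(N/2)(1 - 1/q)`, for `q ∈ [1, ∞]` (with `1/∞ = 0`). -/
noncomputable def decayRate (N : ℕ) (q : ℝ≥0∞) : ℝ := (N : ℝ) / 2 * (1 - (q⁻¹).toReal)

end SemilinearHeat

/-! Everything rests on one pointwise majorant. Write H(t) for the heat flow of |φ| at time 2t.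
Giving up half of the Gaussian exponent yields |G(x,t)| ≤ κ G(x,2t) and |∇G(x,t)| ≤ κ t^(-1/2)
G(x,2t), so it is natural to look for |u| ≤ c H and |∇u| ≤ c t^(-1/2) H. For such u the growth
condition gives |f(x,t,u,∇u)| ≤ c C rate(t) H(t), where `rate` is integrable on (0,∞) because A > 1.
In the Duhamel integral the doubled times 2(t-s) and 2s add up to 2t, so the semigroup property
pulls H(t) out of the integral (`IsHeatKernel.lintegral_dominated_le`). What remains is a scalar
Volterra inequality with kernel (t-s)^(-a) rate(s), a = 0 for u and a = 1/2 for ∇u. A bounded weight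
exp(c ∫ rate) makes this operator as small as desired (`exists_weight`), so no smallness of C or φ
is needed.

Since f is merely continuous, a contraction argument is not available. The unknown is taken to be
the source F = f(x,t,u,∇u). In a scheme with time delay δ, the source at time t depends only on the
source before t-δ, so iteration stabilises after finitely many steps on each bounded time interval,
and the majorant holds uniformly in δ. As δ → 0, weak-* compactness in the dual of L¹, with test
functions rescaled by the common majorant, makes all potentials converge pointwise along a
subsequence; continuity of f then makes the sources converge pointwise, and dominated convergence
identifies the limit (`exists_mild_source`). The norm bounds in (ii) follow from the majorant alone.

For (iii), u(t) is a superposition of Gauss kernels issued from the points of the initial hyperplane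
(density φ) and of space-time (density F). Each of them approaches g(t) in L¹ by parabolic scaling,
and dominated convergence over the finite total density gives u(t) - M g(t) → 0 in L¹
(`tendsto_superposition_L1`). Restarting the evolution at time t/2 converts this into L^q and
gradient decay: the heat kernel smooths the L¹-small datum, and the source on (t/2,t) contributes an
extra factor of order t^(1-A) (`IsSource.tendsto_eLpNorm_zero`). -/

namespace SemilinearHeat

/-! ### The Gauss kernel: bounds, semigroup identity, scaling. -/

section Kernel

variable {N : ℕ}

/-- The spatial gradient of the Gauss kernel. -/
noncomputable def gaussGrad (x : Space N) (t : ℝ) : Space N :=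
  (-(gaussKernel x t / (2 * t))) • x

theorem isOpen_spaceTime : IsOpen (spaceTime N) :=
  isOpen_lt continuous_const continuous_snd

theorem measurableSet_spaceTime : MeasurableSet (spaceTime N) :=
  isOpen_spaceTime.measurableSet

theorem spaceTime_eq_prod : spaceTime N = univ ×ˢ Ioi (0 : ℝ) := by
  ext z; simp [spaceTime]

theorem gaussKernel_nonneg (x : Space N) (t : ℝ) (ht : 0 < t) : 0 ≤ gaussKernel x t := by
  unfold gaussKernel; positivity

theorem measurable_gaussKernel :
    Measurable (fun z : Space N × ℝ => gaussKernel z.1 z.2) := by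
  unfold gaussKernel; fun_prop

theorem measurable_gaussGrad :
    Measurable (fun z : Space N × ℝ => gaussGrad z.1 z.2) := by
  unfold gaussGrad
  have := measurable_gaussKernel (N := N)
  fun_prop

theorem continuousOn_gaussKernel :
    ContinuousOn (fun z : Space N × ℝ => gaussKernel z.1 z.2) (spaceTime N) := by
  unfold gaussKernel
  refine ContinuousOn.mul ?_ ?_
  · refine ContinuousOn.rpow_const (by fun_prop) fun z hz => Or.inl ?_
    have : 0 < z.2 := hz
    positivity
  · refine Real.continuous_exp.comp_continuousOn ?_
    refine ContinuousOn.neg (ContinuousOn.div (by fun_prop) (by fun_prop) fun z hz => ?_)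
    have : 0 < z.2 := hz
    positivity

theorem continuousOn_gaussGrad :
    ContinuousOn (fun z : Space N × ℝ => gaussGrad z.1 z.2) (spaceTime N) := by
  unfold gaussGrad
  refine ContinuousOn.smul (ContinuousOn.neg (continuousOn_gaussKernel.div (by fun_prop) ?_))
    (by fun_prop)
  intro z hz
  have : 0 < z.2 := hz
  positivity

theorem gaussKernel_le (x : Space N) {t : ℝ} (ht : 0 < t) :
    gaussKernel x t ≤ (4 * Real.pi * t) ^ (-((N : ℝ) / 2)) := by
  unfold gaussKernel
  refine mul_le_of_le_one_right (by positivity) ?_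
  rw [Real.exp_le_one_iff]
  have : 0 ≤ ‖x‖ ^ 2 / (4 * t) := by positivity
  linarith

/-- Half of the Gaussian exponent is set aside as a factor exp(-|x|²/(8t)). That factor later
absorbs any power of |x|/√t, at the price of doubling the time. -/
theorem gaussKernel_eq_two_mul (x : Space N) {t : ℝ} (ht : 0 < t) :
    gaussKernel x t =
      2 ^ ((N : ℝ) / 2) * Real.exp (-(‖x‖ ^ 2 / (8 * t))) * gaussKernel x (2 * t) := by
  unfold gaussKernel
  have h1 : (4 * Real.pi * (2 * t)) ^ (-((N : ℝ) / 2)) =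
      2 ^ (-((N : ℝ) / 2)) * (4 * Real.pi * t) ^ (-((N : ℝ) / 2)) := by
    rw [← Real.mul_rpow (by norm_num) (by positivity)]
    congr 1; ring
  have h2 : (2 : ℝ) ^ ((N : ℝ) / 2) * 2 ^ (-((N : ℝ) / 2)) = 1 := by
    rw [← Real.rpow_add (by norm_num)]; simp
  have h3 : Real.exp (-(‖x‖ ^ 2 / (4 * t))) =
      Real.exp (-(‖x‖ ^ 2 / (8 * t))) * Real.exp (-(‖x‖ ^ 2 / (4 * (2 * t)))) := by
    rw [← Real.exp_add]; congr 1; field_simp; ring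
  rw [h1, h3]
  linear_combination (-(4 * Real.pi * t) ^ (-((N : ℝ) / 2)) *
    (Real.exp (-(‖x‖ ^ 2 / (8 * t))) * Real.exp (-(‖x‖ ^ 2 / (4 * (2 * t)))))) * h2

theorem gaussKernel_le_two_mul (x : Space N) {t : ℝ} (ht : 0 < t) :
    gaussKernel x t ≤ 2 ^ ((N : ℝ) / 2) * gaussKernel x (2 * t) := by
  rw [gaussKernel_eq_two_mul x ht]
  refine mul_le_mul_of_nonneg_right ?_ (gaussKernel_nonneg _ _ (by positivity))
  refine mul_le_of_le_one_right (by positivity) ?_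
  rw [Real.exp_le_one_iff]
  have : 0 ≤ ‖x‖ ^ 2 / (8 * t) := by positivity
  linarith

theorem norm_gaussGrad_le (x : Space N) {t : ℝ} (ht : 0 < t) :
    ‖gaussGrad x t‖ ≤ 2 ^ ((N : ℝ) / 2) * t ^ (-(1 / 2 : ℝ)) * gaussKernel x (2 * t) := by
  have hG := gaussKernel_nonneg x (2 * t) (by positivity)
  have hG' := gaussKernel_nonneg x t ht
  rw [gaussGrad, norm_smul, norm_neg, Real.norm_of_nonneg (by positivity),
    gaussKernel_eq_two_mul x ht]
  have hs : t ^ (-(1 / 2 : ℝ)) = (√t)⁻¹ := by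
    rw [Real.rpow_neg ht.le, Real.sqrt_eq_rpow]
  have hst : 0 < √t := Real.sqrt_pos.2 ht
  -- With r = |x|/√t this is r/2 ≤ exp(r²/8), which follows from 1 + y ≤ exp y and (r-2)² ≥ 0.
  have key : Real.exp (-(‖x‖ ^ 2 / (8 * t))) * (‖x‖ / (2 * t)) ≤ (√t)⁻¹ := by
    rw [Real.exp_neg, inv_mul_le_iff₀ (Real.exp_pos _)]
    have h1 : ‖x‖ / (2 * t) = (‖x‖ / √t / 2) * (√t)⁻¹ := by
      field_simp; rw [Real.sq_sqrt ht.le]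
    rw [h1]
    refine mul_le_mul_of_nonneg_right ?_ (by positivity)
    have h2 : ‖x‖ ^ 2 / (8 * t) = (‖x‖ / √t) ^ 2 / 8 := by
      rw [div_pow, Real.sq_sqrt ht.le]; field_simp
    rw [h2]
    have := Real.add_one_le_exp ((‖x‖ / √t) ^ 2 / 8)
    nlinarith [sq_nonneg (‖x‖ / √t - 2)]
  rw [hs]
  calc _ = 2 ^ ((N : ℝ) / 2) * (Real.exp (-(‖x‖ ^ 2 / (8 * t))) * (‖x‖ / (2 * t))) *
        gaussKernel x (2 * t) := by ring
    _ ≤ _ := by gcongr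

theorem hasGradientAt_gaussKernel (x : Space N) (t : ℝ) :
    HasGradientAt (fun y : Space N => gaussKernel y t) (gaussGrad x t) x := by
  rw [hasGradientAt_iff_hasFDerivAt]
  unfold gaussKernel
  have h1 : HasFDerivAt (fun y : Space N => ‖y‖ ^ 2) (2 • (innerSL ℝ x)) x :=
    (hasStrictFDerivAt_norm_sq x).hasFDerivAt
  have h2 := (((h1.mul_const (4 * t)⁻¹).neg).exp).const_mul
    ((4 * Real.pi * t) ^ (-((N : ℝ) / 2)))
  refine (h2.congr_fderiv ?_)
  ext y
  simp [gaussGrad, gaussKernel, div_eq_mul_inv]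
  ring

theorem integral_gaussKernel {t : ℝ} (ht : 0 < t) : ∫ x : Space N, gaussKernel x t = 1 := by
  unfold gaussKernel
  rw [integral_const_mul]
  have h1 : ∀ x : Space N, Real.exp (-(‖x‖ ^ 2 / (4 * t))) =
      Real.exp (-(1 / (4 * t)) * ‖x‖ ^ 2) := fun x => by congr 1; ring
  simp_rw [h1]
  rw [GaussianFourier.integral_rexp_neg_mul_sq_norm (by positivity)]
  have h2 : Real.pi / (1 / (4 * t)) = 4 * Real.pi * t := by field_simp
  rw [h2, finrank_euclideanSpace, Fintype.card_fin, ← Real.rpow_add (by positivity)]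
  simp

theorem integrable_gaussKernel {t : ℝ} (ht : 0 < t) :
    Integrable (fun x : Space N => gaussKernel x t) :=
  integrable_of_integral_eq_one (integral_gaussKernel ht)

/-- The Gauss kernel with values in `[0, ∞]`. -/
noncomputable def gaussE (x : Space N) (t : ℝ) : ℝ≥0∞ := ENNReal.ofReal (gaussKernel x t)

theorem measurable_gaussE : Measurable (fun z : Space N × ℝ => gaussE z.1 z.2) :=
  measurable_gaussKernel.ennreal_ofReal

@[fun_prop]
theorem _root_.Measurable.gaussE {α : Type*} [MeasurableSpace α] {a : α → Space N} {b : α → ℝ}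
    (ha : Measurable a) (hb : Measurable b) : Measurable (fun z => gaussE (a z) (b z)) :=
  measurable_gaussE.comp (ha.prodMk hb)

theorem lintegral_gaussE {t : ℝ} (ht : 0 < t) : ∫⁻ x : Space N, gaussE x t = 1 := by
  unfold gaussE
  rw [← ofReal_integral_eq_lintegral_ofReal (integrable_gaussKernel ht)
    (Eventually.of_forall fun x => gaussKernel_nonneg x t ht), integral_gaussKernel ht]
  simp

theorem lintegral_gaussE_sub (y : Space N) {t : ℝ} (ht : 0 < t) :
    ∫⁻ x : Space N, gaussE (x - y) t = 1 := by
  rw [lintegral_sub_right_eq_self (fun x => gaussE x t) y, lintegral_gaussE ht]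

theorem gaussE_le (x : Space N) {t : ℝ} (ht : 0 < t) :
    gaussE x t ≤ ENNReal.ofReal ((4 * Real.pi * t) ^ (-((N : ℝ) / 2))) :=
  ENNReal.ofReal_le_ofReal (gaussKernel_le x ht)

/-- Chapman–Kolmogorov identity, pointwise: completing the square. -/
theorem gaussKernel_mul_gaussKernel (x y ξ : Space N) {t s : ℝ} (ht : 0 < t) (hs : 0 < s) :
    gaussKernel (x - ξ) t * gaussKernel (ξ - y) s =
      gaussKernel (x - y) (t + s) *
        gaussKernel (ξ - (y + (s / (t + s)) • (x - y))) (t * s / (t + s)) := by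
  unfold gaussKernel
  have hA : (4 * Real.pi * t) ^ (-((N : ℝ) / 2)) * (4 * Real.pi * s) ^ (-((N : ℝ) / 2)) =
      (4 * Real.pi * (t + s)) ^ (-((N : ℝ) / 2)) *
        (4 * Real.pi * (t * s / (t + s))) ^ (-((N : ℝ) / 2)) := by
    rw [← Real.mul_rpow (by positivity) (by positivity),
      ← Real.mul_rpow (by positivity) (by positivity)]
    congr 1; field_simp
  have hB : Real.exp (-(‖x - ξ‖ ^ 2 / (4 * t))) * Real.exp (-(‖ξ - y‖ ^ 2 / (4 * s))) =
      Real.exp (-(‖x - y‖ ^ 2 / (4 * (t + s)))) *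
        Real.exp (-(‖ξ - (y + (s / (t + s)) • (x - y))‖ ^ 2 / (4 * (t * s / (t + s))))) := by
    rw [← Real.exp_add, ← Real.exp_add]
    congr 1
    have e1 : x - ξ = (x - y) - (ξ - y) := by abel
    have e2 : ξ - (y + (s / (t + s)) • (x - y)) = (ξ - y) - (s / (t + s)) • (x - y) := by abel
    rw [e1, e2, norm_sub_sq_real (x - y), norm_sub_sq_real (ξ - y), inner_smul_right, norm_smul,
      real_inner_comm (ξ - y) (x - y), Real.norm_of_nonneg (by positivity)]
    field_simp
    ring
  calc _ = ((4 * Real.pi * t) ^ (-((N : ℝ) / 2)) * (4 * Real.pi * s) ^ (-((N : ℝ) / 2))) *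
        (Real.exp (-(‖x - ξ‖ ^ 2 / (4 * t))) * Real.exp (-(‖ξ - y‖ ^ 2 / (4 * s)))) := by ring
    _ = _ := by rw [hA, hB]; ring

theorem integral_gaussKernel_mul (x y : Space N) {t s : ℝ} (ht : 0 < t) (hs : 0 < s) :
    ∫ ξ, gaussKernel (x - ξ) t * gaussKernel (ξ - y) s = gaussKernel (x - y) (t + s) := by
  simp_rw [gaussKernel_mul_gaussKernel x y _ ht hs]
  rw [integral_const_mul,
    integral_sub_right_eq_self (fun ξ : Space N => gaussKernel ξ (t * s / (t + s))),
    integral_gaussKernel (by positivity), mul_one]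

theorem lintegral_gaussE_mul (x y : Space N) {t s : ℝ} (ht : 0 < t) (hs : 0 < s) :
    ∫⁻ ξ, gaussE (x - ξ) t * gaussE (ξ - y) s = gaussE (x - y) (t + s) := by
  unfold gaussE
  simp_rw [← ENNReal.ofReal_mul (gaussKernel_nonneg _ _ ht),
    gaussKernel_mul_gaussKernel x y _ ht hs,
    ENNReal.ofReal_mul (gaussKernel_nonneg _ _ (add_pos ht hs))]
  rw [lintegral_const_mul' _ _ ENNReal.ofReal_ne_top]
  have := lintegral_gaussE_sub (y + (s / (t + s)) • (x - y))
    (show 0 < t * s / (t + s) by positivity)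
  unfold gaussE at this
  rw [this, mul_one]

/-- Parabolic self-similarity turns the limit t → ∞ into a limit at the fixed time 1. -/
theorem gaussKernel_scale (y : Space N) {t τ : ℝ} (ht : 0 < t) (hτ : 0 < τ) :
    gaussKernel (√t • y) (t * τ) = t ^ (-((N : ℝ) / 2)) * gaussKernel y τ := by
  unfold gaussKernel
  have h1 : 4 * Real.pi * (t * τ) = t * (4 * Real.pi * τ) := by ring
  rw [h1, Real.mul_rpow ht.le (by positivity), norm_smul, mul_pow,
    Real.norm_of_nonneg (Real.sqrt_nonneg t), Real.sq_sqrt ht.le, mul_assoc]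
  congr 3
  field_simp

/-- An integrable majorant uniform in z and τ, for dominated convergence after rescaling. It comes
from |y-z|² ≥ |y|²/2 - 1 and 4τ ≤ 8. -/
theorem gaussKernel_le_exp_of_near (y z : Space N) {τ : ℝ} (hz : ‖z‖ ≤ 1) (h1 : 1 / 2 ≤ τ)
    (h2 : τ ≤ 2) :
    gaussKernel (y - z) τ ≤
      ((2 * Real.pi) ^ (-((N : ℝ) / 2)) * Real.exp (1 / 8)) *
        Real.exp (-(1 / 16) * ‖y‖ ^ 2) := by
  unfold gaussKernel
  rw [mul_assoc ((2 * Real.pi) ^ (-((N : ℝ) / 2))), ← Real.exp_add]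
  have hN : -((N : ℝ) / 2) ≤ 0 := by
    have : (0 : ℝ) ≤ N := Nat.cast_nonneg N
    linarith
  refine mul_le_mul ?_ ?_ (Real.exp_pos _).le (by positivity)
  · refine Real.rpow_le_rpow_of_nonpos (by positivity) ?_ hN
    nlinarith [Real.pi_pos]
  · rw [Real.exp_le_exp]
    have h3 : ‖y‖ ^ 2 / 2 - 1 ≤ ‖y - z‖ ^ 2 := by
      have h4 : ‖y‖ ≤ ‖y - z‖ + ‖z‖ := by
        simpa using norm_add_le (y - z) z
      have h5 : ‖y‖ ^ 2 ≤ (‖y - z‖ + ‖z‖) ^ 2 := by gcongr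
      nlinarith [sq_nonneg (‖y - z‖ - ‖z‖), norm_nonneg z]
    have h4 : ‖y - z‖ ^ 2 / 8 ≤ ‖y - z‖ ^ 2 / (4 * τ) :=
      div_le_div_of_nonneg_left (by positivity) (by positivity) (by linarith)
    linarith

/-- In the variable y = x/√t the two kernels become G(y - ξ/√t, 1 - s/t) and G(y, 1 + 1/t). Both
tend to G(y,1), and the L¹ norm is scale invariant. -/
theorem tendsto_gaussKernel_sub_L1 (ξ : Space N) (s : ℝ) :
    Tendsto (fun t : ℝ => ∫⁻ x, ‖gaussKernel (x - ξ) (t - s) - gaussKernel x (1 + t)‖ₑ)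
      atTop (𝓝 0) := by
  have hscale : ∀ᶠ t : ℝ in atTop,
      ∫ y, ‖gaussKernel (y - (√t)⁻¹ • ξ) (1 - s / t) - gaussKernel y (1 + 1 / t)‖ =
      ∫ x, ‖gaussKernel (x - ξ) (t - s) - gaussKernel x (1 + t)‖ := by
    filter_upwards [eventually_gt_atTop (max s 0)] with t ht
    have ht0 : 0 < t := (le_max_right _ _).trans_lt ht
    have hts : s < t := (le_max_left _ _).trans_lt ht
    have hst : 0 < √t := Real.sqrt_pos.2 ht0
    have h1 := Measure.integral_comp_smul_of_nonneg (volume : Measure (Space N))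
      (fun x => ‖gaussKernel (x - ξ) (t - s) - gaussKernel x (1 + t)‖) (√t) (hR := hst.le)
    have h2 : ∀ y : Space N,
        ‖gaussKernel (√t • y - ξ) (t - s) - gaussKernel (√t • y) (1 + t)‖ =
        t ^ (-((N : ℝ) / 2)) *
          ‖gaussKernel (y - (√t)⁻¹ • ξ) (1 - s / t) - gaussKernel y (1 + 1 / t)‖ := by
      intro y
      have e1 : √t • y - ξ = √t • (y - (√t)⁻¹ • ξ) := by
        rw [smul_sub, smul_inv_smul₀ hst.ne']
      have e2 : t - s = t * (1 - s / t) := by field_simp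
      have e3 : 1 + t = t * (1 + 1 / t) := by field_simp; ring
      rw [e1, e2, e3, gaussKernel_scale _ ht0, gaussKernel_scale _ ht0 (by positivity), ← mul_sub,
        norm_mul, Real.norm_of_nonneg (by positivity)]
      rw [sub_pos, div_lt_one ht0]; exact hts
    simp_rw [h2] at h1
    rw [integral_const_mul, finrank_euclideanSpace, Fintype.card_fin, smul_eq_mul] at h1
    have h3 : (√t ^ N)⁻¹ = t ^ (-((N : ℝ) / 2)) := by
      rw [Real.sqrt_eq_rpow, ← Real.rpow_natCast, ← Real.rpow_mul ht0.le, Real.rpow_neg ht0.le]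
      congr 2; ring
    rw [h3] at h1
    exact mul_left_cancel₀ (by positivity) h1
  have hz : Tendsto (fun t : ℝ => (√t)⁻¹ • ξ) atTop (𝓝 0) := by
    have : Tendsto (fun t : ℝ => (√t)⁻¹) atTop (𝓝 0) :=
      tendsto_inv_atTop_zero.comp Real.tendsto_sqrt_atTop
    simpa using this.smul_const ξ
  have hτ1 : Tendsto (fun t : ℝ => 1 - s / t) atTop (𝓝 1) := by
    simpa using (tendsto_const_nhds (x := (1 : ℝ))).sub (tendsto_const_nhds.div_atTop tendsto_id)
  have hτ2 : Tendsto (fun t : ℝ => 1 + 1 / t) atTop (𝓝 1) := by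
    simpa using (tendsto_const_nhds (x := (1 : ℝ))).add tendsto_inv_atTop_zero
  have hlim : Tendsto (fun t : ℝ =>
      ∫ y, ‖gaussKernel (y - (√t)⁻¹ • ξ) (1 - s / t) - gaussKernel y (1 + 1 / t)‖)
      atTop (𝓝 0) := by
    have hb : Integrable (fun y : Space N =>
        2 * (((2 * Real.pi) ^ (-((N : ℝ) / 2)) * Real.exp (1 / 8)) *
          Real.exp (-(1 / 16) * ‖y‖ ^ 2))) := by
      refine (Integrable.const_mul ?_ _).const_mul _
      -- The function exp(-|y|²/16) is a multiple of the Gauss kernel at time 4.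
      refine ((integrable_gaussKernel (N := N) (t := 4) (by norm_num)).const_mul
        ((4 * Real.pi * 4) ^ (-((N : ℝ) / 2)))⁻¹).congr (Eventually.of_forall fun y => ?_)
      simp only [gaussKernel]
      rw [inv_mul_cancel_left₀ (by positivity)]
      congr 1; ring
    have := tendsto_integral_filter_of_dominated_convergence
      (F := fun (t : ℝ) (y : Space N) =>
        ‖gaussKernel (y - (√t)⁻¹ • ξ) (1 - s / t) - gaussKernel y (1 + 1 / t)‖)
      (f := fun _ => (0 : ℝ)) (l := atTop) (μ := volume) _ ?_ ?_ hb ?_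
    · simpa using this
    · refine Eventually.of_forall fun t => Measurable.aestronglyMeasurable ?_
      have h1 : Measurable fun y : Space N => gaussKernel (y - (√t)⁻¹ • ξ) (1 - s / t) :=
        measurable_gaussKernel.comp (by fun_prop : Measurable fun y : Space N =>
          (y - (√t)⁻¹ • ξ, 1 - s / t))
      have h2 : Measurable fun y : Space N => gaussKernel y (1 + 1 / t) :=
        measurable_gaussKernel.comp (by fun_prop : Measurable fun y : Space N => (y, 1 + 1 / t))
      exact (h1.sub h2).norm
    · have hz' : ∀ᶠ t : ℝ in atTop, ‖(√t)⁻¹ • ξ‖ ≤ 1 := by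
        have := hz.norm
        rw [norm_zero] at this
        exact this.eventually_le_const one_pos
      filter_upwards [hz', hτ1.eventually (Icc_mem_nhds (by norm_num : (1 / 2 : ℝ) < 1)
        (by norm_num : (1 : ℝ) < 2)), hτ2.eventually (Icc_mem_nhds (by norm_num : (1 / 2 : ℝ) < 1)
        (by norm_num : (1 : ℝ) < 2))] with t h1 h2 h3
      refine Eventually.of_forall fun y => ?_
      rw [norm_norm]
      refine (norm_sub_le _ _).trans ?_
      have hA := gaussKernel_le_exp_of_near y _ h1 h2.1 h2.2
      have hB := gaussKernel_le_exp_of_near y 0 (by simp) h3.1 h3.2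
      rw [sub_zero] at hB
      rw [Real.norm_of_nonneg (gaussKernel_nonneg _ _ (by linarith [h2.1])),
        Real.norm_of_nonneg (gaussKernel_nonneg _ _ (by linarith [h3.1]))]
      linarith
    · refine Eventually.of_forall fun y => ?_
      have hc : ContinuousAt (fun z : Space N × ℝ => gaussKernel z.1 z.2) (y, 1) :=
        continuousOn_gaussKernel.continuousAt (isOpen_spaceTime.mem_nhds
          (show (0 : ℝ) < 1 from one_pos))
      have h1 : Tendsto (fun t : ℝ => (y - (√t)⁻¹ • ξ, 1 - s / t)) atTop (𝓝 (y, 1)) := by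
        have := (tendsto_const_nhds (x := y)).sub hz
        rw [sub_zero] at this
        exact this.prodMk_nhds hτ1
      have h2 : Tendsto (fun t : ℝ => (y, 1 + 1 / t)) atTop (𝓝 (y, 1)) :=
        (tendsto_const_nhds).prodMk_nhds hτ2
      have := ((hc.tendsto.comp h1).sub (hc.tendsto.comp h2)).norm
      simpa using this
  have hlim' := (hlim.congr' hscale)
  have h0 : Tendsto (fun t : ℝ => ENNReal.ofReal
      (∫ x, ‖gaussKernel (x - ξ) (t - s) - gaussKernel x (1 + t)‖)) atTop (𝓝 0) := by
    simpa using ENNReal.tendsto_ofReal hlim'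
  refine h0.congr' ?_
  filter_upwards [eventually_gt_atTop (max s 0)] with t ht
  have ht0 : 0 < t := (le_max_right _ _).trans_lt ht
  have hts : s < t := (le_max_left _ _).trans_lt ht
  exact ofReal_integral_norm_eq_lintegral_enorm
    (((integrable_gaussKernel (sub_pos.2 hts)).comp_sub_right ξ).sub
      (integrable_gaussKernel (by positivity)))

end Kernel

/-! ### The heat flow of nonnegative data: semigroup law, smoothing, moments. -/

section Heat

variable {N : ℕ}

/-- The heat semigroup on `[0, ∞]`-valued functions. -/
noncomputable def heat (t : ℝ) (ψ : Space N → ℝ≥0∞) (x : Space N) : ℝ≥0∞ :=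
  ∫⁻ y, gaussE (x - y) t * ψ y

variable {ψ : Space N → ℝ≥0∞}

theorem measurable_heat_uncurry (hψ : Measurable ψ) :
    Measurable (fun z : Space N × ℝ => heat z.2 ψ z.1) := by
  unfold heat
  exact Measurable.lintegral_prod_right' (f := fun p : (Space N × ℝ) × Space N =>
    gaussE (p.1.1 - p.2) p.1.2 * ψ p.2) (by fun_prop)

theorem measurable_heat_comp {α : Type*} [MeasurableSpace α] {a : α → Space N} {b : α → ℝ}
    (hψ : Measurable ψ) (hb : Measurable b) (ha : Measurable a) :
    Measurable (fun z : α => heat (b z) ψ (a z)) := by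
  have h1 : Measurable fun z => (a z, b z) := ha.prodMk hb
  have h2 := (measurable_heat_uncurry hψ).comp h1
  exact h2

/-- Tonelli and Chapman–Kolmogorov. This identity lets a heat-flow majorant pass through the Duhamel
integral unchanged. -/
theorem heat_heat (hψ : Measurable ψ) {t s : ℝ} (ht : 0 < t) (hs : 0 < s) (x : Space N) :
    heat t (fun y => heat s ψ y) x = heat (t + s) ψ x := by
  unfold heat
  have h1 : ∀ y, gaussE (x - y) t * ∫⁻ z, gaussE (y - z) s * ψ z =
      ∫⁻ z, gaussE (x - y) t * (gaussE (y - z) s * ψ z) := fun y =>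
    (lintegral_const_mul' _ _ ENNReal.ofReal_ne_top).symm
  simp_rw [h1]
  rw [lintegral_lintegral_swap (by unfold Function.uncurry; fun_prop)]
  refine lintegral_congr fun z => ?_
  simp_rw [← mul_assoc]
  rw [lintegral_mul_const _ (by fun_prop), lintegral_gaussE_mul x z ht hs]

theorem lintegral_heat (hψ : Measurable ψ) {t : ℝ} (ht : 0 < t) :
    ∫⁻ x, heat t ψ x = ∫⁻ y, ψ y := by
  unfold heat
  rw [lintegral_lintegral_swap (by unfold Function.uncurry; fun_prop)]
  refine lintegral_congr fun y => ?_
  rw [lintegral_mul_const _ (by fun_prop), lintegral_gaussE_sub y ht, one_mul]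

theorem heat_le (ψ : Space N → ℝ≥0∞) {t : ℝ} (ht : 0 < t) (x : Space N) :
    heat t ψ x ≤ ENNReal.ofReal ((4 * Real.pi * t) ^ (-((N : ℝ) / 2))) * ∫⁻ y, ψ y := by
  unfold heat
  rw [← lintegral_const_mul' _ _ ENNReal.ofReal_ne_top]
  gcongr with y
  exact gaussE_le _ ht

theorem heat_lt_top (hψ : ∫⁻ y, ψ y ≠ ∞) {t : ℝ} (ht : 0 < t) (x : Space N) :
    heat t ψ x < ∞ :=
  (heat_le ψ ht x).trans_lt (ENNReal.mul_lt_top ENNReal.ofReal_lt_top hψ.lt_top)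

/-- Interpolation between L¹ and L^∞, from g^q ≤ B^(q-1) g when q is finite. -/
theorem eLpNorm_le_of_le_of_lintegral_le {α : Type*} [MeasurableSpace α] {μ : Measure α}
    {g : α → ℝ≥0∞} {B I : ℝ≥0∞} (hBt : B ≠ ∞) (hB : ∀ x, g x ≤ B) (hI : ∫⁻ x, g x ∂μ ≤ I)
    {q : ℝ≥0∞} (hq : 1 ≤ q) :
    eLpNorm g q μ ≤ B ^ (1 - (q⁻¹).toReal) * I ^ (q⁻¹).toReal := by
  rcases eq_or_ne q ∞ with rfl | hq'
  · simp only [ENNReal.inv_top, ENNReal.toReal_zero, sub_zero, ENNReal.rpow_one,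
      ENNReal.rpow_zero, mul_one, eLpNorm_exponent_top]
    exact essSup_le_of_ae_le _ (Eventually.of_forall hB)
  have hq0 : q ≠ 0 := (zero_lt_one.trans_le hq).ne'
  have hr : 1 ≤ q.toReal := by
    rw [← ENNReal.toReal_one]; exact ENNReal.toReal_mono hq' hq
  have hr0 : 0 < q.toReal := by linarith
  rw [eLpNorm_eq_lintegral_rpow_enorm_toReal hq0 hq', ENNReal.toReal_inv, one_div]
  have h1 : ∫⁻ x, ‖g x‖ₑ ^ q.toReal ∂μ ≤ B ^ (q.toReal - 1) * I := by
    calc ∫⁻ x, ‖g x‖ₑ ^ q.toReal ∂μ ≤ ∫⁻ x, B ^ (q.toReal - 1) * g x ∂μ := by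
          gcongr with x
          rw [enorm_eq_self]
          calc g x ^ q.toReal = g x ^ (q.toReal - 1) * g x ^ (1 : ℝ) := by
                rw [← ENNReal.rpow_add_of_nonneg _ _ (by linarith) zero_le_one]
                congr 1; ring
            _ ≤ B ^ (q.toReal - 1) * g x := by
                rw [ENNReal.rpow_one]
                refine mul_le_mul_left ?_ _
                exact ENNReal.rpow_le_rpow (hB x) (by linarith)
      _ = B ^ (q.toReal - 1) * ∫⁻ x, g x ∂μ :=
          lintegral_const_mul' _ _ (ENNReal.rpow_ne_top_of_nonneg (by linarith) hBt)
      _ ≤ _ := by gcongr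
  calc (∫⁻ x, ‖g x‖ₑ ^ q.toReal ∂μ) ^ q.toReal⁻¹
      ≤ (B ^ (q.toReal - 1) * I) ^ q.toReal⁻¹ := by gcongr
    _ = B ^ (1 - q.toReal⁻¹) * I ^ q.toReal⁻¹ := by
        rw [ENNReal.mul_rpow_of_nonneg _ _ (by positivity), ← ENNReal.rpow_mul]
        congr 2; field_simp

theorem decayRate_nonneg (N : ℕ) {q : ℝ≥0∞} (hq : 1 ≤ q) : 0 ≤ decayRate N q := by
  have h1 : (q⁻¹).toReal ≤ 1 := by
    rw [← ENNReal.toReal_one]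
    exact ENNReal.toReal_mono ENNReal.one_ne_top (ENNReal.inv_le_one.2 hq)
  unfold decayRate
  have : (0 : ℝ) ≤ 1 - (q⁻¹).toReal := by linarith
  positivity

/-- Interpolates between the sup bound and conservation of mass. The two powers of the mass add up
to one, and the factor (4π)^(-decayRate) is at most 1 and is dropped. -/
theorem eLpNorm_heat_le (hψ : Measurable ψ) {t : ℝ} (ht : 0 < t) {q : ℝ≥0∞} (hq : 1 ≤ q) :
    ENNReal.ofReal (t ^ decayRate N q) * eLpNorm (heat t ψ) q volume ≤ ∫⁻ y, ψ y := by
  rcases eq_or_ne (∫⁻ y, ψ y) ∞ with hI | hI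
  · rw [hI]; exact le_top
  have h1 : (q⁻¹).toReal ≤ 1 := by
    rw [← ENNReal.toReal_one]
    exact ENNReal.toReal_mono ENNReal.one_ne_top (ENNReal.inv_le_one.2 hq)
  have h2 := eLpNorm_le_of_le_of_lintegral_le
    (ENNReal.mul_ne_top ENNReal.ofReal_ne_top hI) (heat_le ψ ht) (lintegral_heat hψ ht).le hq
  refine (mul_le_mul_right h2 _).trans ?_
  rw [ENNReal.mul_rpow_of_nonneg _ _ (by linarith), mul_assoc,
    ← ENNReal.rpow_add_of_nonneg _ _ (by linarith) ENNReal.toReal_nonneg, sub_add_cancel,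
    ENNReal.rpow_one, ← mul_assoc, ENNReal.ofReal_rpow_of_nonneg (by positivity) (by linarith),
    ← ENNReal.ofReal_mul (by positivity), ← Real.rpow_mul (by positivity)]
  refine mul_le_of_le_one_left zero_le ?_
  rw [← ENNReal.ofReal_one]
  refine ENNReal.ofReal_le_ofReal ?_
  have e : -((N : ℝ) / 2) * (1 - (q⁻¹).toReal) = -decayRate N q := by unfold decayRate; ring
  rw [e, Real.rpow_neg (by positivity), ← div_eq_mul_inv]
  refine div_le_one_of_le₀ ?_ (by positivity)
  refine Real.rpow_le_rpow ht.le ?_ (decayRate_nonneg N hq)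
  nlinarith [Real.pi_gt_three]

/-- Apply z ≤ exp z to z = (1+y)/(2(l+1)); after the l-th power the exponent is at most (1+y)/2 ≤ 1
+ y²/8. The coefficient 1/8 matches the exponential set aside in `gaussKernel_eq_two_mul`. -/
theorem one_add_rpow_le_exp {l y : ℝ} (hl : 0 ≤ l) (hy : 0 ≤ y) :
    (1 + y) ^ l ≤ (2 * (l + 1)) ^ l * Real.exp (1 + y ^ 2 / 8) := by
  have h1 : 1 + y ≤ 2 * (l + 1) * Real.exp ((1 + y) / (2 * (l + 1))) := by
    have h := Real.add_one_le_exp ((1 + y) / (2 * (l + 1)))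
    have h2 : (1 + y) / (2 * (l + 1)) ≤ Real.exp ((1 + y) / (2 * (l + 1))) := by linarith
    rwa [div_le_iff₀' (by positivity)] at h2
  calc (1 + y) ^ l ≤ (2 * (l + 1) * Real.exp ((1 + y) / (2 * (l + 1)))) ^ l := by gcongr
    _ = (2 * (l + 1)) ^ l * Real.exp ((1 + y) / (2 * (l + 1)) * l) := by
        rw [Real.mul_rpow (by positivity) (Real.exp_pos _).le, Real.exp_mul]
    _ ≤ _ := by
        gcongr
        have h3 : (1 + y) / (2 * (l + 1)) * l ≤ (1 + y) / 2 := by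
          rw [div_mul_eq_mul_div, div_le_div_iff₀ (by positivity) (by norm_num)]
          nlinarith
        nlinarith [sq_nonneg (y - 2)]

/-- Moments of the Gauss kernel. -/
theorem exists_lintegral_weight_gaussE_le (N : ℕ) {l : ℝ} (hl : 0 ≤ l) :
    ∃ c : ℝ, 0 ≤ c ∧ ∀ t : ℝ, 0 < t →
      ∫⁻ z : Space N, ENNReal.ofReal ((1 + ‖z‖) ^ l) * gaussE z t ≤
        ENNReal.ofReal (c * (1 + t) ^ (l / 2)) := by
  refine ⟨2 ^ l * ((2 * (l + 1)) ^ l * Real.exp 1) * 2 ^ ((N : ℝ) / 2), by positivity,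
    fun t ht => ?_⟩
  have hst : 0 < √t := Real.sqrt_pos.2 ht
  -- The weight is at most 2^l (1+t)^(l/2) (1 + |z|/√t)^l, and the last factor is absorbed by
  -- exp(-|z|²/(8t)).
  have key : ∀ z : Space N, (1 + ‖z‖) ^ l * gaussKernel z t ≤
      2 ^ l * ((2 * (l + 1)) ^ l * Real.exp 1) * 2 ^ ((N : ℝ) / 2) * (1 + t) ^ (l / 2) *
        gaussKernel z (2 * t) := by
    intro z
    have h1 : 1 + ‖z‖ ≤ 2 * (1 + t) ^ (1 / 2 : ℝ) * (1 + ‖z‖ / √t) := by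
      rw [← Real.sqrt_eq_rpow]
      have a1 : 1 ≤ √(1 + t) := by rw [Real.one_le_sqrt]; linarith
      have a2 : √t ≤ √(1 + t) := Real.sqrt_le_sqrt (by linarith)
      have a3 : ‖z‖ = √t * (‖z‖ / √t) := by field_simp
      have a4 : ‖z‖ ≤ √(1 + t) * (‖z‖ / √t) := by
        conv_lhs => rw [a3]
        gcongr
      have a5 : 0 ≤ √(1 + t) * (‖z‖ / √t) := by positivity
      nlinarith
    have h2 : (1 + ‖z‖) ^ l ≤ 2 ^ l * (1 + t) ^ (l / 2) *
        ((2 * (l + 1)) ^ l * Real.exp (1 + (‖z‖ / √t) ^ 2 / 8)) := by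
      calc (1 + ‖z‖) ^ l ≤ (2 * (1 + t) ^ (1 / 2 : ℝ) * (1 + ‖z‖ / √t)) ^ l := by gcongr
        _ = 2 ^ l * (1 + t) ^ (l / 2) * (1 + ‖z‖ / √t) ^ l := by
          rw [Real.mul_rpow (by positivity) (by positivity),
            Real.mul_rpow (by positivity) (by positivity), ← Real.rpow_mul (by positivity)]
          congr 3; ring
        _ ≤ _ := by
          gcongr
          exact one_add_rpow_le_exp hl (by positivity)
    rw [gaussKernel_eq_two_mul z ht]
    have h3 : (‖z‖ / √t) ^ 2 / 8 = ‖z‖ ^ 2 / (8 * t) := by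
      rw [div_pow, Real.sq_sqrt ht.le]; field_simp
    rw [h3, Real.exp_add] at h2
    have hE : Real.exp (‖z‖ ^ 2 / (8 * t)) * Real.exp (-(‖z‖ ^ 2 / (8 * t))) = 1 := by
      rw [← Real.exp_add]; simp
    have hG := gaussKernel_nonneg z (2 * t) (by positivity)
    calc _ ≤ 2 ^ l * (1 + t) ^ (l / 2) *
        ((2 * (l + 1)) ^ l * (Real.exp 1 * Real.exp (‖z‖ ^ 2 / (8 * t)))) *
        (2 ^ ((N : ℝ) / 2) * Real.exp (-(‖z‖ ^ 2 / (8 * t))) * gaussKernel z (2 * t)) := by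
          gcongr
      _ = 2 ^ l * (1 + t) ^ (l / 2) * (2 * (l + 1)) ^ l * Real.exp 1 * 2 ^ ((N : ℝ) / 2) *
          gaussKernel z (2 * t) *
          (Real.exp (‖z‖ ^ 2 / (8 * t)) * Real.exp (-(‖z‖ ^ 2 / (8 * t)))) := by ring
      _ = _ := by rw [hE]; ring
  calc _ ≤ ∫⁻ z : Space N, ENNReal.ofReal (2 ^ l * ((2 * (l + 1)) ^ l * Real.exp 1) *
        2 ^ ((N : ℝ) / 2) * (1 + t) ^ (l / 2)) * gaussE z (2 * t) := by
        refine lintegral_mono fun z => ?_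
        unfold gaussE
        rw [← ENNReal.ofReal_mul (by positivity), ← ENNReal.ofReal_mul (by positivity)]
        exact ENNReal.ofReal_le_ofReal (key z)
    _ = _ := by
        rw [lintegral_const_mul' _ _ ENNReal.ofReal_ne_top, lintegral_gaussE (by positivity),
          mul_one]

/-- The weight is submultiplicative, 1+|x| ≤ (1+|x-y|)(1+|y|), so the weighted norm of a convolution
is at most the product of the weighted norms. -/
theorem exists_lintegral_weight_heat_le (N : ℕ) {l : ℝ} (hl : 0 ≤ l) :
    ∃ c : ℝ, 0 ≤ c ∧ ∀ ψ : Space N → ℝ≥0∞, Measurable ψ → ∀ t : ℝ, 0 < t →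
      ∫⁻ x, ENNReal.ofReal ((1 + ‖x‖) ^ l) * heat t ψ x ≤
        ENNReal.ofReal (c * (1 + t) ^ (l / 2)) *
          ∫⁻ y, ENNReal.ofReal ((1 + ‖y‖) ^ l) * ψ y := by
  obtain ⟨c, hc, hct⟩ := exists_lintegral_weight_gaussE_le N hl
  refine ⟨c, hc, fun ψ hψ t ht => ?_⟩
  unfold heat
  simp_rw [← lintegral_const_mul' _ _ ENNReal.ofReal_ne_top]
  rw [lintegral_lintegral_swap (by unfold Function.uncurry; fun_prop)]
  refine lintegral_mono fun y => ?_
  have h1 : ∀ x : Space N, ENNReal.ofReal ((1 + ‖x‖) ^ l) * (gaussE (x - y) t * ψ y) ≤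
      (ENNReal.ofReal ((1 + ‖x - y‖) ^ l) * gaussE (x - y) t) *
        (ENNReal.ofReal ((1 + ‖y‖) ^ l) * ψ y) := by
    intro x
    have h2 : (1 + ‖x‖) ^ l ≤ (1 + ‖x - y‖) ^ l * (1 + ‖y‖) ^ l := by
      rw [← Real.mul_rpow (by positivity) (by positivity)]
      refine Real.rpow_le_rpow (by positivity) ?_ hl
      have h3 : ‖x‖ ≤ ‖x - y‖ + ‖y‖ := by simpa using norm_add_le (x - y) y
      nlinarith [norm_nonneg (x - y), norm_nonneg y,
        mul_nonneg (norm_nonneg (x - y)) (norm_nonneg y)]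
    calc _ ≤ ENNReal.ofReal ((1 + ‖x - y‖) ^ l * (1 + ‖y‖) ^ l) * (gaussE (x - y) t * ψ y) := by
          gcongr
      _ = _ := by rw [ENNReal.ofReal_mul (by positivity)]; ring
  refine (lintegral_mono h1).trans ?_
  rw [lintegral_mul_const _ (by fun_prop), lintegral_sub_right_eq_self
    (fun x : Space N => ENNReal.ofReal ((1 + ‖x‖) ^ l) * gaussE x t) y]
  gcongr
  exact hct t ht

end Heat

/-! ### The scalar Volterra operator in time. -/

section Rate

/-- The time factor in the bound of the nonlinearity along functions with
`|u| + t^(1/2) |∇u|` under control. -/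
noncomputable def rate (A s : ℝ) : ℝ :=
  (1 + s) ^ (-A) * (1 + (1 + s) ^ (1 / 2 : ℝ) * s ^ (-(1 / 2 : ℝ)))

variable {A : ℝ}

theorem measurable_rate : Measurable (rate A) := by unfold rate; fun_prop

theorem rate_nonneg {s : ℝ} (hs : 0 < s) : 0 ≤ rate A s := by unfold rate; positivity

theorem rate_le {s : ℝ} (hs : 0 < s) :
    rate A s ≤ 2 * ((1 + s) ^ (1 / 2 - A) * s ^ (-(1 / 2 : ℝ))) := by
  have h1 : (1 + s) ^ (-A) * (1 + s) ^ (1 / 2 : ℝ) = (1 + s) ^ (1 / 2 - A) := by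
    rw [← Real.rpow_add (by positivity)]; congr 1; ring
  have h2 : 1 ≤ (1 + s) ^ (1 / 2 : ℝ) * s ^ (-(1 / 2 : ℝ)) := by
    rw [Real.rpow_neg hs.le, ← div_eq_mul_inv, one_le_div (by positivity)]
    gcongr; linarith
  unfold rate
  rw [← h1]
  have h3 : 0 ≤ (1 + s) ^ (-A) := by positivity
  nlinarith

/-- The form suited to times comparable with t: an interval of length of order t compensates 1/s and
leaves the decay t^(1-A). -/
theorem rate_le_div {s : ℝ} (hs : 0 < s) : rate A s ≤ 2 * ((1 + s) ^ (1 - A) / s) := by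
  refine (rate_le hs).trans ?_
  have h1 : (1 + s) ^ (1 - A) = (1 + s) ^ (1 / 2 - A) * (1 + s) ^ (1 / 2 : ℝ) := by
    rw [← Real.rpow_add (by positivity)]; congr 1; ring
  have h2 : s ^ (-(1 / 2 : ℝ)) = s ^ (1 / 2 : ℝ) / s := by
    rw [eq_div_iff hs.ne']
    conv_lhs => rw [← Real.rpow_one s, ← Real.rpow_mul hs.le, ← Real.rpow_add hs]
    norm_num
  rw [h1, h2, mul_div_assoc]
  gcongr
  linarith

theorem rate_le_of_le (hA : 1 < A) {r s : ℝ} (hr : 0 < r) (hrs : r ≤ s) :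
    rate A s ≤ 2 * ((1 + r) ^ (1 - A) / r) := by
  refine (rate_le_div (hr.trans_le hrs)).trans ?_
  have : (1 + s) ^ (1 - A) ≤ (1 + r) ^ (1 - A) :=
    Real.rpow_le_rpow_of_nonpos (by positivity) (by linarith) (by linarith)
  gcongr

/-- The singularity at 0 is s^(-1/2), the decay at infinity is s^(-A). -/
theorem integrableOn_rate (hA : 1 < A) : IntegrableOn (rate A) (Ioi 0) := by
  have h01 : IntegrableOn (rate A) (Ioc 0 1) := by
    have h1 : IntegrableOn (fun s : ℝ => 2 * s ^ (-(1 / 2 : ℝ))) (Ioc 0 1) := by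
      have := intervalIntegral.intervalIntegrable_rpow' (a := 0) (b := 1)
        (r := -(1 / 2 : ℝ)) (by norm_num)
      rw [intervalIntegrable_iff_integrableOn_Ioc_of_le zero_le_one] at this
      exact this.const_mul 2
    refine Integrable.mono' h1 measurable_rate.aestronglyMeasurable ?_
    filter_upwards [ae_restrict_mem measurableSet_Ioc] with s hs
    rw [Real.norm_of_nonneg (rate_nonneg hs.1)]
    refine (rate_le hs.1).trans ?_
    have : (1 + s) ^ (1 / 2 - A) ≤ 1 :=
      Real.rpow_le_one_of_one_le_of_nonpos (by linarith [hs.1]) (by linarith)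
    have h2 : 0 ≤ s ^ (-(1 / 2 : ℝ)) := Real.rpow_nonneg hs.1.le _
    nlinarith
  have h1 : IntegrableOn (rate A) (Ioi 1) := by
    have h1 : IntegrableOn (fun s : ℝ => 2 * s ^ (-A)) (Ioi 1) :=
      (integrableOn_Ioi_rpow_of_lt (by linarith) one_pos).const_mul 2
    refine Integrable.mono' h1 measurable_rate.aestronglyMeasurable ?_
    filter_upwards [ae_restrict_mem measurableSet_Ioi] with s hs
    have hs0 : 0 < s := one_pos.trans hs
    rw [Real.norm_of_nonneg (rate_nonneg hs0)]
    refine (rate_le hs0).trans ?_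
    have h2 : s ^ (-A) = s ^ (1 / 2 - A) * s ^ (-(1 / 2 : ℝ)) := by
      rw [← Real.rpow_add hs0]; congr 1; ring
    rw [h2]
    have : (1 + s) ^ (1 / 2 - A) ≤ s ^ (1 / 2 - A) :=
      Real.rpow_le_rpow_of_nonpos hs0 (by linarith) (by linarith)
    gcongr
  rw [← Ioc_union_Ioi_eq_Ioi zero_le_one]
  exact h01.union h1

theorem lintegral_rpow_sub {a r t : ℝ} (ha : a < 1) (hrt : r < t) :
    ∫⁻ s in Ioo r t, ENNReal.ofReal ((t - s) ^ (-a)) =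
      ENNReal.ofReal ((t - r) ^ (1 - a) / (1 - a)) := by
  have h0 : IntervalIntegrable (fun s : ℝ => s ^ (-a)) volume (t - t) (t - r) :=
    intervalIntegral.intervalIntegrable_rpow' (by linarith)
  have h1 : IntegrableOn (fun s => (t - s) ^ (-a)) (Ioo r t) := by
    have := (h0.comp_sub_left t).symm
    simp only [sub_sub_cancel] at this
    rwa [intervalIntegrable_iff_integrableOn_Ioo_of_le hrt.le] at this
  rw [← ofReal_integral_eq_lintegral_ofReal h1]
  · congr 1
    rw [← integral_Ioc_eq_integral_Ioo, ← intervalIntegral.integral_of_le hrt.le,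
      intervalIntegral.integral_comp_sub_left (fun s => s ^ (-a)) t,
      integral_rpow (Or.inl (by linarith))]
    rw [sub_self, Real.zero_rpow (by linarith), sub_zero]
    congr 1
    · congr 1; ring
    · ring
  · filter_upwards [ae_restrict_mem measurableSet_Ioo] with s hs
    exact Real.rpow_nonneg (by linarith [hs.2]) _

theorem lintegral_rate_Ioo_le (hA : 1 < A) {a r t : ℝ} (ha : a < 1) (hr : 0 < r) (hrt : r < t) :
    ∫⁻ s in Ioo r t, ENNReal.ofReal ((t - s) ^ (-a) * rate A s) ≤
      ENNReal.ofReal (2 * ((1 + r) ^ (1 - A) / r) * ((t - r) ^ (1 - a) / (1 - a))) := by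
  rw [ENNReal.ofReal_mul (by positivity), ← lintegral_rpow_sub ha hrt,
    ← lintegral_const_mul' _ _ ENNReal.ofReal_ne_top]
  refine setLIntegral_mono_ae (by fun_prop) (Eventually.of_forall fun s hs => ?_)
  rw [← ENNReal.ofReal_mul (by positivity)]
  refine ENNReal.ofReal_le_ofReal ?_
  have h1 : 0 ≤ (t - s) ^ (-a) := Real.rpow_nonneg (by linarith [hs.2]) _
  rw [mul_comm]
  gcongr
  exact rate_le_of_le hA hr hs.1.le

/-- On (t/2,t) the rate is at most a multiple of (1+t/2)^(1-A)/t, while (t-s)^(-a) integrates to a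
multiple of t^(1-a). The surplus (1+t/2)^(1-A) is the vanishing factor. -/
theorem exists_tendsto_lintegral_rate_half (hA : 1 < A) {a : ℝ} (ha : a < 1) :
    ∃ η : ℝ → ℝ, Tendsto η atTop (𝓝 0) ∧ (∀ t, 0 < t → 0 ≤ η t) ∧ ∀ t, 0 < t →
      ∫⁻ s in Ioo (t / 2) t, ENNReal.ofReal ((t - s) ^ (-a) * rate A s) ≤
        ENNReal.ofReal (η t * t ^ (-a)) := by
  have ha' : 0 < 1 - a := by linarith
  refine ⟨fun t => 2 * 2 ^ a / (1 - a) * (1 + t / 2) ^ (1 - A), ?_, ?_, ?_⟩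
  · have h1 : Tendsto (fun t : ℝ => 1 + t / 2) atTop atTop :=
      tendsto_atTop_add_const_left _ _ (tendsto_id.atTop_div_const two_pos)
    have h2 := (tendsto_rpow_neg_atTop (sub_pos.2 hA)).comp h1
    have h3 := h2.const_mul (2 * 2 ^ a / (1 - a))
    rw [mul_zero] at h3
    refine h3.congr fun t => ?_
    simp only [Function.comp, neg_sub]
  · intro t ht; positivity
  · intro t ht
    refine (lintegral_rate_Ioo_le hA ha (half_pos ht) (by linarith)).trans (le_of_eq ?_)
    congr 1
    have e1 : t - t / 2 = t / 2 := by ring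
    have e2 : (t / 2) ^ (1 - a) = t / 2 * (2 ^ a * t ^ (-a)) := by
      rw [sub_eq_add_neg, Real.rpow_add (by positivity), Real.rpow_one,
        Real.div_rpow ht.le (by norm_num), Real.rpow_neg (by norm_num : (0 : ℝ) ≤ 2)]
      field_simp
    rw [e1, e2]
    field_simp

/-- The primitive of `rate`. -/
noncomputable def ratePrim (A t : ℝ) : ℝ := ∫ s in Ioc 0 t, rate A s

theorem ratePrim_mono (hA : 1 < A) : Monotone (ratePrim A) := by
  intro r t hrt
  refine setIntegral_mono_set ((integrableOn_rate hA).mono_set Ioc_subset_Ioi_self) ?_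
    (Ioc_subset_Ioc_right hrt).eventuallyLE
  filter_upwards [ae_restrict_mem measurableSet_Ioc] with s hs
  exact rate_nonneg hs.1

theorem ratePrim_nonneg (t : ℝ) : 0 ≤ ratePrim A t :=
  setIntegral_nonneg measurableSet_Ioc fun _ hs => rate_nonneg hs.1

theorem ratePrim_le (hA : 1 < A) (t : ℝ) : ratePrim A t ≤ ∫ s in Ioi 0, rate A s := by
  refine setIntegral_mono_set (integrableOn_rate hA) ?_ Ioc_subset_Ioi_self.eventuallyLE
  filter_upwards [ae_restrict_mem measurableSet_Ioi] with s hs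
  exact rate_nonneg hs

theorem continuousOn_rate : ContinuousOn (rate A) (Ioi 0) := by
  unfold rate
  have h1 : ContinuousOn (fun s : ℝ => 1 + s) (Ioi 0) := by fun_prop
  refine (h1.rpow_const fun s hs => Or.inl ?_).mul (continuousOn_const.add
    ((h1.rpow_const fun s hs => Or.inl ?_).mul (continuousOn_id.rpow_const fun s hs => Or.inl ?_)))
  · have : 0 < s := hs
    positivity
  · have : 0 < s := hs
    positivity
  · exact (show 0 < s from hs).ne'

/-- The integrand is the derivative of exp(c ∫ rate)/c. As `rate` is singular at 0, the fundamental
theorem is used with continuity on the closed interval and derivatives in the interior only. -/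
theorem lintegral_rate_mul_exp_le (hA : 1 < A) {c t : ℝ} (hc : 0 < c) (ht : 0 < t) :
    ∫⁻ s in Ioo 0 t, ENNReal.ofReal (rate A s * Real.exp (c * ratePrim A s)) ≤
      ENNReal.ofReal (Real.exp (c * ratePrim A t) / c) := by
  have hint : ∀ b, 0 ≤ b → IntervalIntegrable (rate A) volume 0 b := fun b hb => by
    rw [intervalIntegrable_iff_integrableOn_Ioc_of_le hb]
    exact (integrableOn_rate hA).mono_set Ioc_subset_Ioi_self
  have heq : ∀ b, 0 ≤ b → ratePrim A b = ∫ s in (0 : ℝ)..b, rate A s := fun b hb => by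
    rw [ratePrim, intervalIntegral.integral_of_le hb]
  have hcont : ContinuousOn (ratePrim A) (Icc 0 t) := by
    have := intervalIntegral.continuousOn_primitive (μ := volume) (f := rate A) (a := 0) (b := t)
      ((integrableOn_Icc_iff_integrableOn_Ioc).2
        ((integrableOn_rate hA).mono_set (Ioc_subset_Ioi_self (a := t))))
    exact this
  have hderiv : ∀ s, 0 < s → HasDerivAt (ratePrim A) (rate A s) s := by
    intro s hs
    have h1 := intervalIntegral.integral_hasDerivAt_right (hint s hs.le)
      measurable_rate.stronglyMeasurable.stronglyMeasurableAtFilter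
      (continuousOn_rate.continuousAt (Ioi_mem_nhds hs))
    refine h1.congr_of_eventuallyEq ?_
    filter_upwards [Ioi_mem_nhds hs] with b hb
    exact heq b (le_of_lt hb)
  have hexp : Measurable fun s => Real.exp (c * ratePrim A s) :=
    Real.measurable_exp.comp ((ratePrim_mono hA).measurable.const_mul c)
  have hi : IntegrableOn (fun s => rate A s * Real.exp (c * ratePrim A s)) (Ioc 0 t) := by
    refine Integrable.mono' (((integrableOn_rate hA).mono_set
      (Ioc_subset_Ioi_self (a := t))).mul_const (Real.exp (c * ratePrim A t)))
      (measurable_rate.mul hexp).aestronglyMeasurable ?_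
    filter_upwards [ae_restrict_mem measurableSet_Ioc] with s hs
    rw [Real.norm_of_nonneg (mul_nonneg (rate_nonneg hs.1) (Real.exp_pos _).le)]
    have h1 := rate_nonneg (A := A) hs.1
    have h2 := ratePrim_mono hA hs.2
    gcongr
  have hftc := intervalIntegral.integral_eq_sub_of_hasDerivAt_of_le ht.le
    (f := fun s => Real.exp (c * ratePrim A s) / c)
    (f' := fun s => rate A s * Real.exp (c * ratePrim A s))
    ((Real.continuous_exp.comp_continuousOn (hcont.const_smul c)).div_const c)
    (fun s hs => by
      have := (((hderiv s hs.1).const_mul c).exp).div_const c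
      refine this.congr_deriv ?_
      field_simp) ((intervalIntegrable_iff_integrableOn_Ioc_of_le ht.le).2 hi)
  rw [intervalIntegral.integral_of_le ht.le, integral_Ioc_eq_integral_Ioo] at hftc
  rw [← ofReal_integral_eq_lintegral_ofReal (hi.mono_set Ioo_subset_Ioc_self), hftc]
  · refine ENNReal.ofReal_le_ofReal ?_
    have : 0 ≤ Real.exp (c * ratePrim A 0) / c := by positivity
    linarith
  · filter_upwards [ae_restrict_mem measurableSet_Ioo] with s hs
    exact mul_nonneg (rate_nonneg hs.1) (Real.exp_pos _).le

/-- Exponential weights make the Volterra operator with kernel `(t - s)^(-a) rate(s)` small. -/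
theorem eventually_lintegral_weight_le (hA : 1 < A) {a ε : ℝ} (ha0 : 0 ≤ a) (ha : a < 1)
    (hε : 0 < ε) : ∀ᶠ c : ℝ in atTop, ∀ t, 0 < t →
      ∫⁻ s in Ioo 0 t, ENNReal.ofReal
          ((t - s) ^ (-a) * (rate A s * Real.exp (c * ratePrim A s))) ≤
        ENNReal.ofReal (ε * t ^ (-a) * Real.exp (c * ratePrim A t)) := by
  have ha' : 0 < 1 - a := by linarith
  -- The integral is split at (1-δ)t. On the last piece `rate` is at most 4/t, and integrating
  -- (t-s)^(-a) over length δt gives a factor δ^(1-a), small by the choice of δ. Before it,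
  -- (t-s)^(-a) ≤ (δt)^(-a), and the weighted rate integrates to at most exp(c ∫ rate)/c, small by
  -- then taking c large.
  obtain ⟨δ, hδ0, hδ1, hδ⟩ : ∃ δ : ℝ, 0 < δ ∧ δ ≤ 1 / 2 ∧ 4 * δ ^ (1 - a) / (1 - a) ≤ ε / 2 := by
    have h1 : Tendsto (fun δ : ℝ => 4 * δ ^ (1 - a) / (1 - a)) (𝓝[>] 0) (𝓝 0) := by
      have h2 : Tendsto (fun δ : ℝ => δ ^ (1 - a)) (𝓝[>] 0) (𝓝 0) := by
        have := (Real.continuousAt_rpow_const 0 (1 - a) (Or.inr ha'.le)).tendsto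
        rw [Real.zero_rpow ha'.ne'] at this
        exact this.mono_left nhdsWithin_le_nhds
      simpa using (h2.const_mul 4).div_const (1 - a)
    have h2 := h1.eventually_le_const (half_pos hε)
    have h3 : ∀ᶠ δ : ℝ in 𝓝[>] 0, δ ∈ Ioc (0 : ℝ) (1 / 2) :=
      Ioc_mem_nhdsGT (by norm_num)
    obtain ⟨δ, h4, h5⟩ := (h2.and h3).exists
    exact ⟨δ, h5.1, h5.2, h4⟩
  filter_upwards [eventually_ge_atTop (2 * δ ^ (-a) / ε), eventually_gt_atTop 0] with c hc hc0 t ht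
  have hsplit : Ioo 0 t ⊆ Ioc 0 ((1 - δ) * t) ∪ Ioo ((1 - δ) * t) t := by
    intro s hs
    rcases le_or_gt s ((1 - δ) * t) with h | h
    · exact Or.inl ⟨hs.1, h⟩
    · exact Or.inr ⟨h, hs.2⟩
  refine (lintegral_mono_set hsplit).trans ((lintegral_union_le _ _ _).trans ?_)
  have hδt : (1 - δ) * t < t := by nlinarith
  have hδt0 : t / 2 ≤ (1 - δ) * t := by nlinarith
  have hw : ∀ s, s ≤ t → Real.exp (c * ratePrim A s) ≤ Real.exp (c * ratePrim A t) :=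
    fun s hs => by
      have := ratePrim_mono hA hs
      gcongr
  have e1 : ∫⁻ s in Ioc 0 ((1 - δ) * t), ENNReal.ofReal
      ((t - s) ^ (-a) * (rate A s * Real.exp (c * ratePrim A s))) ≤
      ENNReal.ofReal (ε / 2 * t ^ (-a) * Real.exp (c * ratePrim A t)) := by
    calc _ ≤ ∫⁻ s in Ioc 0 ((1 - δ) * t), ENNReal.ofReal ((δ * t) ^ (-a)) *
          ENNReal.ofReal (rate A s * Real.exp (c * ratePrim A s)) := by
          refine setLIntegral_mono_ae' measurableSet_Ioc (Eventually.of_forall fun s hs => ?_)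
          rw [← ENNReal.ofReal_mul (by positivity)]
          refine ENNReal.ofReal_le_ofReal ?_
          have h1 := rate_nonneg (A := A) hs.1
          refine mul_le_mul_of_nonneg_right ?_ (by positivity)
          exact Real.rpow_le_rpow_of_nonpos (by positivity) (by linarith [hs.2]) (by linarith)
      _ ≤ ENNReal.ofReal ((δ * t) ^ (-a)) * ∫⁻ s in Ioo 0 t,
          ENNReal.ofReal (rate A s * Real.exp (c * ratePrim A s)) := by
          rw [lintegral_const_mul' _ _ ENNReal.ofReal_ne_top]
          have hsub : Ioc 0 ((1 - δ) * t) ⊆ Ioo 0 t := fun s hs => ⟨hs.1, hs.2.trans_lt hδt⟩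
          exact mul_le_mul_right (lintegral_mono_set hsub) _
      _ ≤ ENNReal.ofReal ((δ * t) ^ (-a)) * ENNReal.ofReal (Real.exp (c * ratePrim A t) / c) := by
          gcongr
          exact lintegral_rate_mul_exp_le hA hc0 ht
      _ ≤ _ := by
          rw [← ENNReal.ofReal_mul (by positivity)]
          refine ENNReal.ofReal_le_ofReal ?_
          rw [Real.mul_rpow hδ0.le ht.le]
          have h2 : δ ^ (-a) / c ≤ ε / 2 := by
            rw [div_le_iff₀ hc0]
            rw [div_le_iff₀ hε] at hc
            linarith
          calc _ = δ ^ (-a) / c * (t ^ (-a) * Real.exp (c * ratePrim A t)) := by ring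
            _ ≤ ε / 2 * (t ^ (-a) * Real.exp (c * ratePrim A t)) := by gcongr
            _ = _ := by ring
  have e2 : ∫⁻ s in Ioo ((1 - δ) * t) t, ENNReal.ofReal
      ((t - s) ^ (-a) * (rate A s * Real.exp (c * ratePrim A s))) ≤
      ENNReal.ofReal (ε / 2 * t ^ (-a) * Real.exp (c * ratePrim A t)) := by
    calc _ ≤ ∫⁻ s in Ioo ((1 - δ) * t) t, ENNReal.ofReal (4 / t * Real.exp (c * ratePrim A t)) *
          ENNReal.ofReal ((t - s) ^ (-a)) := by
          refine setLIntegral_mono_ae' measurableSet_Ioo (Eventually.of_forall fun s hs => ?_)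
          have hs0 : t / 2 ≤ s := hδt0.trans hs.1.le
          rw [← ENNReal.ofReal_mul (by positivity)]
          refine ENNReal.ofReal_le_ofReal ?_
          have h1 := rate_nonneg (A := A) (s := s) (by linarith)
          have h3 : 0 ≤ (t - s) ^ (-a) := Real.rpow_nonneg (by linarith [hs.2]) _
          have h4 : rate A s ≤ 4 / t := by
            refine (rate_le_of_le hA (half_pos ht) hs0).trans ?_
            have : (1 + t / 2) ^ (1 - A) ≤ 1 :=
              Real.rpow_le_one_of_one_le_of_nonpos (by linarith) (by linarith)
            calc _ ≤ 2 * (1 / (t / 2)) := by gcongr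
              _ = 4 / t := by field_simp; norm_num
          rw [mul_comm]
          gcongr
          exact ratePrim_mono hA hs.2.le
      _ = ENNReal.ofReal (4 / t * Real.exp (c * ratePrim A t)) *
          ENNReal.ofReal ((δ * t) ^ (1 - a) / (1 - a)) := by
          rw [lintegral_const_mul' _ _ ENNReal.ofReal_ne_top, lintegral_rpow_sub ha hδt]
          congr 4; ring
      _ ≤ _ := by
          rw [← ENNReal.ofReal_mul (by positivity)]
          refine ENNReal.ofReal_le_ofReal ?_
          have h2 : (δ * t) ^ (1 - a) = δ ^ (1 - a) * (t * t ^ (-a)) := by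
            rw [Real.mul_rpow hδ0.le ht.le]
            congr 1
            rw [sub_eq_add_neg, Real.rpow_add ht, Real.rpow_one]
          rw [h2]
          calc _ = 4 * δ ^ (1 - a) / (1 - a) * (t ^ (-a) * Real.exp (c * ratePrim A t)) := by
                field_simp
            _ ≤ ε / 2 * (t ^ (-a) * Real.exp (c * ratePrim A t)) := by gcongr
            _ = _ := by ring
  refine (add_le_add e1 e2).trans (le_of_eq ?_)
  rw [← ENNReal.ofReal_add (by positivity) (by positivity)]
  congr 1; ring

/-- Integrability of `rate` keeps the exponential weight between two positive constants, so weighted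
bounds lose nothing globally in time. The same weight serves the kernel (a = 0) and its gradient (a
= 1/2). -/
theorem exists_weight (hA : 1 < A) {ε : ℝ} (hε : 0 < ε) :
    ∃ w : ℝ → ℝ, Measurable w ∧ (∀ s, 1 ≤ w s) ∧ (∃ W, ∀ s, w s ≤ W) ∧
      ∀ a : ℝ, a = 0 ∨ a = 1 / 2 → ∀ t, 0 < t →
        ∫⁻ s in Ioo 0 t, ENNReal.ofReal ((t - s) ^ (-a) * (rate A s * w s)) ≤
          ENNReal.ofReal (ε * t ^ (-a) * w t) := by
  obtain ⟨c, ⟨h1, h2⟩, hc⟩ := (((eventually_lintegral_weight_le hA le_rfl one_pos hε).and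
    (eventually_lintegral_weight_le hA (by norm_num : (0 : ℝ) ≤ 1 / 2) (by norm_num) hε)).and
    (eventually_ge_atTop 0)).exists
  refine ⟨fun s => Real.exp (c * ratePrim A s),
    Real.measurable_exp.comp ((ratePrim_mono hA).measurable.const_mul c),
    fun s => Real.one_le_exp (mul_nonneg hc (ratePrim_nonneg s)),
    ⟨Real.exp (c * ∫ s in Ioi 0, rate A s), fun s => ?_⟩, ?_⟩
  · exact Real.exp_le_exp.2 (mul_le_mul_of_nonneg_left (ratePrim_le hA s) hc)
  · rintro a (rfl | rfl)
    exacts [h1, h2]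

/-- Insert 1 ≤ w under the integral and bound w(t) by its supremum afterwards. -/
theorem exists_lintegral_rate_le (hA : 1 < A) : ∃ c : ℝ, 0 ≤ c ∧
    ∀ a : ℝ, a = 0 ∨ a = 1 / 2 → ∀ t, 0 < t →
      ∫⁻ s in Ioo 0 t, ENNReal.ofReal ((t - s) ^ (-a) * rate A s) ≤
        ENNReal.ofReal (c * t ^ (-a)) := by
  obtain ⟨w, -, hw1, ⟨W, hW⟩, hw⟩ := exists_weight hA one_pos
  refine ⟨W, by linarith [hw1 0, hW 0], fun a ha t ht => ?_⟩
  calc _ ≤ ∫⁻ s in Ioo 0 t, ENNReal.ofReal ((t - s) ^ (-a) * (rate A s * w s)) := by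
        refine setLIntegral_mono_ae' measurableSet_Ioo (Eventually.of_forall fun s hs => ?_)
        refine ENNReal.ofReal_le_ofReal ?_
        have h1 := rate_nonneg (A := A) hs.1
        have h3 : 0 ≤ (t - s) ^ (-a) := Real.rpow_nonneg (by linarith [hs.2]) _
        refine mul_le_mul_of_nonneg_left ?_ h3
        exact le_mul_of_one_le_right h1 (hw1 s)
    _ ≤ _ := (hw a ha t ht).trans (ENNReal.ofReal_le_ofReal (by
        have : 0 ≤ t ^ (-a) := by positivity
        nlinarith [hW t]))

end Rate

/-! ### Kernels of heat type and superpositions of them. -/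

section Potential

variable {N : ℕ} {E : Type*} [NormedAddCommGroup E]

/-- Kernels dominated by `κ t^(-a)` times the Gauss kernel at the doubled time. -/
structure IsHeatKernel (k : Space N → ℝ → E) (κ a : ℝ) : Prop where
  stronglyMeasurable : StronglyMeasurable fun z : Space N × ℝ => k z.1 z.2
  continuousOn : ContinuousOn (fun z : Space N × ℝ => k z.1 z.2) (spaceTime N)
  const_nonneg : 0 ≤ κ
  exponent : a = 0 ∨ a = 1 / 2
  enorm_le : ∀ x t, 0 < t → ‖k x t‖ₑ ≤ ENNReal.ofReal (κ * t ^ (-a)) * gaussE x (2 * t)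

/-- The time doubling is not needed for G itself; it is accepted so that G and its gradient share
one majorant. -/
theorem isHeatKernel_gaussKernel (N : ℕ) :
    IsHeatKernel (fun (x : Space N) t => gaussKernel x t) (2 ^ ((N : ℝ) / 2)) 0 where
  stronglyMeasurable := measurable_gaussKernel.stronglyMeasurable
  continuousOn := continuousOn_gaussKernel
  const_nonneg := by positivity
  exponent := Or.inl rfl
  enorm_le x t ht := by
    rw [gaussE, ← ENNReal.ofReal_mul (by positivity), Real.enorm_eq_ofReal_abs,
      abs_of_nonneg (gaussKernel_nonneg x t ht), neg_zero, Real.rpow_zero, mul_one]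
    exact ENNReal.ofReal_le_ofReal (gaussKernel_le_two_mul x ht)

theorem isHeatKernel_gaussGrad (N : ℕ) :
    IsHeatKernel (fun (x : Space N) t => gaussGrad x t) (2 ^ ((N : ℝ) / 2)) (1 / 2) where
  stronglyMeasurable := measurable_gaussGrad.stronglyMeasurable
  continuousOn := continuousOn_gaussGrad
  const_nonneg := by positivity
  exponent := Or.inr rfl
  enorm_le x t ht := by
    rw [gaussE, ← ENNReal.ofReal_mul (by positivity), ← ofReal_norm]
    exact ENNReal.ofReal_le_ofReal (norm_gaussGrad_le x ht)

namespace IsHeatKernel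

variable {k : Space N → ℝ → E} {κ a : ℝ}

theorem exponent_nonneg (hk : IsHeatKernel k κ a) : 0 ≤ a := by
  rcases hk.exponent with h | h <;> rw [h]; norm_num

theorem exponent_lt_one (hk : IsHeatKernel k κ a) : a < 1 := by
  rcases hk.exponent with h | h <;> rw [h] <;> norm_num

/-- Kernels are bounded away from their singular time, which supplies the dominating functions for
truncated superpositions. -/
theorem exists_norm_le (hk : IsHeatKernel k κ a) {ε : ℝ} (hε : 0 < ε) : ∃ M : ℝ, 0 ≤ M ∧ ∀ x t, ε ≤ t → ‖k x t‖ ≤ M := by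
  refine ⟨κ * ε ^ (-a) * (4 * Real.pi * (2 * ε)) ^ (-((N : ℝ) / 2)),
    mul_nonneg (mul_nonneg hk.const_nonneg (by positivity)) (by positivity), fun x t ht => ?_⟩
  have ht0 : 0 < t := hε.trans_le ht
  have hκ := hk.const_nonneg
  have h1 := (hk.enorm_le x t ht0).trans (mul_le_mul_right (gaussE_le x (by positivity)) _)
  rw [← ENNReal.ofReal_mul (by positivity), ← ofReal_norm,
    ENNReal.ofReal_le_ofReal_iff (by positivity)] at h1
  refine h1.trans ?_
  have hN : -((N : ℝ) / 2) ≤ 0 := by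
    have : (0 : ℝ) ≤ N := Nat.cast_nonneg N
    linarith
  have e1 : t ^ (-a) ≤ ε ^ (-a) :=
    Real.rpow_le_rpow_of_nonpos hε ht (by linarith [hk.exponent_nonneg])
  have e2 : (4 * Real.pi * (2 * t)) ^ (-((N : ℝ) / 2)) ≤
      (4 * Real.pi * (2 * ε)) ^ (-((N : ℝ) / 2)) :=
    Real.rpow_le_rpow_of_nonpos (by positivity) (by gcongr) hN
  gcongr

theorem stronglyMeasurable_comp (hk : IsHeatKernel k κ a) {α : Type*} [MeasurableSpace α] {y : α → Space N} {τ : α → ℝ}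
    (hy : Measurable y) (hτ : Measurable τ) : StronglyMeasurable fun ω => k (y ω) (τ ω) :=
  hk.stronglyMeasurable.comp_measurable (hy.prodMk hτ)

end IsHeatKernel

/-! ### Superpositions of kernels issued from points of space-time -/

section Superposition

variable [NormedSpace ℝ E] {Ω : Type*} [MeasurableSpace Ω] {ρ : Measure Ω} {y : Ω → Space N} {s : Ω → ℝ}
  {α : Ω → ℝ} {k : Space N → ℝ → E} {κ a : ℝ}

theorem IsHeatKernel.integrable_superposition (hk : IsHeatKernel k κ a) (hy : Measurable y)
    (hs : Measurable s) (hα : Integrable α ρ) {ε t : ℝ} (hε : 0 < ε)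
    (hst : ∀ᵐ ω ∂ρ, s ω ≤ t - ε) (x : Space N) :
    Integrable (fun ω => α ω • k (x - y ω) (t - s ω)) ρ := by
  obtain ⟨M, hM0, hM⟩ := hk.exists_norm_le hε
  refine Integrable.mono' (hα.norm.mul_const M) (hα.1.smul
    (hk.stronglyMeasurable_comp (by fun_prop) (by fun_prop)).aestronglyMeasurable) ?_
  filter_upwards [hst] with ω hω
  rw [norm_smul]
  gcongr
  exact hM _ _ (by linarith)

/-- The cut-off keeps the kernel bounded, so dominated convergence applies. The cut-off moves with
the time variable, and its only points of discontinuity are the excluded ones, s = t₀ - ε. -/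
theorem IsHeatKernel.continuousAt_superposition (hk : IsHeatKernel k κ a) (hy : Measurable y)
    (hs : Measurable s) (hα : Integrable α ρ) {ε : ℝ} (hε : 0 < ε) {x₀ : Space N} {t₀ : ℝ}
    (hst : ∀ᵐ ω ∂ρ, s ω ≠ t₀ - ε) :
    ContinuousAt (fun z : Space N × ℝ =>
      ∫ ω, {ω | s ω ≤ z.2 - ε}.indicator (fun ω => α ω • k (z.1 - y ω) (z.2 - s ω)) ω ∂ρ)
      (x₀, t₀) := by
  obtain ⟨M, hM0, hM⟩ := hk.exists_norm_le hε
  refine tendsto_integral_filter_of_dominated_convergence (fun ω => ‖α ω‖ * M) ?_ ?_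
    (hα.norm.mul_const M) ?_
  · refine Eventually.of_forall fun z => ?_
    refine AEStronglyMeasurable.indicator (hα.1.smul
      (hk.stronglyMeasurable_comp (by fun_prop) (by fun_prop)).aestronglyMeasurable) ?_
    exact measurableSet_le hs measurable_const
  · refine Eventually.of_forall fun z => Eventually.of_forall fun ω => ?_
    by_cases h : s ω ≤ z.2 - ε
    · rw [indicator_of_mem (by exact h), norm_smul]
      gcongr
      exact hM _ _ (by linarith)
    · rw [indicator_of_notMem (by exact h), norm_zero]
      positivity
  · filter_upwards [hst] with ω hω
    have hcont : Tendsto (fun z : Space N × ℝ => z.2 - ε) (𝓝 (x₀, t₀)) (𝓝 (t₀ - ε)) :=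
      (continuous_snd.sub continuous_const).tendsto _
    rcases lt_or_gt_of_ne hω with h | h
    · have h1 : ∀ᶠ z : Space N × ℝ in 𝓝 (x₀, t₀), s ω ≤ z.2 - ε :=
        hcont.eventually_const_le h
      rw [indicator_of_mem (by exact h.le)]
      have h2 : Tendsto (fun z : Space N × ℝ => α ω • k (z.1 - y ω) (z.2 - s ω)) (𝓝 (x₀, t₀))
          (𝓝 (α ω • k (x₀ - y ω) (t₀ - s ω))) := by
        refine Tendsto.const_smul ?_ _
        have h3 : ContinuousAt (fun z : Space N × ℝ => k z.1 z.2) (x₀ - y ω, t₀ - s ω) :=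
          hk.continuousOn.continuousAt (isOpen_spaceTime.mem_nhds
            (show (0 : ℝ) < t₀ - s ω by linarith))
        have h4 : Tendsto (fun z : Space N × ℝ => (z.1 - y ω, z.2 - s ω)) (𝓝 (x₀, t₀))
          (𝓝 (x₀ - y ω, t₀ - s ω)) := (by fun_prop : Continuous fun z : Space N × ℝ =>
            (z.1 - y ω, z.2 - s ω)).tendsto _
        exact h3.tendsto.comp h4
      refine h2.congr' ?_
      filter_upwards [h1] with z hz
      rw [indicator_of_mem (by exact hz)]
    · have h1 : ∀ᶠ z : Space N × ℝ in 𝓝 (x₀, t₀), z.2 - ε < s ω :=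
        hcont.eventually_lt_const h
      rw [indicator_of_notMem (by simpa using h)]
      refine tendsto_const_nhds.congr' ?_
      filter_upwards [h1] with z hz
      rw [indicator_of_notMem (by simpa using hz)]

theorem hasGradientAt_superposition (hy : Measurable y)
    (hs : Measurable s) (hα : Integrable α ρ) {ε t : ℝ} (hε : 0 < ε)
    (hst : ∀ᵐ ω ∂ρ, s ω ≤ t - ε) (x : Space N) :
    HasGradientAt (fun x => ∫ ω, α ω • gaussKernel (x - y ω) (t - s ω) ∂ρ)
      (∫ ω, α ω • gaussGrad (x - y ω) (t - s ω) ∂ρ) x := by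
  have hkg := isHeatKernel_gaussGrad N
  obtain ⟨M, hM0, hM⟩ := hkg.exists_norm_le hε
  have hint := hkg.integrable_superposition hy hs hα hε hst x
  have hderiv : ∀ (ω : Ω) (x : Space N),
      HasFDerivAt (fun x => α ω • gaussKernel (x - y ω) (t - s ω))
      (InnerProductSpace.toDual ℝ (Space N) (α ω • gaussGrad (x - y ω) (t - s ω))) x := by
    intro ω x
    have h1 := (hasGradientAt_gaussKernel (x - y ω) (t - s ω)).hasFDerivAt
    have h2 := (h1.comp x ((hasFDerivAt_id x).sub_const (y ω))).const_smul (α ω)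
    refine h2.congr_fderiv ?_
    ext v
    simp
  have key := hasFDerivAt_integral_of_dominated_of_fderiv_le (𝕜 := ℝ) (μ := ρ)
    (F := fun x ω => α ω • gaussKernel (x - y ω) (t - s ω)) (x₀ := x) (s := univ)
    (F' := fun x ω => InnerProductSpace.toDual ℝ (Space N)
      (α ω • gaussGrad (x - y ω) (t - s ω))) (bound := fun ω => ‖α ω‖ * M) univ_mem
    (Eventually.of_forall fun x =>
      ((isHeatKernel_gaussKernel N).integrable_superposition hy hs hα hε hst x).1)
    ((isHeatKernel_gaussKernel N).integrable_superposition hy hs hα hε hst x)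
    ((InnerProductSpace.toDual ℝ (Space N)).continuous.comp_aestronglyMeasurable hint.1)
    (by
      filter_upwards [hst] with ω hω x _
      rw [LinearIsometryEquiv.norm_map, norm_smul]
      gcongr
      exact hM _ _ (by linarith))
    (hα.norm.mul_const M) (Eventually.of_forall fun ω x _ => hderiv ω x)
  rw [hasGradientAt_iff_hasFDerivAt]
  refine key.congr_fderiv ?_
  have hint' : Integrable (fun ω => InnerProductSpace.toDual ℝ (Space N)
      (α ω • gaussGrad (x - y ω) (t - s ω))) ρ :=
    hint.congr' ((InnerProductSpace.toDual ℝ (Space N)).continuous.comp_aestronglyMeasurable hint.1)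
      (Eventually.of_forall fun ω => by rw [LinearIsometryEquiv.norm_map])
  ext v
  rw [ContinuousLinearMap.integral_apply hint', InnerProductSpace.toDual_apply_apply,
    real_inner_comm, ← integral_inner hint]
  refine integral_congr_ae (Eventually.of_forall fun ω => ?_)
  simp only [InnerProductSpace.toDual_apply_apply]
  exact real_inner_comm _ _

/-- Semigroup property for superpositions of Gauss kernels. -/
theorem integral_gaussKernel_mul_superposition [SFinite ρ] (hy : Measurable y) (hs : Measurable s)
    (hα : Integrable α ρ) {τ t : ℝ} (hτ : ∀ᵐ ω ∂ρ, s ω < τ) (ht : τ < t) (x : Space N) :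
    ∫ z, gaussKernel (x - z) (t - τ) * ∫ ω, α ω • gaussKernel (z - y ω) (τ - s ω) ∂ρ =
      ∫ ω, α ω • gaussKernel (x - y ω) (t - s ω) ∂ρ := by
  have hm : Measurable fun p : Space N × Ω => gaussKernel (x - p.1) (t - τ) *
      gaussKernel (p.1 - y p.2) (τ - s p.2) := by
    have h1 : Measurable fun p : Space N × Ω => gaussKernel (x - p.1) (t - τ) :=
      measurable_gaussKernel.comp (by fun_prop : Measurable fun p : Space N × Ω =>
        (x - p.1, t - τ))
    have h2 : Measurable fun p : Space N × Ω => gaussKernel (p.1 - y p.2) (τ - s p.2) :=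
      measurable_gaussKernel.comp (by fun_prop : Measurable fun p : Space N × Ω =>
        (p.1 - y p.2, τ - s p.2))
    exact h1.mul h2
  have hint : Integrable (fun p : Space N × Ω => gaussKernel (x - p.1) (t - τ) *
      (α p.2 • gaussKernel (p.1 - y p.2) (τ - s p.2))) (volume.prod ρ) := by
    have hm' : AEStronglyMeasurable (fun p : Space N × Ω => gaussKernel (x - p.1) (t - τ) *
      (α p.2 • gaussKernel (p.1 - y p.2) (τ - s p.2))) (volume.prod ρ) := by
      refine (hα.1.comp_snd.mul hm.aestronglyMeasurable).congr (Eventually.of_forall fun p => ?_)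
      simp only [smul_eq_mul, Pi.mul_apply]; ring
    rw [integrable_prod_iff' hm']
    constructor
    · filter_upwards [hτ] with ω hω
      have h1 : Integrable fun z : Space N => gaussKernel (z - y ω) (τ - s ω) :=
        (integrable_gaussKernel (sub_pos.2 hω)).comp_sub_right (y ω)
      refine (h1.const_mul (α ω)).bdd_mul (c := (4 * Real.pi * (t - τ)) ^ (-((N : ℝ) / 2))) ?_ ?_
      · exact (measurable_gaussKernel.comp (by fun_prop : Measurable fun z : Space N =>
          (x - z, t - τ))).aestronglyMeasurable
      · refine Eventually.of_forall fun z => ?_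
        rw [Real.norm_of_nonneg (gaussKernel_nonneg _ _ (sub_pos.2 ht))]
        exact gaussKernel_le _ (sub_pos.2 ht)
    · refine (hα.norm.mul_const ((4 * Real.pi * (t - τ)) ^ (-((N : ℝ) / 2)))).mono'
        hm'.norm.prod_swap.integral_prod_right' ?_
      filter_upwards [hτ] with ω hω
      have hpos : ∀ z : Space N, ‖gaussKernel (x - z) (t - τ) *
          (α ω • gaussKernel (z - y ω) (τ - s ω))‖ =
          ‖α ω‖ * (gaussKernel (x - z) (t - τ) * gaussKernel (z - y ω) (τ - s ω)) := by
        intro z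
        rw [norm_mul, norm_smul, Real.norm_of_nonneg (gaussKernel_nonneg _ _ (sub_pos.2 ht)),
          Real.norm_of_nonneg (gaussKernel_nonneg _ _ (sub_pos.2 hω))]
        ring
      simp_rw [hpos]
      rw [integral_const_mul, integral_gaussKernel_mul _ _ (sub_pos.2 ht) (sub_pos.2 hω),
        norm_mul, norm_norm, Real.norm_of_nonneg (gaussKernel_nonneg _ _ (by linarith))]
      refine mul_le_mul_of_nonneg_left ?_ (norm_nonneg _)
      refine (gaussKernel_le _ (by linarith)).trans ?_
      have hN : -((N : ℝ) / 2) ≤ 0 := by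
        have : (0 : ℝ) ≤ N := Nat.cast_nonneg N
        linarith
      have : 0 < t - τ := sub_pos.2 ht
      refine Real.rpow_le_rpow_of_nonpos (by positivity) ?_ hN
      gcongr
      linarith
  simp_rw [← integral_const_mul]
  rw [integral_integral_swap hint]
  refine integral_congr_ae ?_
  filter_upwards [hτ] with ω hω
  have h1 : ∀ z : Space N, gaussKernel (x - z) (t - τ) *
      (α ω • gaussKernel (z - y ω) (τ - s ω)) =
      α ω * (gaussKernel (x - z) (t - τ) * gaussKernel (z - y ω) (τ - s ω)) := by
    intro z; rw [smul_eq_mul]; ring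
  simp_rw [h1]
  rw [integral_const_mul, integral_gaussKernel_mul _ _ (sub_pos.2 ht) (sub_pos.2 hω), smul_eq_mul]
  congr 2; ring

/-- Total mass of a superposition of Gauss kernels. -/
theorem integral_superposition [SFinite ρ] (hy : Measurable y) (hs : Measurable s)
    (hα : Integrable α ρ) {t : ℝ} (ht : ∀ᵐ ω ∂ρ, s ω < t) :
    Integrable (fun x => ∫ ω, α ω • gaussKernel (x - y ω) (t - s ω) ∂ρ) ∧
    ∫ x, ∫ ω, α ω • gaussKernel (x - y ω) (t - s ω) ∂ρ = ∫ ω, α ω ∂ρ := by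
  have hm : Measurable fun p : Space N × Ω => gaussKernel (p.1 - y p.2) (t - s p.2) :=
      measurable_gaussKernel.comp (by fun_prop : Measurable fun p : Space N × Ω =>
        (p.1 - y p.2, t - s p.2))
  have hint : Integrable (fun p : Space N × Ω =>
      α p.2 • gaussKernel (p.1 - y p.2) (t - s p.2)) (volume.prod ρ) := by
    have hm' : AEStronglyMeasurable (fun p : Space N × Ω =>
      α p.2 • gaussKernel (p.1 - y p.2) (t - s p.2)) (volume.prod ρ) :=
      hα.1.comp_snd.smul hm.aestronglyMeasurable
    rw [integrable_prod_iff' hm']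
    constructor
    · filter_upwards [ht] with ω hω
      exact ((integrable_gaussKernel (sub_pos.2 hω)).comp_sub_right (y ω)).const_mul (α ω)
    · refine hα.norm.mono' hm'.norm.prod_swap.integral_prod_right' ?_
      filter_upwards [ht] with ω hω
      have hpos : ∀ z : Space N, ‖α ω • gaussKernel (z - y ω) (t - s ω)‖ =
          ‖α ω‖ * gaussKernel (z - y ω) (t - s ω) := by
        intro z
        rw [norm_smul, Real.norm_of_nonneg (gaussKernel_nonneg _ _ (sub_pos.2 hω))]
      simp_rw [hpos]
      rw [integral_const_mul,
        integral_sub_right_eq_self (fun z : Space N => gaussKernel z (t - s ω)),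
        integral_gaussKernel (sub_pos.2 hω), mul_one, norm_norm]
  refine ⟨hint.integral_prod_left, ?_⟩
  rw [integral_integral_swap hint]
  refine integral_congr_ae ?_
  filter_upwards [ht] with ω hω
  simp only [smul_eq_mul]
  rw [integral_const_mul,
    integral_sub_right_eq_self (fun z : Space N => gaussKernel z (t - s ω)),
    integral_gaussKernel (sub_pos.2 hω), mul_one]

/-- A superposition of Gauss kernels is asymptotic in `L¹` to a multiple of one Gauss kernel. -/
theorem tendsto_superposition_L1 [SFinite ρ] (hy : Measurable y) (hs : Measurable s)
    (hα : Integrable α ρ) :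
    Tendsto (fun t : ℝ => ∫⁻ x, ‖(∫ ω in {ω | s ω < t}, α ω • gaussKernel (x - y ω) (t - s ω) ∂ρ) -
      (∫ ω, α ω ∂ρ) * gaussKernel x (1 + t)‖ₑ) atTop (𝓝 0) := by
  -- Bringing the L¹ norm under the integral over sources leaves |α(ω)| times the L¹ distance
  -- between one kernel and g(t). Sources not yet active at time t are counted with kernel 0.
  let H : ℝ → Ω → ℝ≥0∞ := fun t ω => ‖α ω‖ₑ * ∫⁻ x,
    ‖{ω | s ω < t}.indicator (fun ω => gaussKernel (x - y ω) (t - s ω)) ω -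
      gaussKernel x (1 + t)‖ₑ
  have hmeas : ∀ t, Measurable fun p : Space N × Ω =>
      ‖{ω | s ω < t}.indicator (fun ω => gaussKernel (p.1 - y ω) (t - s ω)) p.2 -
      gaussKernel p.1 (1 + t)‖ₑ := by
    intro t
    have h1 : Measurable fun p : Space N × Ω => gaussKernel (p.1 - y p.2) (t - s p.2) :=
      measurable_gaussKernel.comp (by fun_prop : Measurable fun p : Space N × Ω =>
        (p.1 - y p.2, t - s p.2))
    have h2 : Measurable fun p : Space N × Ω => gaussKernel p.1 (1 + t) :=
      measurable_gaussKernel.comp (by fun_prop : Measurable fun p : Space N × Ω =>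
        (p.1, 1 + t))
    have h3 : Measurable ({p : Space N × Ω | s p.2 < t}.indicator
        fun p => gaussKernel (p.1 - y p.2) (t - s p.2)) :=
      h1.indicator (measurableSet_lt (hs.comp measurable_snd) measurable_const)
    exact (h3.sub h2).enorm
  have hle : ∀ᶠ t : ℝ in atTop,
      ∫⁻ x, ‖(∫ ω in {ω | s ω < t}, α ω • gaussKernel (x - y ω) (t - s ω) ∂ρ) -
        (∫ ω, α ω ∂ρ) * gaussKernel x (1 + t)‖ₑ ≤ ∫⁻ ω, H t ω ∂ρ := by
    filter_upwards [eventually_gt_atTop 0] with t ht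
    have hS : MeasurableSet {ω | s ω < t} := measurableSet_lt hs measurable_const
    have hint : ∀ᵐ x : Space N, IntegrableOn (fun ω => α ω • gaussKernel (x - y ω) (t - s ω))
        {ω | s ω < t} ρ := by
      have hm : Measurable fun p : Space N × Ω => gaussKernel (p.1 - y p.2) (t - s p.2) :=
        measurable_gaussKernel.comp (by fun_prop : Measurable fun p : Space N × Ω =>
          (p.1 - y p.2, t - s p.2))
      have hm' : AEStronglyMeasurable (fun p : Space N × Ω =>
        α p.2 • gaussKernel (p.1 - y p.2) (t - s p.2))
          (volume.prod (ρ.restrict {ω | s ω < t})) :=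
        hα.1.restrict.comp_snd.smul hm.aestronglyMeasurable
      have : Integrable (fun p : Space N × Ω =>
          α p.2 • gaussKernel (p.1 - y p.2) (t - s p.2))
          (volume.prod (ρ.restrict {ω | s ω < t})) := by
        refine ⟨hm', ?_⟩
        rw [hasFiniteIntegral_iff_enorm, lintegral_prod_symm _ hm'.enorm]
        refine lt_of_le_of_lt ?_ hα.2
        refine le_trans ?_ (setLIntegral_le_lintegral {ω | s ω < t} _)
        refine setLIntegral_mono_ae' hS (Eventually.of_forall fun ω hω => ?_)
        simp_rw [enorm_smul]
        rw [lintegral_const_mul' _ _ enorm_ne_top]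
        refine mul_le_of_le_one_right zero_le (le_of_eq ?_)
        rw [← lintegral_gaussE_sub (y ω) (sub_pos.2 hω)]
        refine lintegral_congr fun x => ?_
        rw [Real.enorm_of_nonneg (gaussKernel_nonneg _ _ (sub_pos.2 hω))]; rfl
      exact this.prod_right_ae
    calc _ ≤ ∫⁻ x, ∫⁻ ω, ‖α ω‖ₑ *
          ‖{ω | s ω < t}.indicator (fun ω => gaussKernel (x - y ω) (t - s ω)) ω -
            gaussKernel x (1 + t)‖ₑ ∂ρ := by
          refine lintegral_mono_ae ?_
          filter_upwards [hint] with x hx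
          rw [← integral_indicator hS, ← integral_mul_const,
            ← integral_sub ((integrable_indicator_iff hS).2 hx) (hα.mul_const _)]
          refine (enorm_integral_le_lintegral_enorm _).trans
            (lintegral_mono fun ω => le_of_eq ?_)
          rw [← enorm_mul]
          congr 1
          by_cases h : ω ∈ {ω | s ω < t}
          · rw [indicator_of_mem h, indicator_of_mem h, smul_eq_mul, mul_sub]
          · rw [indicator_of_notMem h, indicator_of_notMem h]; ring
      _ = ∫⁻ ω, H t ω ∂ρ := by
          rw [lintegral_lintegral_swap]
          · refine lintegral_congr fun ω => ?_
            rw [lintegral_const_mul' _ _ enorm_ne_top]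
          · exact hα.1.comp_snd.enorm.mul (hmeas t).aemeasurable
  have hH : Tendsto (fun t => ∫⁻ ω, H t ω ∂ρ) atTop (𝓝 (∫⁻ _, 0 ∂ρ)) := by
    -- The bound 2 is the sum of the masses of the two kernels.
    refine tendsto_lintegral_filter_of_dominated_convergence' (fun ω => ‖α ω‖ₑ * 2) ?_ ?_ ?_ ?_
    · refine Eventually.of_forall fun t => hα.1.enorm.mul ?_
      exact (Measurable.lintegral_prod_left' (hmeas t)).aemeasurable
    · filter_upwards [eventually_gt_atTop 0] with t ht
      refine Eventually.of_forall fun ω => mul_le_mul_right ?_ _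
      calc _ ≤ ∫⁻ x, (({ω | s ω < t}.indicator (fun ω => gaussE (x - y ω) (t - s ω)) ω) +
            gaussE x (1 + t)) := by
            refine lintegral_mono fun x => (enorm_sub_le).trans (add_le_add ?_ ?_)
            · by_cases h : ω ∈ {ω | s ω < t}
              · rw [indicator_of_mem h, indicator_of_mem h,
                  Real.enorm_of_nonneg (gaussKernel_nonneg _ _ (sub_pos.2 h))]; rfl
              · rw [indicator_of_notMem h]; simp
            · rw [Real.enorm_of_nonneg (gaussKernel_nonneg _ _ (by linarith))]; rfl
        _ ≤ 1 + 1 := by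
            rw [lintegral_add_right _ (by fun_prop), lintegral_gaussE (by linarith)]
            gcongr
            by_cases h : ω ∈ {ω | s ω < t}
            · simp_rw [indicator_of_mem h]
              rw [lintegral_gaussE_sub _ (sub_pos.2 h)]
            · simp_rw [indicator_of_notMem h]; simp
        _ = 2 := one_add_one_eq_two
    · rw [lintegral_mul_const' _ _ (by norm_num)]
      exact ENNReal.mul_ne_top hα.2.ne (by norm_num)
    · refine Eventually.of_forall fun ω => ?_
      have h1 := ENNReal.Tendsto.const_mul (a := ‖α ω‖ₑ)
        (tendsto_gaussKernel_sub_L1 (y ω) (s ω)) (Or.inr enorm_ne_top)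
      rw [mul_zero] at h1
      refine h1.congr' ?_
      filter_upwards [eventually_gt_atTop (s ω)] with t ht
      have : ω ∈ {ω | s ω < t} := ht
      simp only [H]
      simp_rw [indicator_of_mem this]
  rw [lintegral_zero] at hH
  exact tendsto_of_tendsto_of_tendsto_of_le_of_le' tendsto_const_nhds hH
    (Eventually.of_forall fun _ => zero_le) hle

end Superposition

end Potential

/-! ### Duhamel integrals of dominated sources: bounds, continuity, differentiability. -/

section Source

variable {N : ℕ} {E : Type*} [NormedAddCommGroup E]

/-- Source terms dominated by `β(t)` times the heat flow of `ψ` at the doubled time. -/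
structure IsSource (F : Space N × ℝ → ℝ) (β : ℝ → ℝ≥0∞) (ψ : Space N → ℝ≥0∞) : Prop where
  measurable : Measurable F
  enorm_le : ∀ p, 0 < p.2 → ‖F p‖ₑ ≤ β p.2 * heat (2 * p.2) ψ p.1

theorem volume_restrict_univ_prod (I : Set ℝ) :
    (volume : Measure (Space N × ℝ)).restrict (univ ×ˢ I) =
      (volume : Measure (Space N)).prod (volume.restrict I) := by
  rw [Measure.volume_eq_prod, ← Measure.prod_restrict, Measure.restrict_univ]

variable {k : Space N → ℝ → E} {κ a : ℝ} {F : Space N × ℝ → ℝ}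
  {β : ℝ → ℝ≥0∞} {ψ : Space N → ℝ≥0∞}

/-- Domination of the Duhamel integral of a dominating source. -/
theorem IsHeatKernel.lintegral_dominated_le (hk : IsHeatKernel k κ a) (hψ : Measurable ψ)
    (hβ : Measurable β) {I : Set ℝ} (hI : MeasurableSet I) {t : ℝ} (hIt : I ⊆ Ioo 0 t)
    (x : Space N) :
    ∫⁻ p in univ ×ˢ I, ‖k (x - p.1) (t - p.2)‖ₑ * (β p.2 * heat (2 * p.2) ψ p.1) ≤
      (∫⁻ s in I, ENNReal.ofReal (κ * (t - s) ^ (-a)) * β s) * heat (2 * t) ψ x := by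
  have hm1 : Measurable fun p : Space N × ℝ => ‖k (x - p.1) (t - p.2)‖ₑ :=
    (hk.stronglyMeasurable_comp (by fun_prop) (by fun_prop)).enorm
  have hm2 : Measurable fun p : Space N × ℝ => heat (2 * p.2) ψ p.1 :=
    measurable_heat_comp hψ (by fun_prop) (by fun_prop)
  rw [volume_restrict_univ_prod, lintegral_prod_symm' _ (by fun_prop),
    ← lintegral_mul_const _ (by fun_prop)]
  refine setLIntegral_mono_ae' hI (Eventually.of_forall fun s hs => ?_)
  have hs0 : 0 < s := (hIt hs).1
  have hst : 0 < t - s := sub_pos.2 (hIt hs).2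
  calc _ ≤ ∫⁻ ξ, ENNReal.ofReal (κ * (t - s) ^ (-a)) * β s *
        (gaussE (x - ξ) (2 * (t - s)) * heat (2 * s) ψ ξ) := by
        refine lintegral_mono fun ξ => ?_
        refine (mul_le_mul_left (hk.enorm_le (x - ξ) (t - s) hst) _).trans (le_of_eq ?_)
        ring
    _ = _ := by
        have h1 : Measurable fun ξ : Space N => heat (2 * s) ψ ξ :=
          measurable_heat_comp hψ measurable_const measurable_id
        have h2 : Measurable fun ξ : Space N => gaussE (x - ξ) (2 * (t - s)) * heat (2 * s) ψ ξ := by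
          fun_prop
        rw [lintegral_const_mul _ h2]
        congr 1
        -- The doubled times add up to 2t for every s, so the spatial profile does not depend on s
        -- and leaves the time integral.
        have := heat_heat hψ (show 0 < 2 * (t - s) by linarith) (show 0 < 2 * s by linarith) x
        have e : 2 * (t - s) + 2 * s = 2 * t := by ring
        rw [e] at this
        exact this

variable [NormedSpace ℝ E]

theorem IsHeatKernel.stronglyMeasurable_source (hk : IsHeatKernel k κ a) (hF : Measurable F)
    (x : Space N) (t : ℝ) :
    StronglyMeasurable fun p : Space N × ℝ => F p • k (x - p.1) (t - p.2) :=
  hF.stronglyMeasurable.smul (hk.stronglyMeasurable_comp (by fun_prop) (by fun_prop))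

theorem IsSource.lintegral_le (hF : IsSource F β ψ) (hk : IsHeatKernel k κ a) (hψ : Measurable ψ)
    (hβ : Measurable β) {I : Set ℝ} (hI : MeasurableSet I) {t : ℝ} (hIt : I ⊆ Ioo 0 t)
    (x : Space N) :
    ∫⁻ p in univ ×ˢ I, ‖F p • k (x - p.1) (t - p.2)‖ₑ ≤
      (∫⁻ s in I, ENNReal.ofReal (κ * (t - s) ^ (-a)) * β s) * heat (2 * t) ψ x := by
  refine le_trans ?_ (hk.lintegral_dominated_le hψ hβ hI hIt x)
  refine setLIntegral_mono_ae' (MeasurableSet.univ.prod hI) (Eventually.of_forall fun p hp => ?_)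
  rw [enorm_smul, mul_comm]
  exact mul_le_mul_right (hF.enorm_le p (hIt hp.2).1) _

theorem lintegral_dominated (hψ : Measurable ψ) (hβ : Measurable β) {I : Set ℝ}
    (hI : MeasurableSet I) (hI0 : I ⊆ Ioi 0) :
    ∫⁻ p in univ ×ˢ I, β p.2 * heat (2 * p.2) ψ p.1 = (∫⁻ s in I, β s) * ∫⁻ y, ψ y := by
  have hm2 : Measurable fun p : Space N × ℝ => heat (2 * p.2) ψ p.1 :=
    measurable_heat_comp hψ (by fun_prop) (by fun_prop)
  rw [volume_restrict_univ_prod, lintegral_prod_symm' _ (by fun_prop),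
    ← lintegral_mul_const _ (by fun_prop)]
  refine setLIntegral_congr_fun hI fun s hs => ?_
  have hs0 : 0 < s := hI0 hs
  simp only
  rw [lintegral_const_mul _ (measurable_heat_comp hψ (by fun_prop) (by fun_prop))]
  congr 1
  exact lintegral_heat hψ (by linarith)

theorem IsSource.integrableOn (hF : IsSource F β ψ) (hψ : Measurable ψ) (hβ : Measurable β)
    (hψ' : ∫⁻ y, ψ y ≠ ∞) (hβ' : ∫⁻ s in Ioi 0, β s ≠ ∞) : IntegrableOn F (spaceTime N) := by
  refine ⟨hF.measurable.aestronglyMeasurable, ?_⟩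
  rw [hasFiniteIntegral_iff_enorm]
  refine lt_of_le_of_lt ?_ (ENNReal.mul_lt_top hβ'.lt_top hψ'.lt_top)
  rw [← lintegral_dominated hψ hβ measurableSet_Ioi subset_rfl, ← spaceTime_eq_prod]
  exact setLIntegral_mono_ae' measurableSet_spaceTime
    (Eventually.of_forall fun p hp => hF.enorm_le p hp)

/-- The Duhamel integral of a source `F` against a kernel `k`, over the times in `I`. -/
noncomputable def potential (k : Space N → ℝ → E) (F : Space N × ℝ → ℝ) (I : Set ℝ)
    (x : Space N) (t : ℝ) : E :=
  ∫ p in univ ×ˢ I, F p • k (x - p.1) (t - p.2)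

theorem enorm_potential_le (k : Space N → ℝ → E) (F : Space N × ℝ → ℝ) (I : Set ℝ)
    (x : Space N) (t : ℝ) :
    ‖potential k F I x t‖ₑ ≤ ∫⁻ p in univ ×ˢ I, ‖F p • k (x - p.1) (t - p.2)‖ₑ :=
  enorm_integral_le_lintegral_enorm _

/-! ### Sources with time factor `B rate(t)` -/

variable {A B : ℝ}

theorem measurable_ofReal_rate : Measurable fun s => ENNReal.ofReal (B * rate A s) :=
  (measurable_rate.const_mul B).ennreal_ofReal

theorem lintegral_ofReal_rate_ne_top (hA : 1 < A) :
    ∫⁻ s in Ioi 0, ENNReal.ofReal (B * rate A s) ≠ ∞ :=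
  (((integrableOn_rate hA).const_mul B).lintegral_lt_top).ne

theorem lintegral_mul_rate_le (hκ : 0 ≤ κ) (hB : 0 ≤ B) {r t : ℝ} :
    ∫⁻ s in Ioo r t, ENNReal.ofReal (κ * (t - s) ^ (-a)) * ENNReal.ofReal (B * rate A s) ≤
      ENNReal.ofReal (κ * B) *
        ∫⁻ s in Ioo r t, ENNReal.ofReal ((t - s) ^ (-a) * rate A s) := by
  rw [← lintegral_const_mul' _ _ ENNReal.ofReal_ne_top]
  refine setLIntegral_mono_ae' measurableSet_Ioo (Eventually.of_forall fun s hs => ?_)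
  have h1 : 0 ≤ (t - s) ^ (-a) := Real.rpow_nonneg (by linarith [hs.2]) _
  rw [← ENNReal.ofReal_mul (by positivity), ← ENNReal.ofReal_mul (by positivity)]
  refine le_of_eq ?_
  congr 1; ring

theorem IsSource.exists_lintegral_le
    (hF : IsSource F (fun s => ENNReal.ofReal (B * rate A s)) ψ) (hk : IsHeatKernel k κ a)
    (hψ : Measurable ψ) (hA : 1 < A) (hB : 0 ≤ B) : ∃ c : ℝ, 0 ≤ c ∧ ∀ x t, 0 < t →
      ∫⁻ p in univ ×ˢ Ioo 0 t, ‖F p • k (x - p.1) (t - p.2)‖ₑ ≤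
        ENNReal.ofReal (c * t ^ (-a)) * heat (2 * t) ψ x := by
  obtain ⟨c, hc, hct⟩ := exists_lintegral_rate_le hA
  have hκ := hk.const_nonneg
  refine ⟨κ * B * c, by positivity, fun x t ht => ?_⟩
  refine (hF.lintegral_le hk hψ measurable_ofReal_rate measurableSet_Ioo subset_rfl x).trans
    (mul_le_mul_left ?_ _)
  refine (lintegral_mul_rate_le hκ hB).trans
    ((mul_le_mul_right (hct a hk.exponent t ht) _).trans (le_of_eq ?_))
  rw [← ENNReal.ofReal_mul (by positivity)]
  congr 1; ring

theorem IsSource.exists_tendsto_lintegral_half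
    (hF : IsSource F (fun s => ENNReal.ofReal (B * rate A s)) ψ) (hk : IsHeatKernel k κ a)
    (hψ : Measurable ψ) (hA : 1 < A) (hB : 0 ≤ B) :
    ∃ η : ℝ → ℝ, Tendsto η atTop (𝓝 0) ∧ (∀ t, 0 < t → 0 ≤ η t) ∧ ∀ x t, 0 < t →
      ∫⁻ p in univ ×ˢ Ioo (t / 2) t, ‖F p • k (x - p.1) (t - p.2)‖ₑ ≤
        ENNReal.ofReal (η t * t ^ (-a)) * heat (2 * t) ψ x := by
  obtain ⟨η, hη, hη0, hηt⟩ := exists_tendsto_lintegral_rate_half hA hk.exponent_lt_one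
  have hκ := hk.const_nonneg
  refine ⟨fun t => κ * B * η t, by simpa using hη.const_mul (κ * B),
    fun t ht => mul_nonneg (by positivity) (hη0 t ht), fun x t ht => ?_⟩
  refine (hF.lintegral_le hk hψ measurable_ofReal_rate measurableSet_Ioo
    (Ioo_subset_Ioo_left (by linarith)) x).trans (mul_le_mul_left ?_ _)
  refine (lintegral_mul_rate_le hκ hB).trans
    ((mul_le_mul_right (hηt t ht) _).trans (le_of_eq ?_))
  rw [← ENNReal.ofReal_mul (by positivity)]
  congr 1; ring

theorem IsSource.integrableOn_kernel
    (hF : IsSource F (fun s => ENNReal.ofReal (B * rate A s)) ψ) (hk : IsHeatKernel k κ a)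
    (hψ : Measurable ψ) (hψ' : ∫⁻ y, ψ y ≠ ∞) (hA : 1 < A) (hB : 0 ≤ B) (x : Space N) {t : ℝ}
    (ht : 0 < t) :
    IntegrableOn (fun p : Space N × ℝ => F p • k (x - p.1) (t - p.2)) (univ ×ˢ Ioo 0 t) := by
  obtain ⟨c, hc, hct⟩ := hF.exists_lintegral_le hk hψ hA hB
  refine ⟨(hk.stronglyMeasurable_source hF.measurable x t).aestronglyMeasurable, ?_⟩
  rw [hasFiniteIntegral_iff_enorm]
  exact (hct x t ht).trans_lt (ENNReal.mul_lt_top ENNReal.ofReal_lt_top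
    (heat_lt_top hψ' (by linarith) x))

/-- The contribution of the times just before `t` is uniformly small. -/
theorem IsHeatKernel.exists_norm_potential_near_le (hk : IsHeatKernel k κ a)
    (hψ : Measurable ψ) (hψ' : ∫⁻ y, ψ y ≠ ∞) (hA : 1 < A) (hB : 0 ≤ B) {t₀ : ℝ} (ht₀ : 0 < t₀) :
    ∃ c : ℝ, 0 ≤ c ∧ ∀ F, IsSource F (fun s => ENNReal.ofReal (B * rate A s)) ψ →
      ∀ ε t x, 0 < ε → t₀ + ε ≤ t →
      ‖potential k F (Ioo (t - ε) t) x t‖ ≤ c * ε ^ (1 - a) := by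
  have hκ := hk.const_nonneg
  have ha1 : 0 < 1 - a := by linarith [hk.exponent_lt_one]
  -- Since t - ε ≥ t₀, the rate on the last interval is at most 2/t₀, and the heat flow at time 2t
  -- is at most its sup bound at 2t₀. Integrating (t-s)^(-a) gives ε^(1-a)/(1-a).
  refine ⟨κ * B * (2 * (1 / t₀)) / (1 - a) *
    ((4 * Real.pi * (2 * t₀)) ^ (-((N : ℝ) / 2)) * (∫⁻ y, ψ y).toReal), by positivity,
    fun F hF ε t x hε ht => ?_⟩
  have hr : 0 < t - ε := by linarith
  have ht0 : 0 < t := by linarith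
  have h1 := (enorm_potential_le k F (Ioo (t - ε) t) x t).trans
    (hF.lintegral_le hk hψ measurable_ofReal_rate measurableSet_Ioo
      (Ioo_subset_Ioo_left hr.le) x)
  have h2 := (lintegral_mul_rate_le (a := a) (A := A) (t := t) hκ hB).trans
    (mul_le_mul_right (lintegral_rate_Ioo_le hA hk.exponent_lt_one hr (by linarith)) _)
  have h3 := heat_le ψ (show 0 < 2 * t by linarith) x
  rw [sub_sub_cancel, ← ENNReal.ofReal_mul (by positivity)] at h2
  rw [← ENNReal.ofReal_toReal hψ', ← ENNReal.ofReal_mul (by positivity)] at h3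
  have h4 := h1.trans (mul_le_mul' h2 h3)
  rw [← ofReal_norm, ← ENNReal.ofReal_mul (by positivity),
    ENNReal.ofReal_le_ofReal_iff (by positivity)] at h4
  refine h4.trans ?_
  have e1 : (1 + (t - ε)) ^ (1 - A) ≤ 1 :=
    Real.rpow_le_one_of_one_le_of_nonpos (by linarith) (by linarith)
  have hN : -((N : ℝ) / 2) ≤ 0 := by
    have : (0 : ℝ) ≤ N := Nat.cast_nonneg N
    linarith
  have e2 : (4 * Real.pi * (2 * t)) ^ (-((N : ℝ) / 2)) ≤
      (4 * Real.pi * (2 * t₀)) ^ (-((N : ℝ) / 2)) :=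
    Real.rpow_le_rpow_of_nonpos (by positivity) (by gcongr; linarith) hN
  have e4 : (1 + (t - ε)) ^ (1 - A) / (t - ε) ≤ 1 / t₀ :=
    div_le_div₀ zero_le_one e1 ht₀ (by linarith)
  calc _ ≤ κ * B * (2 * (1 / t₀) * (ε ^ (1 - a) / (1 - a))) *
      ((4 * Real.pi * (2 * t₀)) ^ (-((N : ℝ) / 2)) * (∫⁻ y, ψ y).toReal) := by
        gcongr
    _ = _ := by ring

theorem potential_split
    (hF : IsSource F (fun s => ENNReal.ofReal (B * rate A s)) ψ) (hk : IsHeatKernel k κ a)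
    (hψ : Measurable ψ) (hψ' : ∫⁻ y, ψ y ≠ ∞) (hA : 1 < A) (hB : 0 ≤ B) (x : Space N) {r τ t : ℝ}
    (hr : 0 ≤ r) (hrτ : r ≤ τ) (hτt : τ < t) :
    potential k F (Ioo r t) x t =
      potential k F (Ioc r τ) x t + potential k F (Ioo τ t) x t := by
  have hint := hF.integrableOn_kernel hk hψ hψ' hA hB x (hr.trans_lt (hrτ.trans_lt hτt))
  have hun : (univ : Set (Space N)) ×ˢ Ioo r t = univ ×ˢ Ioc r τ ∪ univ ×ˢ Ioo τ t := by
    rw [← prod_union, Ioc_union_Ioo_eq_Ioo hrτ hτt]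
  unfold potential
  rw [hun, setIntegral_union]
  · refine Set.disjoint_left.2 fun p hp hp' => ?_
    exact absurd hp.2.2 (not_le.2 hp'.2.1)
  · exact MeasurableSet.univ.prod measurableSet_Ioo
  · refine hint.mono_set (prod_mono subset_rfl fun s hs => ⟨hr.trans_lt hs.1, hs.2.trans_lt hτt⟩)
  · refine hint.mono_set (prod_mono subset_rfl fun s hs => ⟨(hr.trans hrτ).trans_lt hs.1, hs.2⟩)

/-- The potential is a locally uniform limit, as ε → 0, of potentials truncated at t - ε, which are
continuous superpositions of bounded kernels. -/
theorem IsSource.continuousOn_potential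
    (hF : IsSource F (fun s => ENNReal.ofReal (B * rate A s)) ψ) (hk : IsHeatKernel k κ a)
    (hψ : Measurable ψ) (hψ' : ∫⁻ y, ψ y ≠ ∞) (hA : 1 < A) (hB : 0 ≤ B) :
    ContinuousOn (fun z : Space N × ℝ => potential k F (Ioo 0 z.2) z.1 z.2) (spaceTime N) := by
  rintro ⟨x₀, t₀⟩ (ht₀ : 0 < t₀)
  refine ContinuousAt.continuousWithinAt ?_
  refine continuousAt_of_locally_uniform_approx_of_continuousAt fun u hu => ?_
  obtain ⟨d, hd, hdu⟩ := Metric.mem_uniformity_dist.1 hu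
  obtain ⟨c, hc, hcb⟩ := hk.exists_norm_potential_near_le hψ hψ' hA hB
    (show 0 < t₀ / 4 by linarith)
  have ha1 : 0 < 1 - a := by linarith [hk.exponent_lt_one]
  obtain ⟨ε, hε0, hε1, hε⟩ : ∃ ε : ℝ, 0 < ε ∧ ε ≤ t₀ / 4 ∧ c * ε ^ (1 - a) < d := by
    have h1 : Tendsto (fun δ : ℝ => c * δ ^ (1 - a)) (𝓝[>] 0) (𝓝 0) := by
      have := (Real.continuousAt_rpow_const 0 (1 - a) (Or.inr ha1.le)).tendsto
      rw [Real.zero_rpow ha1.ne'] at this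
      simpa using (this.mono_left nhdsWithin_le_nhds).const_mul c
    have h2 := h1.eventually_lt_const hd
    have h3 : ∀ᶠ δ : ℝ in 𝓝[>] 0, δ ∈ Ioc (0 : ℝ) (t₀ / 4) :=
      Ioc_mem_nhdsGT (by linarith)
    obtain ⟨δ, h4, h5⟩ := (h2.and h3).exists
    exact ⟨δ, h5.1, h5.2, h4⟩
  have hnhds : ∀ᶠ z : Space N × ℝ in 𝓝 (x₀, t₀), t₀ / 2 < z.2 :=
    continuous_snd.continuousAt.eventually_const_lt (by simpa using ht₀)
  refine ⟨_, hnhds, fun z => ∫ p, {p : Space N × ℝ | p.2 ≤ z.2 - ε}.indicator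
    (fun p => F p • k (z.1 - p.1) (z.2 - p.2)) p ∂(volume.restrict (spaceTime N)), ?_, ?_⟩
  · refine hk.continuousAt_superposition (y := Prod.fst) (s := Prod.snd) measurable_fst
      measurable_snd (hF.integrableOn hψ measurable_ofReal_rate hψ'
        (lintegral_ofReal_rate_ne_top hA)) hε0 ?_
    refine ae_restrict_of_ae ?_
    have h0 : (volume : Measure (Space N × ℝ)) (univ ×ˢ {t₀ - ε}) = 0 := by
      rw [Measure.volume_eq_prod, Measure.prod_prod]; simp
    filter_upwards [measure_eq_zero_iff_ae_notMem.1 h0] with p hp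
    simpa using hp
  · rintro ⟨x, t⟩ (hz : t₀ / 2 < t)
    refine hdu ?_
    have hS : MeasurableSet {p : Space N × ℝ | p.2 ≤ t - ε} :=
      measurableSet_le measurable_snd measurable_const
    have e1 : spaceTime N ∩ {p : Space N × ℝ | p.2 ≤ t - ε} = univ ×ˢ Ioc 0 (t - ε) := by
      ext p; simp [spaceTime]
    simp only
    rw [setIntegral_indicator hS, e1, dist_eq_norm,
      potential_split hF hk hψ hψ' hA hB x le_rfl (show 0 ≤ t - ε by linarith)
        (show t - ε < t by linarith)]
    change ‖potential k F (Ioc 0 (t - ε)) x t + _ - potential k F (Ioc 0 (t - ε)) x t‖ < d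
    rw [add_sub_cancel_left]
    exact (hcb F hF ε t x hε0 (by linarith)).trans_lt hε

/-- Differentiation under the integral is legitimate only away from s = t. The truncated potentials
are differentiable, their gradients converge uniformly in x with error of order ε^(1/2), and the
limit theorem for derivatives applies. -/
theorem IsSource.hasGradientAt_potential
    (hF : IsSource F (fun s => ENNReal.ofReal (B * rate A s)) ψ)
    (hψ : Measurable ψ) (hψ' : ∫⁻ y, ψ y ≠ ∞) (hA : 1 < A) (hB : 0 ≤ B) {r t : ℝ} (hr : 0 ≤ r)
    (hrt : r < t) (x : Space N) :
    HasGradientAt (fun x => potential (fun x t => gaussKernel x t) F (Ioo r t) x t)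
      (potential (fun x t => gaussGrad x t) F (Ioo r t) x t) x := by
  have hk0 := isHeatKernel_gaussKernel N
  have hk1 := isHeatKernel_gaussGrad N
  obtain ⟨ε, -, hεm, hε⟩ := exists_seq_strictAnti_tendsto' (show 0 < (t - r) / 2 by linarith)
  have hpow : ∀ (c : ℝ) {b : ℝ}, 0 < b → Tendsto (fun n => c * ε n ^ b) atTop (𝓝 0) := by
    intro c b hb
    have := (Real.continuousAt_rpow_const 0 b (Or.inr hb.le)).tendsto
    rw [Real.zero_rpow hb.ne'] at this
    simpa using (this.comp hε).const_mul c
  have hsplit : ∀ {E' : Type} [NormedAddCommGroup E'] [NormedSpace ℝ E'] {k : Space N → ℝ → E'}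
      {κ a : ℝ} (_ : IsHeatKernel k κ a), ∃ c : ℝ, ∀ n x, ‖potential k F (Ioo r t) x t -
      potential k F (Ioc r (t - ε n)) x t‖ ≤ c * ε n ^ (1 - a) := by
    intro E' _ _ k κ a hk
    obtain ⟨c, hc, hcb⟩ := hk.exists_norm_potential_near_le hψ hψ' hA hB
      (show 0 < (t - r) / 2 by linarith)
    refine ⟨c, fun n x => ?_⟩
    have h1 := hεm n
    rw [potential_split hF hk hψ hψ' hA hB x hr (show r ≤ t - ε n by linarith [h1.2])
        (show t - ε n < t by linarith [h1.1]), add_sub_cancel_left]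
    exact hcb F hF _ _ _ h1.1 (by linarith [h1.2])
  obtain ⟨c0, hc0⟩ := hsplit hk0
  obtain ⟨c1, hc1⟩ := hsplit hk1
  rw [hasGradientAt_iff_hasFDerivAt]
  refine hasFDerivAt_of_tendstoUniformly (l := atTop)
    (f := fun n x => potential (fun x t => gaussKernel x t) F (Ioc r (t - ε n)) x t)
    (f' := fun n x => InnerProductSpace.toDual ℝ (Space N)
      (potential (fun x t => gaussGrad x t) F (Ioc r (t - ε n)) x t))
    (g' := fun x => InnerProductSpace.toDual ℝ (Space N)
      (potential (fun x t => gaussGrad x t) F (Ioo r t) x t)) ?_ ?_ ?_ x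
  · rw [Metric.tendstoUniformly_iff]
    intro d hd
    filter_upwards [(hpow c1 (by norm_num : (0 : ℝ) < 1 - 1 / 2)).eventually_lt_const hd]
      with n hn x
    rw [LinearIsometryEquiv.dist_map, dist_eq_norm]
    exact (hc1 n x).trans_lt hn
  · intro n x
    rw [← hasGradientAt_iff_hasFDerivAt]
    have hFi : IntegrableOn F (univ ×ˢ Ioc r (t - ε n)) :=
      (hF.integrableOn hψ measurable_ofReal_rate hψ' (lintegral_ofReal_rate_ne_top hA)).mono_set
        fun p hp => hr.trans_lt hp.2.1
    exact hasGradientAt_superposition (y := Prod.fst) (s := Prod.snd) measurable_fst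
      measurable_snd hFi (hεm n).1
      ((ae_restrict_mem (MeasurableSet.univ.prod measurableSet_Ioc)).mono fun p hp => hp.2.2) x
  · intro x
    rw [tendsto_iff_norm_sub_tendsto_zero]
    refine squeeze_zero (fun _ => norm_nonneg _) (fun n => ?_)
      (hpow c0 (by norm_num : (0 : ℝ) < 1 - 0))
    rw [norm_sub_rev]
    exact hc0 n x

end Source

/-! ### Weak-* compactness of dominated sequences. -/

section WeakCompactness

variable {Ω : Type*} [MeasurableSpace Ω] {μ : Measure Ω}

/-- Integration against a function bounded by `1`, as a functional on `L¹`. -/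
theorem exists_dual_of_bounded {θ : Ω → ℝ} (hθ : AEStronglyMeasurable θ μ)
    (hθ1 : ∀ᵐ ω ∂μ, ‖θ ω‖ ≤ 1) :
    ∃ L : StrongDual ℝ (Lp ℝ 1 μ), ‖L‖ ≤ 1 ∧ ∀ g : Lp ℝ 1 μ, L g = ∫ ω, θ ω * g ω ∂μ := by
  have hint : ∀ g : Lp ℝ 1 μ, Integrable (fun ω => θ ω * g ω) μ := fun g =>
    (L1.integrable_coeFn g).bdd_mul hθ hθ1
  let L₀ : Lp ℝ 1 μ →ₗ[ℝ] ℝ :=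
    { toFun := fun g => ∫ ω, θ ω * g ω ∂μ
      map_add' := fun g h => by
        rw [← integral_add (hint g) (hint h)]
        refine integral_congr_ae ?_
        filter_upwards [Lp.coeFn_add g h] with ω hω
        rw [hω, Pi.add_apply, mul_add]
      map_smul' := fun c g => by
        rw [RingHom.id_apply, ← integral_smul]
        refine integral_congr_ae ?_
        filter_upwards [Lp.coeFn_smul c g] with ω hω
        rw [hω, Pi.smul_apply, smul_eq_mul, smul_eq_mul]; ring }
  have hL₀ : ∀ g, ‖L₀ g‖ ≤ 1 * ‖g‖ := fun g => by
    rw [one_mul, L1.norm_eq_integral_norm]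
    refine norm_integral_le_of_norm_le (L1.integrable_coeFn g).norm ?_
    filter_upwards [hθ1] with ω hω
    rw [norm_mul]
    exact mul_le_of_le_one_left (norm_nonneg _) hω
  exact ⟨L₀.mkContinuous 1 hL₀, L₀.mkContinuous_norm_le zero_le_one hL₀, fun g => rfl⟩

/-- A sequence of functions dominated by `D` has a subsequence whose integrals converge against
every `g` with `g D` integrable. -/
theorem exists_subseq_tendsto_integral [MeasurableSpace.CountablyGenerated Ω] [SigmaFinite μ]
    {D : Ω → ℝ} (hD : AEStronglyMeasurable D μ) {F : ℕ → Ω → ℝ}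
    (hF : ∀ n, AEStronglyMeasurable (F n) μ) (hFD : ∀ n, ∀ᵐ ω ∂μ, ‖F n ω‖ ≤ D ω) :
    ∃ σ : ℕ → ℕ, StrictMono σ ∧ ∀ g : Ω → ℝ, Integrable (fun ω => D ω * g ω) μ →
      ∃ l, Tendsto (fun n => ∫ ω, F (σ n) ω * g ω ∂μ) atTop (𝓝 l) := by
  -- Dividing by the majorant places the sequence in the unit ball of the dual of L¹.
  have hθ : ∀ n, ∀ᵐ ω ∂μ, ‖F n ω / D ω‖ ≤ 1 := fun n => by
    filter_upwards [hFD n] with ω hω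
    rw [norm_div, Real.norm_of_nonneg ((norm_nonneg _).trans hω)]
    exact div_le_one_of_le₀ hω ((norm_nonneg _).trans hω)
  choose L hL1 hL using fun n => exists_dual_of_bounded ((hF n).div₀ hD) (hθ n)
  -- Needed for separability of L¹, on which the sequential form of Banach–Alaoglu depends.
  have : Fact ((1 : ℝ≥0∞) ≠ ∞) := ⟨ENNReal.one_ne_top⟩
  obtain ⟨L', -, σ, hσ, hlim⟩ := WeakDual.isSeqCompact_closedBall ℝ (Lp ℝ 1 μ) 0 1
    (x := fun n => StrongDual.toWeakDual (L n)) (fun n => by simpa using hL1 n)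
  refine ⟨σ, hσ, fun g hg => ⟨L' hg.toL1, ?_⟩⟩
  have h1 : Tendsto (fun n => L (σ n) hg.toL1) atTop (𝓝 (L' hg.toL1)) :=
    ((WeakDual.eval_continuous hg.toL1).tendsto L').comp hlim
  refine h1.congr fun n => ?_
  rw [hL]
  refine integral_congr_ae ?_
  filter_upwards [hg.coeFn_toL1, hFD (σ n)] with ω hω hb
  rw [hω]
  -- Where D vanishes so does F, hence the value assigned to the quotient there is immaterial.
  rcases eq_or_ne (D ω) 0 with h | h
  · rw [h] at hb
    have h0 : F (σ n) ω = 0 := norm_le_zero_iff.1 hb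
    simp [h0]
  · simp only [Pi.div_apply]; field_simp

end WeakCompactness

/-! ### The mild formulation and the delayed scheme. -/

section Existence

variable {N : ℕ} {E : Type*} [NormedAddCommGroup E] [NormedSpace ℝ E]
  {k : Space N → ℝ → E} {κ a : ℝ} {F : Space N × ℝ → ℝ} {φ : Space N → ℝ}

/-- The right-hand side of the integral equation with kernel `k`, initial datum `φ` and source `F`
acting during the times in `I`. -/
noncomputable def mild (k : Space N → ℝ → E) (φ : Space N → ℝ) (F : Space N × ℝ → ℝ) (I : Set ℝ)
    (x : Space N) (t : ℝ) : E :=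
  (∫ ξ, φ ξ • k (x - ξ) t) + potential k F I x t

theorem IsHeatKernel.stronglyMeasurable_mild (hk : IsHeatKernel k κ a) (hφ : Measurable φ)
    (hF : Measurable F) (δ : ℝ) :
    StronglyMeasurable fun z : Space N × ℝ => mild k φ F (Ioc 0 (z.2 - δ)) z.1 z.2 := by
  refine StronglyMeasurable.add ?_ ?_
  · refine StronglyMeasurable.integral_prod_right' (f := fun q : (Space N × ℝ) × Space N =>
      φ q.2 • k (q.1.1 - q.2) q.1.2) ?_
    exact (hφ.comp measurable_snd).stronglyMeasurable.smul
      (hk.stronglyMeasurable_comp (by fun_prop) (by fun_prop))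
  · have h1 : ∀ z : Space N × ℝ, potential k F (Ioc 0 (z.2 - δ)) z.1 z.2 =
        ∫ p, {q : (Space N × ℝ) × Space N × ℝ | 0 < q.2.2 ∧ q.2.2 ≤ q.1.2 - δ}.indicator
          (fun q => F q.2 • k (q.1.1 - q.2.1) (q.1.2 - q.2.2)) (z, p) := by
      intro z
      rw [potential, ← integral_indicator (MeasurableSet.univ.prod measurableSet_Ioc)]
      refine integral_congr_ae (Eventually.of_forall fun p => ?_)
      simp [indicator]
    simp_rw [h1]
    refine StronglyMeasurable.integral_prod_right' ?_
    refine StronglyMeasurable.indicator ?_ ?_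
    · exact (hF.comp measurable_snd).stronglyMeasurable.smul
        (hk.stronglyMeasurable_comp (y := fun q : (Space N × ℝ) × Space N × ℝ => q.1.1 - q.2.1)
          (τ := fun q => q.1.2 - q.2.2) (by fun_prop) (by fun_prop))
    · exact (measurableSet_lt measurable_const (measurable_snd.comp measurable_snd)).inter
        (measurableSet_le (measurable_snd.comp measurable_snd)
          ((measurable_snd.comp measurable_fst).sub_const δ))

theorem IsHeatKernel.enorm_initial_le (hk : IsHeatKernel k κ a) (φ : Space N → ℝ) (x : Space N)
    {t : ℝ} (ht : 0 < t) :
    ∫⁻ ξ, ‖φ ξ • k (x - ξ) t‖ₑ ≤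
      ENNReal.ofReal (κ * t ^ (-a)) * heat (2 * t) (fun ξ => ‖φ ξ‖ₑ) x := by
  unfold heat
  rw [← lintegral_const_mul' _ _ ENNReal.ofReal_ne_top]
  refine lintegral_mono fun ξ => ?_
  rw [enorm_smul, ← mul_assoc, mul_comm]
  exact mul_le_mul_left (hk.enorm_le _ _ ht) _

variable {f : Space N → ℝ → ℝ → Space N → ℝ} {A C D : ℝ} {w : ℝ → ℝ}

/-- The smallness D⁻¹ built into the weight cancels the size D of the source, so the Duhamel term
costs only κ t^(-a) w(t). -/
theorem IsSource.enorm_mild_le (hk : IsHeatKernel k κ a) (hφ : Measurable φ) (hD : 0 ≤ D)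
    (hw : Measurable w) (hw1 : ∀ s, 1 ≤ w s)
    (hwint : ∀ t, 0 < t → ∫⁻ s in Ioo 0 t, ENNReal.ofReal ((t - s) ^ (-a) * (rate A s * w s)) ≤
      ENNReal.ofReal (D⁻¹ * t ^ (-a) * w t))
    (hF : IsSource F (fun s => ENNReal.ofReal (D * (rate A s * w s))) fun ξ => ‖φ ξ‖ₑ)
    {I : Set ℝ} (hI : MeasurableSet I) (x : Space N) {t : ℝ} (hIt : I ⊆ Ioo 0 t) (ht : 0 < t) :
    ‖mild k φ F I x t‖ₑ ≤
      ENNReal.ofReal (κ * t ^ (-a) * (1 + w t)) * heat (2 * t) (fun ξ => ‖φ ξ‖ₑ) x := by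
  have hκ := hk.const_nonneg
  have hwt := hw1 t
  have h1 : ‖∫ ξ, φ ξ • k (x - ξ) t‖ₑ ≤ _ :=
    (enorm_integral_le_lintegral_enorm _).trans (hk.enorm_initial_le φ x ht)
  have h2 := (enorm_potential_le k F I x t).trans (hF.lintegral_le hk hφ.enorm
    ((measurable_rate.mul hw).const_mul D).ennreal_ofReal hI hIt x)
  have h3 : ∫⁻ s in I, ENNReal.ofReal (κ * (t - s) ^ (-a)) *
      ENNReal.ofReal (D * (rate A s * w s)) ≤ ENNReal.ofReal (κ * t ^ (-a) * w t) := by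
    calc _ ≤ ∫⁻ s in Ioo 0 t, ENNReal.ofReal (κ * (t - s) ^ (-a)) *
          ENNReal.ofReal (D * (rate A s * w s)) := lintegral_mono_set hIt
      _ ≤ ∫⁻ s in Ioo 0 t, ENNReal.ofReal (κ * D) *
          ENNReal.ofReal ((t - s) ^ (-a) * (rate A s * w s)) := by
          refine setLIntegral_mono_ae' measurableSet_Ioo (Eventually.of_forall fun s hs => ?_)
          have h1 : 0 ≤ (t - s) ^ (-a) := Real.rpow_nonneg (by linarith [hs.2]) _
          rw [← ENNReal.ofReal_mul (by positivity), ← ENNReal.ofReal_mul (by positivity)]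
          exact le_of_eq (by congr 1; ring)
      _ ≤ ENNReal.ofReal (κ * D) * ENNReal.ofReal (D⁻¹ * t ^ (-a) * w t) := by
          rw [lintegral_const_mul' _ _ ENNReal.ofReal_ne_top]
          exact mul_le_mul_right (hwint t ht) _
      _ ≤ _ := by
          rw [← ENNReal.ofReal_mul (by positivity)]
          refine ENNReal.ofReal_le_ofReal ?_
          have h4 : D * D⁻¹ ≤ 1 := mul_inv_le_one
          have h5 : 0 ≤ κ * t ^ (-a) * w t := by positivity
          calc κ * D * (D⁻¹ * t ^ (-a) * w t) = (D * D⁻¹) * (κ * t ^ (-a) * w t) := by ring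
            _ ≤ 1 * (κ * t ^ (-a) * w t) := by gcongr
            _ = _ := one_mul _
  refine (enorm_add_le _ _).trans ((add_le_add h1 (h2.trans (mul_le_mul_left h3 _))).trans
    (le_of_eq ?_))
  rw [← add_mul, ← ENNReal.ofReal_add (by positivity) (by positivity)]
  congr 2; ring

/-- One step of the scheme with time delay `δ`. -/
noncomputable def delayStep (f : Space N → ℝ → ℝ → Space N → ℝ) (φ : Space N → ℝ) (δ : ℝ)
    (F : Space N × ℝ → ℝ) : Space N × ℝ → ℝ := by
  classical
  exact (spaceTime N).piecewise (fun p => f p.1 p.2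
    (mild (fun x t => gaussKernel x t) φ F (Ioc 0 (p.2 - δ)) p.1 p.2)
    (mild (fun x t => gaussGrad x t) φ F (Ioc 0 (p.2 - δ)) p.1 p.2)) 0

theorem delayStep_of_pos {δ : ℝ} {p : Space N × ℝ} (hp : 0 < p.2) :
    delayStep f φ δ F p = f p.1 p.2
      (mild (fun x t => gaussKernel x t) φ F (Ioc 0 (p.2 - δ)) p.1 p.2)
      (mild (fun x t => gaussGrad x t) φ F (Ioc 0 (p.2 - δ)) p.1 p.2) := by
  classical
  exact piecewise_eq_of_mem _ _ _ hp

theorem delayStep_of_nonpos {δ : ℝ} {p : Space N × ℝ} (hp : p.2 ≤ 0) :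
    delayStep f φ δ F p = 0 := by
  classical
  exact piecewise_eq_of_notMem _ _ _ (not_lt.2 hp)

/-- The nonlinearity is continuous only for positive times; extending it by zero makes the
composition Borel on all of space-time. -/
theorem measurable_comp_nonlinearity
    (hf : ContinuousOn (fun z : Space N × ℝ × ℝ × Space N => f z.1 z.2.1 z.2.2.1 z.2.2.2)
      {z | 0 < z.2.1}) {U : Space N × ℝ → ℝ} {V : Space N × ℝ → Space N} (hU : Measurable U)
    (hV : Measurable V) [DecidablePred (· ∈ spaceTime N)] :
    Measurable ((spaceTime N).piecewise (fun p => f p.1 p.2 (U p) (V p)) 0) := by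
  classical
  have hS : MeasurableSet {z : Space N × ℝ × ℝ × Space N | 0 < z.2.1} :=
    measurableSet_lt measurable_const (by fun_prop)
  have h1 := hf.measurable_piecewise (g := 0) continuousOn_const hS
  have h2 : Measurable fun p : Space N × ℝ => (p.1, p.2, U p, V p) := by fun_prop
  have h3 := h1.comp h2
  convert h3 using 1
  funext p
  by_cases hp : p ∈ spaceTime N
  · have : (p.1, p.2, U p, V p) ∈ {z : Space N × ℝ × ℝ × Space N | 0 < z.2.1} := hp
    rw [piecewise_eq_of_mem _ _ _ hp, Function.comp, piecewise_eq_of_mem _ _ _ this]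
  · have : (p.1, p.2, U p, V p) ∉ {z : Space N × ℝ × ℝ × Space N | 0 < z.2.1} := hp
    rw [piecewise_eq_of_notMem _ _ _ hp, Function.comp, piecewise_eq_of_notMem _ _ _ this]
    rfl

/-- The a priori bound reproduces itself. The growth condition turns the bounds on u and ∇u into C
2^(N/2) rate(t) (1 + w(t)) H(t), and 1 ≤ w(t) gives 1 + w ≤ 2w. This dictates D = 2C·2^(N/2),
independent of the delay. -/
theorem IsSource.delayStep
    (hf : ContinuousOn (fun z : Space N × ℝ × ℝ × Space N => f z.1 z.2.1 z.2.2.1 z.2.2.2)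
      {z | 0 < z.2.1}) (hC : 0 < C)
    (hfbound : ∀ (x : Space N) (t : ℝ) (p : ℝ) (q : Space N),
      0 < t → |f x t p q| ≤ C * (1 + t) ^ (-A) * (|p| + (1 + t) ^ (1 / 2 : ℝ) * ‖q‖))
    (hφ : Measurable φ) (hφ' : ∫⁻ ξ, ‖φ ξ‖ₑ ≠ ∞) (hDC : D = 2 * C * 2 ^ ((N : ℝ) / 2))
    (hw : Measurable w) (hw1 : ∀ s, 1 ≤ w s)
    (hwint : ∀ a : ℝ, a = 0 ∨ a = 1 / 2 → ∀ t, 0 < t →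
      ∫⁻ s in Ioo 0 t, ENNReal.ofReal ((t - s) ^ (-a) * (rate A s * w s)) ≤
        ENNReal.ofReal (D⁻¹ * t ^ (-a) * w t))
    {δ : ℝ} (hδ : 0 < δ)
    (hF : IsSource F (fun s => ENNReal.ofReal (D * (rate A s * w s))) fun ξ => ‖φ ξ‖ₑ) :
    IsSource (delayStep f φ δ F) (fun s => ENNReal.ofReal (D * (rate A s * w s)))
      fun ξ => ‖φ ξ‖ₑ where
  measurable := by
    classical
    exact measurable_comp_nonlinearity hf
      ((isHeatKernel_gaussKernel N).stronglyMeasurable_mild hφ hF.measurable δ).measurable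
      ((isHeatKernel_gaussGrad N).stronglyMeasurable_mild hφ hF.measurable δ).measurable
  enorm_le := by
    rintro ⟨x, t⟩ (ht : 0 < t)
    rw [delayStep_of_pos (by exact ht)]
    have hD : 0 ≤ D := by rw [hDC]; positivity
    have hI : Ioc 0 (t - δ) ⊆ Ioo 0 t := fun s hs => ⟨hs.1, hs.2.trans_lt (by linarith)⟩
    have hwt := hw1 t
    have hU := IsSource.enorm_mild_le (isHeatKernel_gaussKernel N) hφ hD hw hw1
      (hwint 0 (Or.inl rfl)) hF measurableSet_Ioc x hI ht
    have hV := IsSource.enorm_mild_le (isHeatKernel_gaussGrad N) hφ hD hw hw1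
      (hwint (1 / 2) (Or.inr rfl)) hF measurableSet_Ioc x hI ht
    have hH := (heat_lt_top hφ' (show 0 < 2 * t by linarith) x).ne
    set H := heat (2 * t) (fun ξ => ‖φ ξ‖ₑ) x
    rw [← ENNReal.ofReal_toReal hH, ← ENNReal.ofReal_mul (by positivity), ← ofReal_norm,
      ENNReal.ofReal_le_ofReal_iff (by positivity)] at hU hV
    have hr := rate_nonneg (A := A) ht
    rw [← ENNReal.ofReal_toReal hH]
    simp only
    rw [← ENNReal.ofReal_mul (by positivity), ← ofReal_norm]
    refine ENNReal.ofReal_le_ofReal ((hfbound x t _ _ ht).trans ?_)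
    rw [← Real.norm_eq_abs]
    set κ : ℝ := 2 ^ ((N : ℝ) / 2)
    have hκ : 0 ≤ κ := by positivity
    calc _ ≤ C * (1 + t) ^ (-A) * (κ * t ^ (-(0 : ℝ)) * (1 + w t) * H.toReal +
          (1 + t) ^ (1 / 2 : ℝ) * (κ * t ^ (-(1 / 2 : ℝ)) * (1 + w t) * H.toReal)) := by gcongr
      _ = C * κ * rate A t * (1 + w t) * H.toReal := by
          unfold rate; rw [neg_zero, Real.rpow_zero]; ring
      _ ≤ C * κ * rate A t * (w t + w t) * H.toReal := by gcongr
      _ = _ := by rw [hDC]; ring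

/-- Causality with a gain: a step at time t reads the source only up to t - δ. -/
theorem delayStep_congr {F F' : Space N × ℝ → ℝ} {b δ : ℝ}
    (h : ∀ p, p.2 ≤ b → F p = F' p) (p : Space N × ℝ) (hp : p.2 ≤ b + δ) :
    delayStep f φ δ F p = delayStep f φ δ F' p := by
  rcases le_or_gt p.2 0 with h0 | h0
  · rw [delayStep_of_nonpos h0, delayStep_of_nonpos h0]
  have hpot : ∀ {E' : Type} [NormedAddCommGroup E'] [NormedSpace ℝ E'] (k : Space N → ℝ → E'),
      mild k φ F (Ioc 0 (p.2 - δ)) p.1 p.2 = mild k φ F' (Ioc 0 (p.2 - δ)) p.1 p.2 := by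
    intro E' _ _ k
    unfold mild potential
    congr 1
    refine setIntegral_congr_fun (MeasurableSet.univ.prod measurableSet_Ioc) fun q hq => ?_
    rw [h q (by linarith [hq.2.2])]
  rw [delayStep_of_pos h0, delayStep_of_pos h0, hpot, hpot]

/-- Each iteration gains δ in time, so the delayed equation is solved exactly up to time nδ, with no
convergence argument. -/
theorem delayStep_iterate_stable {δ : ℝ} (n : ℕ) :
    ∀ p : Space N × ℝ, p.2 ≤ n * δ →
      (delayStep f φ δ)^[n] 0 p = delayStep f φ δ ((delayStep f φ δ)^[n] 0) p := by
  induction n with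
  | zero =>
    intro p hp
    rw [delayStep_of_nonpos (by simpa using hp)]; rfl
  | succ n ih =>
    intro p hp
    rw [Function.iterate_succ_apply']
    refine delayStep_congr ih p ?_
    push_cast at hp
    linarith

end Existence

/-! ### Removal of the delay. -/

section Limit

variable {N : ℕ} {E : Type*} [NormedAddCommGroup E]
  {k : Space N → ℝ → E} {κ a : ℝ} {F : Space N × ℝ → ℝ} {φ : Space N → ℝ}
  {ψ : Space N → ℝ≥0∞} {A B : ℝ}

theorem IsSource.mono {β β' : ℝ → ℝ≥0∞} (hF : IsSource F β ψ) (h : ∀ s, 0 < s → β s ≤ β' s) :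
    IsSource F β' ψ where
  measurable := hF.measurable
  enorm_le p hp := (hF.enorm_le p hp).trans (mul_le_mul_left (h _ hp) _)

theorem IsHeatKernel.lintegral_dominated_ne_top (hk : IsHeatKernel k κ a) (hψ : Measurable ψ)
    (hψ' : ∫⁻ y, ψ y ≠ ∞) (hA : 1 < A) (hB : 0 ≤ B) (x : Space N) {t : ℝ} (ht : 0 < t) :
    ∫⁻ p in univ ×ˢ Ioo 0 t, ‖k (x - p.1) (t - p.2)‖ₑ *
      (ENNReal.ofReal (B * rate A p.2) * heat (2 * p.2) ψ p.1) ≠ ∞ := by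
  obtain ⟨c, hc, hct⟩ := exists_lintegral_rate_le hA
  refine ne_top_of_le_ne_top ?_ (hk.lintegral_dominated_le hψ (measurable_ofReal_rate (B := B)
    (A := A)) measurableSet_Ioo subset_rfl x)
  refine ENNReal.mul_ne_top (ne_top_of_le_ne_top ?_ ((lintegral_mul_rate_le hk.const_nonneg hB).trans
    (mul_le_mul_right (hct a hk.exponent t ht) _))) (heat_lt_top hψ' (by linarith) x).ne
  exact ENNReal.mul_ne_top ENNReal.ofReal_ne_top ENNReal.ofReal_ne_top

/-- Sources with a common dominating function have a subsequence along which all the potentials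
of scalar kernels converge pointwise. -/
theorem exists_subseq_tendsto_potential (hψ : Measurable ψ) (hψ' : ∫⁻ y, ψ y ≠ ∞) (hA : 1 < A)
    (hB : 0 ≤ B) {F : ℕ → Space N × ℝ → ℝ}
    (hF : ∀ n, IsSource (F n) (fun s => ENNReal.ofReal (B * rate A s)) ψ) :
    ∃ σ : ℕ → ℕ, StrictMono σ ∧ ∀ (k : Space N → ℝ → ℝ) (κ a : ℝ), IsHeatKernel k κ a →
      ∀ x t, 0 < t → ∃ l, Tendsto (fun n => potential k (F (σ n)) (Ioo 0 t) x t) atTop (𝓝 l) := by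
  let D : Space N × ℝ → ℝ := fun p =>
    (ENNReal.ofReal (B * rate A p.2) * heat (2 * p.2) ψ p.1).toReal
  have hfin : ∀ p : Space N × ℝ, 0 < p.2 →
      ENNReal.ofReal (B * rate A p.2) * heat (2 * p.2) ψ p.1 ≠ ∞ := fun p hp =>
    ENNReal.mul_ne_top ENNReal.ofReal_ne_top (heat_lt_top hψ' (by linarith) p.1).ne
  have hDm : Measurable D := by
    have h1 : Measurable fun p : Space N × ℝ => heat (2 * p.2) ψ p.1 :=
      measurable_heat_comp hψ (by fun_prop) (by fun_prop)
    have h2 : Measurable fun p : Space N × ℝ => ENNReal.ofReal (B * rate A p.2) :=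
      measurable_ofReal_rate.comp measurable_snd
    exact (h2.mul h1).ennreal_toReal
  obtain ⟨σ, hσ, hlim⟩ := exists_subseq_tendsto_integral (μ := volume.restrict (spaceTime N))
    (D := D) hDm.aestronglyMeasurable (F := F) (fun n => (hF n).measurable.aestronglyMeasurable)
    (fun n => by
      filter_upwards [ae_restrict_mem measurableSet_spaceTime] with p hp
      have := (hF n).enorm_le p hp
      rw [← ofReal_norm, ← ENNReal.ofReal_toReal (hfin p hp),
        ENNReal.ofReal_le_ofReal_iff ENNReal.toReal_nonneg] at this
      exact this)
  refine ⟨σ, hσ, fun k κ a hk x t ht => ?_⟩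
  have hS : MeasurableSet ((univ : Set (Space N)) ×ˢ Ioo 0 t) :=
    MeasurableSet.univ.prod measurableSet_Ioo
  have hkm : StronglyMeasurable fun p : Space N × ℝ => k (x - p.1) (t - p.2) :=
    hk.stronglyMeasurable_comp (by fun_prop) (by fun_prop)
  have hsub : spaceTime N ∩ (univ ×ˢ Ioo 0 t) = univ ×ˢ Ioo 0 t :=
    inter_eq_right.2 fun p hp => hp.2.1
  -- Kernels and base points (x,t) enter only as test functions, so one subsequence serves them all.
  obtain ⟨l, hl⟩ := hlim ((univ ×ˢ Ioo 0 t).indicator fun p => k (x - p.1) (t - p.2)) (by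
    have h1 : (fun p => D p * (univ ×ˢ Ioo 0 t).indicator
        (fun p : Space N × ℝ => k (x - p.1) (t - p.2)) p) =
        (univ ×ˢ Ioo 0 t).indicator (fun p => D p * k (x - p.1) (t - p.2)) := by
      funext p
      by_cases hp : p ∈ (univ : Set (Space N)) ×ˢ Ioo 0 t
      · rw [indicator_of_mem hp, indicator_of_mem hp]
      · rw [indicator_of_notMem hp, indicator_of_notMem hp, mul_zero]
    rw [h1, integrable_indicator_iff hS, IntegrableOn, Measure.restrict_restrict hS, inter_comm,
      hsub]
    refine ⟨(hDm.stronglyMeasurable.mul hkm).aestronglyMeasurable, ?_⟩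
    rw [hasFiniteIntegral_iff_enorm]
    refine lt_of_le_of_lt ?_
      (hk.lintegral_dominated_ne_top hψ hψ' hA hB x ht).lt_top
    refine setLIntegral_mono_ae' hS (Eventually.of_forall fun p hp => ?_)
    rw [enorm_mul, mul_comm, Real.enorm_of_nonneg ENNReal.toReal_nonneg,
      ENNReal.ofReal_toReal (hfin p hp.2.1)])
  refine ⟨l, hl.congr fun n => ?_⟩
  have h1 : (fun p => F (σ n) p * (univ ×ˢ Ioo 0 t).indicator
      (fun p : Space N × ℝ => k (x - p.1) (t - p.2)) p) =
      (univ ×ˢ Ioo 0 t).indicator (fun p => F (σ n) p • k (x - p.1) (t - p.2)) := by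
    funext p
    by_cases hp : p ∈ (univ : Set (Space N)) ×ˢ Ioo 0 t
    · rw [indicator_of_mem hp, indicator_of_mem hp, smul_eq_mul]
    · rw [indicator_of_notMem hp, indicator_of_notMem hp, mul_zero]
  rw [h1, setIntegral_indicator hS, hsub]
  rfl

/-- The compactness statement concerns scalar kernels; the gradient kernel is handled coordinate by
coordinate. -/
theorem IsHeatKernel.coord {k : Space N → ℝ → Space N} (hk : IsHeatKernel k κ a) (i : Fin N) :
    IsHeatKernel (fun x t => k x t i) κ a where
  stronglyMeasurable :=
    (EuclideanSpace.proj (𝕜 := ℝ) i).continuous.comp_stronglyMeasurable hk.stronglyMeasurable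
  continuousOn := (EuclideanSpace.proj (𝕜 := ℝ) i).continuous.comp_continuousOn hk.continuousOn
  const_nonneg := hk.const_nonneg
  exponent := hk.exponent
  enorm_le x t ht := by
    refine le_trans ?_ (hk.enorm_le x t ht)
    rw [← ofReal_norm, ← ofReal_norm]
    exact ENNReal.ofReal_le_ofReal (PiLp.norm_apply_le (k x t) i)

theorem IsSource.potential_coord {k : Space N → ℝ → Space N} (hk : IsHeatKernel k κ a)
    (hψ : Measurable ψ) (hψ' : ∫⁻ y, ψ y ≠ ∞) (hA : 1 < A) (hB : 0 ≤ B)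
    (hF : IsSource F (fun s => ENNReal.ofReal (B * rate A s)) ψ) (x : Space N) {t : ℝ}
    (ht : 0 < t) (i : Fin N) :
    potential k F (Ioo 0 t) x t i = potential (fun x t => k x t i) F (Ioo 0 t) x t := by
  have h := (EuclideanSpace.proj (𝕜 := ℝ) i).integral_comp_comm
    (hF.integrableOn_kernel hk hψ hψ' hA hB x ht)
  exact h.symm

variable [NormedSpace ℝ E]

/-- Dominated convergence for potentials. -/
theorem tendsto_potential (hk : IsHeatKernel k κ a) (hψ : Measurable ψ) (hψ' : ∫⁻ y, ψ y ≠ ∞)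
    (hA : 1 < A) (hB : 0 ≤ B) {F : ℕ → Space N × ℝ → ℝ} {F' : Space N × ℝ → ℝ}
    (hF : ∀ n, IsSource (F n) (fun s => ENNReal.ofReal (B * rate A s)) ψ)
    (hlim : ∀ p, 0 < p.2 → Tendsto (fun n => F n p) atTop (𝓝 (F' p))) (x : Space N) {t : ℝ}
    (ht : 0 < t) :
    Tendsto (fun n => potential k (F n) (Ioo 0 t) x t) atTop
      (𝓝 (potential k F' (Ioo 0 t) x t)) := by
  have hS : MeasurableSet ((univ : Set (Space N)) ×ˢ Ioo 0 t) :=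
    MeasurableSet.univ.prod measurableSet_Ioo
  have hm : Measurable fun p : Space N × ℝ => ‖k (x - p.1) (t - p.2)‖ₑ *
      (ENNReal.ofReal (B * rate A p.2) * heat (2 * p.2) ψ p.1) := by
    have h1 : Measurable fun p : Space N × ℝ => heat (2 * p.2) ψ p.1 :=
      measurable_heat_comp hψ (by fun_prop) (by fun_prop)
    have h2 : Measurable fun p : Space N × ℝ => ENNReal.ofReal (B * rate A p.2) :=
      measurable_ofReal_rate.comp measurable_snd
    have h3 : Measurable fun p : Space N × ℝ => ‖k (x - p.1) (t - p.2)‖ₑ :=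
      (hk.stronglyMeasurable_comp (by fun_prop) (by fun_prop)).enorm
    exact h3.mul (h2.mul h1)
  have hfin := hk.lintegral_dominated_ne_top hψ hψ' hA hB x ht
  have hae := ae_lt_top hm hfin
  refine tendsto_integral_of_dominated_convergence _
    (fun n => (hk.stronglyMeasurable_source (hF n).measurable x t).aestronglyMeasurable)
    (integrable_toReal_of_lintegral_ne_top hm.aemeasurable hfin) (fun n => ?_) ?_
  · filter_upwards [ae_restrict_mem hS, hae] with p hp hpt
    have h1 : ‖F n p • k (x - p.1) (t - p.2)‖ₑ ≤ ‖k (x - p.1) (t - p.2)‖ₑ *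
        (ENNReal.ofReal (B * rate A p.2) * heat (2 * p.2) ψ p.1) := by
      rw [enorm_smul, mul_comm]
      exact mul_le_mul_right ((hF n).enorm_le p hp.2.1) _
    rw [← ofReal_norm, ← ENNReal.ofReal_toReal hpt.ne,
      ENNReal.ofReal_le_ofReal_iff ENNReal.toReal_nonneg] at h1
    exact h1
  · filter_upwards [ae_restrict_mem hS] with p hp
    exact (hlim p hp.2.1).smul_const _

/-- A delay tending to zero does not change limits of potentials. -/
theorem tendsto_potential_delay (hk : IsHeatKernel k κ a) (hψ : Measurable ψ)
    (hψ' : ∫⁻ y, ψ y ≠ ∞) (hA : 1 < A) (hB : 0 ≤ B) {F : ℕ → Space N × ℝ → ℝ}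
    (hF : ∀ n, IsSource (F n) (fun s => ENNReal.ofReal (B * rate A s)) ψ) {δ : ℕ → ℝ}
    (hδ0 : ∀ n, 0 < δ n) (hδ : Tendsto δ atTop (𝓝 0)) (x : Space N) {t : ℝ} (ht : 0 < t) {l : E}
    (hl : Tendsto (fun n => potential k (F n) (Ioo 0 t) x t) atTop (𝓝 l)) :
    Tendsto (fun n => potential k (F n) (Ioc 0 (t - δ n)) x t) atTop (𝓝 l) := by
  obtain ⟨c, hc, hcb⟩ := hk.exists_norm_potential_near_le hψ hψ' hA hB
    (show 0 < t / 2 by linarith)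
  have ha1 : 0 < 1 - a := by linarith [hk.exponent_lt_one]
  have hpow : Tendsto (fun n => c * δ n ^ (1 - a)) atTop (𝓝 0) := by
    have := (Real.continuousAt_rpow_const 0 (1 - a) (Or.inr ha1.le)).tendsto
    rw [Real.zero_rpow ha1.ne'] at this
    simpa using (this.comp hδ).const_mul c
  have hsmall : ∀ᶠ n in atTop, δ n ≤ t / 2 := hδ.eventually_le_const (by linarith)
  have h0 : Tendsto (fun n => potential k (F n) (Ioo (t - δ n) t) x t) atTop (𝓝 0) := by
    refine squeeze_zero_norm' ?_ hpow
    filter_upwards [hsmall] with n hn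
    exact hcb _ (hF n) _ _ _ (hδ0 n) (by linarith)
  have h1 := hl.sub h0
  rw [sub_zero] at h1
  refine h1.congr' ?_
  filter_upwards [hsmall] with n hn
  rw [potential_split (hF n) hk hψ hψ' hA hB x le_rfl (show 0 ≤ t - δ n by linarith)
    (show t - δ n < t by linarith [hδ0 n]), add_sub_cancel_right]

variable {f : Space N → ℝ → ℝ → Space N → ℝ} {C : ℝ}

/-- Existence of a source consistent with the nonlinearity, that is, of a mild solution. -/
theorem exists_mild_source
    (hf : ContinuousOn (fun z : Space N × ℝ × ℝ × Space N => f z.1 z.2.1 z.2.2.1 z.2.2.2)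
      {z | 0 < z.2.1}) (hC : 0 < C) (hA : 1 < A)
    (hfbound : ∀ (x : Space N) (t : ℝ) (p : ℝ) (q : Space N),
      0 < t → |f x t p q| ≤ C * (1 + t) ^ (-A) * (|p| + (1 + t) ^ (1 / 2 : ℝ) * ‖q‖))
    (hφ : Measurable φ) (hφ' : ∫⁻ ξ, ‖φ ξ‖ₑ ≠ ∞) :
    ∃ (F : Space N × ℝ → ℝ) (B : ℝ), 0 ≤ B ∧
      IsSource F (fun s => ENNReal.ofReal (B * rate A s)) (fun ξ => ‖φ ξ‖ₑ) ∧
      ∀ x t, 0 < t → F (x, t) = f x t (mild (fun x t => gaussKernel x t) φ F (Ioo 0 t) x t)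
        (mild (fun x t => gaussGrad x t) φ F (Ioo 0 t) x t) := by
  classical
  obtain ⟨D, hDC⟩ : ∃ D : ℝ, D = 2 * C * 2 ^ ((N : ℝ) / 2) := ⟨_, rfl⟩
  have hD : 0 < D := by rw [hDC]; positivity
  -- The Volterra operator is made smaller than the size D of the nonlinearity can amplify.
  obtain ⟨w, hw, hw1, ⟨W, hW⟩, hwint⟩ := exists_weight hA (inv_pos.2 hD)
  have hW0 : 0 ≤ W := by linarith [hw1 0, hW 0]
  have hψ : Measurable fun ξ => ‖φ ξ‖ₑ := hφ.enorm
  let δ : ℕ → ℝ := fun n => 1 / ((n : ℝ) + 1)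
  have hδ0 : ∀ n, 0 < δ n := fun n => by positivity
  have hδ : Tendsto δ atTop (𝓝 0) := tendsto_one_div_add_atTop_nhds_zero_nat
  have hsrc : ∀ (δ : ℝ), 0 < δ → ∀ m, IsSource ((delayStep f φ δ)^[m] 0)
      (fun s => ENNReal.ofReal (D * (rate A s * w s))) fun ξ => ‖φ ξ‖ₑ := by
    intro δ hδ m
    induction m with
    | zero => exact ⟨measurable_const, fun p hp => by simp⟩
    | succ m ih =>
      rw [Function.iterate_succ_apply']
      exact IsSource.delayStep hf hC hfbound hφ hφ' hDC hw hw1 hwint hδ ih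
  have hB : 0 ≤ D * W := by positivity
  -- With delay 1/(n+1), performing (n+1)² steps reaches time n+1, so the delayed equation holds up
  -- to time n.
  let F₀ : ℕ → Space N × ℝ → ℝ := fun n => (delayStep f φ (δ n))^[(n + 1) ^ 2] 0
  have hF₀ : ∀ n, IsSource (F₀ n) (fun s => ENNReal.ofReal (D * W * rate A s))
      fun ξ => ‖φ ξ‖ₑ := fun n => by
    refine (hsrc _ (hδ0 n) _).mono fun s hs => ENNReal.ofReal_le_ofReal ?_
    have := rate_nonneg (A := A) hs
    calc D * (rate A s * w s) ≤ D * (rate A s * W) := by gcongr; exact hW s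
      _ = _ := by ring
  have hfix : ∀ (n : ℕ) (p : Space N × ℝ), p.2 ≤ n → F₀ n p = delayStep f φ (δ n) (F₀ n) p := by
    intro n p hp
    refine delayStep_iterate_stable _ p (hp.trans ?_)
    simp only [δ]
    push_cast
    field_simp
    nlinarith
  obtain ⟨σ, hσ, hlim⟩ := exists_subseq_tendsto_potential hψ hφ' hA hB hF₀
  have hk0 := isHeatKernel_gaussKernel N
  have hk1 := isHeatKernel_gaussGrad N
  have hFσ : ∀ n, IsSource (F₀ (σ n)) (fun s => ENNReal.ofReal (D * W * rate A s))
      fun ξ => ‖φ ξ‖ₑ := fun n => hF₀ _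
  have hlim1 : ∀ x t, 0 < t → ∃ l, Tendsto (fun n => potential (fun x t => gaussGrad x t)
      (F₀ (σ n)) (Ioo 0 t) x t) atTop (𝓝 l) := by
    intro x t ht
    choose l hl using fun i => hlim _ _ _ (hk1.coord i) x t ht
    refine ⟨WithLp.toLp 2 l, ?_⟩
    have h1 : Tendsto (fun n => fun i => potential (fun x t => gaussGrad x t)
        (F₀ (σ n)) (Ioo 0 t) x t i) atTop (𝓝 l) := by
      rw [tendsto_pi_nhds]
      intro i
      refine (hl i).congr fun n => ?_
      exact ((hFσ n).potential_coord hk1 hψ hφ' hA hB x ht i).symm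
    exact ((PiLp.continuous_toLp 2 _).tendsto l).comp h1
  choose! u hu using hlim _ _ _ hk0
  choose! v hv using hlim1
  have hδσ : Tendsto (fun n => δ (σ n)) atTop (𝓝 0) := hδ.comp hσ.tendsto_atTop
  let U : Space N → ℝ → ℝ := fun x t => (∫ ξ, φ ξ • gaussKernel (x - ξ) t) + u x t
  let V : Space N → ℝ → Space N := fun x t => (∫ ξ, φ ξ • gaussGrad (x - ξ) t) + v x t
  let F : Space N × ℝ → ℝ := (spaceTime N).piecewise
    (fun p => f p.1 p.2 (U p.1 p.2) (V p.1 p.2)) 0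
  have hFval : ∀ x t, 0 < t → F (x, t) = f x t (U x t) (V x t) := fun x t ht =>
    piecewise_eq_of_mem (spaceTime N) _ _ (show (x, t) ∈ spaceTime N from ht)
  -- Weak convergence becomes pointwise here: the potentials converge at each point, the vanishing
  -- delay does not affect their limits, and F₀ is f evaluated at them, f being continuous.
  have hFlim : ∀ p : Space N × ℝ, Tendsto (fun n => F₀ (σ n) p) atTop (𝓝 (F p)) := by
    rintro ⟨x, t⟩
    have hev : ∀ᶠ n in atTop, delayStep f φ (δ (σ n)) (F₀ (σ n)) (x, t) = F₀ (σ n) (x, t) := by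
      have h1 : ∀ᶠ n in atTop, t ≤ (σ n : ℝ) :=
        (tendsto_natCast_atTop_atTop.comp hσ.tendsto_atTop).eventually_ge_atTop t
      filter_upwards [h1] with n hn
      exact (hfix _ _ hn).symm
    refine Tendsto.congr' hev ?_
    rcases le_or_gt t 0 with ht | ht
    · have h0 : F (x, t) = 0 :=
        piecewise_eq_of_notMem (spaceTime N) _ _ (show (x, t) ∉ spaceTime N from not_lt.2 ht)
      rw [h0]
      refine tendsto_const_nhds.congr fun n => ?_
      rw [delayStep_of_nonpos (by exact ht)]
    · rw [hFval x t ht]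
      have h1 := (tendsto_potential_delay hk0 hψ hφ' hA hB hFσ (fun n => hδ0 (σ n)) hδσ x ht
        (hu x t ht)).const_add (∫ ξ, φ ξ • gaussKernel (x - ξ) t)
      have h2 := (tendsto_potential_delay hk1 hψ hφ' hA hB hFσ (fun n => hδ0 (σ n)) hδσ x ht
        (hv x t ht)).const_add (∫ ξ, φ ξ • gaussGrad (x - ξ) t)
      have h3 : ContinuousAt (fun z : Space N × ℝ × ℝ × Space N => f z.1 z.2.1 z.2.2.1 z.2.2.2)
          (x, t, U x t, V x t) := hf.continuousAt ((isOpen_lt continuous_const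
            (by fun_prop : Continuous fun z : Space N × ℝ × ℝ × Space N => z.2.1)).mem_nhds ht)
      have h4 := h3.tendsto.comp ((tendsto_const_nhds (x := x)).prodMk_nhds
        ((tendsto_const_nhds (x := t)).prodMk_nhds (h1.prodMk_nhds h2)))
      refine h4.congr fun n => ?_
      rw [delayStep_of_pos (by exact ht)]
      rfl
  have hFs : IsSource F (fun s => ENNReal.ofReal (D * W * rate A s)) fun ξ => ‖φ ξ‖ₑ := by
    refine ⟨measurable_of_tendsto_metrizable (fun n => (hFσ n).measurable)
      (tendsto_pi_nhds.2 hFlim), fun p hp => ?_⟩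
    exact le_of_tendsto (hFlim p).enorm (Eventually.of_forall fun n => (hFσ n).enorm_le p hp)
  refine ⟨F, D * W, hB, hFs, fun x t ht => ?_⟩
  rw [hFval x t ht]
  -- With pointwise convergence of the sources, dominated convergence identifies the limits of the
  -- potentials as the potentials of the limit source.
  have e0 : u x t = potential (fun x t => gaussKernel x t) F (Ioo 0 t) x t :=
    tendsto_nhds_unique (hu x t ht)
      (tendsto_potential hk0 hψ hφ' hA hB hFσ (fun p _ => hFlim p) x ht)
  have e1 : v x t = potential (fun x t => gaussGrad x t) F (Ioo 0 t) x t :=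
    tendsto_nhds_unique (hv x t ht)
      (tendsto_potential hk1 hψ hφ' hA hB hFσ (fun p _ => hFlim p) x ht)
  simp only [U, V, mild, e0, e1]

end Limit

/-! ### Classical gradients as weak gradients. -/

section Gradient

variable {N : ℕ}

theorem _root_.HasGradientAt.add_gradient {u v : Space N → ℝ} {x du dv : Space N}
    (hu : HasGradientAt u du x) (hv : HasGradientAt v dv x) :
    HasGradientAt (fun y => u y + v y) (du + dv) x := by
  rw [hasGradientAt_iff_hasFDerivAt, map_add]
  exact hu.hasFDerivAt.add hv.hasFDerivAt

/-- An integrable differentiable function with continuous integrable gradient is in `W^{1,1}`. -/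
theorem hasW11Gradient_of_hasGradientAt {w : Space N → ℝ} {v : Space N → Space N}
    (hw : Integrable w) (hv : Integrable v) (h : ∀ x, HasGradientAt w (v x) x) :
    HasW11Gradient w v := by
  refine ⟨hw, hv, fun ψ hψ hψc => ?_⟩
  have hψd : Differentiable ℝ ψ := hψ.differentiable (by simp)
  have hgrad : gradient ψ = fun x => (InnerProductSpace.toDual ℝ (Space N)).symm (fderiv ℝ ψ x) :=
    rfl
  have hfc : Continuous (fderiv ℝ ψ) := hψ.continuous_fderiv (by simp)
  have hgc : Continuous (gradient ψ) := by
    rw [hgrad]; exact (LinearIsometryEquiv.continuous _).comp hfc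
  obtain ⟨c0, hc0⟩ := hψc.exists_bound_of_continuous hψ.continuous
  obtain ⟨c1, hc1⟩ := (hψc.fderiv ℝ).exists_bound_of_continuous hfc
  have hi1 : Integrable fun x => w x • gradient ψ x := by
    refine Integrable.mono' (hw.norm.mul_const c1) (hw.1.smul hgc.aestronglyMeasurable)
      (Eventually.of_forall fun x => ?_)
    rw [norm_smul, hgrad, LinearIsometryEquiv.norm_map]
    exact mul_le_mul_of_nonneg_left (hc1 x) (norm_nonneg _)
  have hi2 : Integrable fun x => ψ x • v x := by
    refine Integrable.mono' (hv.norm.const_mul c0) (hψ.continuous.aestronglyMeasurable.smul hv.1)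
      (Eventually.of_forall fun x => ?_)
    rw [norm_smul]
    exact mul_le_mul_of_nonneg_right (hc0 x) (norm_nonneg _)
  have hi3 : Integrable fun x => w x * ψ x := by
    refine Integrable.mono' (hw.norm.mul_const c0) (hw.1.mul hψ.continuous.aestronglyMeasurable)
      (Eventually.of_forall fun x => ?_)
    rw [norm_mul]
    exact mul_le_mul_of_nonneg_left (hc0 x) (norm_nonneg _)
  -- Pairing with a fixed vector reduces the claim to scalar integration by parts in one direction.
  refine ext_inner_left ℝ fun e => ?_
  rw [inner_neg_right, ← integral_inner hi1, ← integral_inner hi2]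
  have e1 : ∀ x, inner ℝ e (w x • gradient ψ x) = w x * fderiv ℝ ψ x e := fun x => by
    rw [inner_smul_right, hgrad, real_inner_comm, InnerProductSpace.toDual_symm_apply]
  have e2 : ∀ x, inner ℝ e (ψ x • v x) = fderiv ℝ w x e * ψ x := fun x => by
    rw [inner_smul_right, (h x).hasFDerivAt.fderiv, InnerProductSpace.toDual_apply_apply,
      real_inner_comm, mul_comm]
  simp_rw [e1, e2]
  refine integral_mul_fderiv_eq_neg_fderiv_mul_of_integrable ?_ ?_ hi3
    (fun x _ => (h x).differentiableAt) (fun x _ => hψd x)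
  · exact (hi2.const_inner e).congr (Eventually.of_forall e2)
  · exact (hi1.const_inner e).congr (Eventually.of_forall e1)

end Gradient

/-! ### Norm bounds implied by the heat-flow majorant. -/

section Bounds

variable {N : ℕ} {E : Type*} [NormedAddCommGroup E] {ψ : Space N → ℝ≥0∞}

theorem ofReal_mul_heat (c t : ℝ) (x : Space N) :
    ENNReal.ofReal c * heat t ψ x = heat t (fun y => ENNReal.ofReal c * ψ y) x := by
  unfold heat
  rw [← lintegral_const_mul' _ _ ENNReal.ofReal_ne_top]
  exact lintegral_congr fun y => by ring

theorem eLpNorm_mul_heat_le (hψ : Measurable ψ) {c t : ℝ} (ht : 0 < t) {q : ℝ≥0∞} (hq : 1 ≤ q) :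
    ENNReal.ofReal (t ^ decayRate N q) *
      eLpNorm (fun x => ENNReal.ofReal c * heat t ψ x) q volume ≤
        ENNReal.ofReal c * ∫⁻ y, ψ y := by
  simp_rw [ofReal_mul_heat]
  rw [← lintegral_const_mul' _ _ ENNReal.ofReal_ne_top]
  exact eLpNorm_heat_le (hψ.const_mul _) ht hq

theorem eLpNorm_le_of_enorm_le_heat (hψ : Measurable ψ) {c t : ℝ} (ht : 0 < t) {q : ℝ≥0∞}
    (hq : 1 ≤ q) {w : Space N → E}
    (hw : ∀ x, ‖w x‖ₑ ≤ ENNReal.ofReal c * heat (2 * t) ψ x) :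
    ENNReal.ofReal (t ^ decayRate N q) * eLpNorm w q volume ≤ ENNReal.ofReal c * ∫⁻ y, ψ y := by
  refine le_trans ?_ (eLpNorm_mul_heat_le hψ (show 0 < 2 * t by linarith) hq)
  refine mul_le_mul' (ENNReal.ofReal_le_ofReal ?_) (eLpNorm_mono_enorm fun x => ?_)
  · exact Real.rpow_le_rpow ht.le (by linarith) (decayRate_nonneg N hq)
  · rw [enorm_eq_self]; exact hw x

theorem eLpNorm_one_le_of_enorm_le_heat (hψ : Measurable ψ) {c t : ℝ} (ht : 0 < t)
    {w : Space N → E} (hw : ∀ x, ‖w x‖ₑ ≤ ENNReal.ofReal c * heat (2 * t) ψ x) :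
    eLpNorm w 1 volume ≤ ENNReal.ofReal c * ∫⁻ y, ψ y := by
  rw [eLpNorm_one_eq_lintegral_enorm, ← lintegral_heat hψ (show 0 < 2 * t by linarith),
    ← lintegral_const_mul' _ _ ENNReal.ofReal_ne_top]
  exact lintegral_mono hw

theorem weightedL1Norm_le_of_enorm_le_heat (N : ℕ) {l : ℝ} (hl : 0 ≤ l) : ∃ b : ℝ, 0 ≤ b ∧
    ∀ {E : Type} [NormedAddCommGroup E] {φ : Space N → ℝ} (_ : Measurable φ) {c t : ℝ} (_ : 0 < t)
      {w : Space N → E} (_ : ∀ x, ‖w x‖ₑ ≤ ENNReal.ofReal c * heat (2 * t) (fun ξ => ‖φ ξ‖ₑ) x),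
      weightedL1Norm l w ≤ ENNReal.ofReal c *
        (ENNReal.ofReal (b * (1 + t) ^ (l / 2)) * weightedL1Norm l φ) := by
  obtain ⟨b, hb, hbt⟩ := exists_lintegral_weight_heat_le N hl
  refine ⟨b * 2 ^ (l / 2), by positivity, fun {E} _ {φ} hφ {c t} ht {w} hw => ?_⟩
  unfold weightedL1Norm
  calc _ ≤ ∫⁻ x, ENNReal.ofReal c *
        (ENNReal.ofReal ((1 + ‖x‖) ^ l) * heat (2 * t) (fun ξ => ‖φ ξ‖ₑ) x) := by
        refine lintegral_mono fun x => (mul_le_mul_right (hw x) _).trans (le_of_eq ?_)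
        ring
    _ ≤ ENNReal.ofReal c * (ENNReal.ofReal (b * (1 + 2 * t) ^ (l / 2)) *
          ∫⁻ y, ENNReal.ofReal ((1 + ‖y‖) ^ l) * ‖φ y‖ₑ) := by
        rw [lintegral_const_mul' _ _ ENNReal.ofReal_ne_top]
        exact mul_le_mul_right (hbt _ hφ.enorm _ (by linarith)) _
    _ ≤ _ := by
        refine mul_le_mul_right (mul_le_mul_left (ENNReal.ofReal_le_ofReal ?_) _) _
        rw [mul_assoc, ← Real.mul_rpow (by norm_num) (by linarith)]
        refine mul_le_mul_of_nonneg_left (Real.rpow_le_rpow (by linarith) (by linarith)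
          (by positivity)) hb

theorem weightedL1Norm_mono {l l' : ℝ} (h : l ≤ l') (w : Space N → E) :
    weightedL1Norm l w ≤ weightedL1Norm l' w := by
  refine lintegral_mono fun x => mul_le_mul_left (ENNReal.ofReal_le_ofReal ?_) _
  exact Real.rpow_le_rpow_of_exponent_le (by linarith [norm_nonneg x]) h

end Bounds

/-! ### Regularity of mild solutions and the integral equation. -/

section Mild

variable {N : ℕ} {E : Type*} [NormedAddCommGroup E] [NormedSpace ℝ E]
  {k : Space N → ℝ → E} {κ a : ℝ} {F : Space N × ℝ → ℝ} {φ : Space N → ℝ} {A B : ℝ}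

theorem integrable_of_lintegral_ne_top (hφ : Measurable φ) (hφ' : ∫⁻ ξ, ‖φ ξ‖ₑ ≠ ∞) :
    Integrable φ := ⟨hφ.aestronglyMeasurable, hφ'.lt_top⟩

/-- The pointwise bound from which all the norm estimates for u and ∇u follow. -/
theorem IsSource.exists_enorm_mild_le
    (hF : IsSource F (fun s => ENNReal.ofReal (B * rate A s)) fun ξ => ‖φ ξ‖ₑ)
    (hk : IsHeatKernel k κ a) (hφ : Measurable φ) (hA : 1 < A) (hB : 0 ≤ B) :
    ∃ c : ℝ, 0 ≤ c ∧ ∀ x t, 0 < t → ‖mild k φ F (Ioo 0 t) x t‖ₑ ≤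
      ENNReal.ofReal (c * t ^ (-a)) * heat (2 * t) (fun ξ => ‖φ ξ‖ₑ) x := by
  obtain ⟨c, hc, hct⟩ := hF.exists_lintegral_le hk hφ.enorm hA hB
  have hκ := hk.const_nonneg
  refine ⟨κ + c, by positivity, fun x t ht => ?_⟩
  have h1 : ‖∫ ξ, φ ξ • k (x - ξ) t‖ₑ ≤ _ :=
    (enorm_integral_le_lintegral_enorm _).trans (hk.enorm_initial_le φ x ht)
  refine (enorm_add_le _ _).trans ((add_le_add h1
    ((enorm_potential_le _ _ _ _ _).trans (hct x t ht))).trans (le_of_eq ?_))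
  rw [← add_mul, ← ENNReal.ofReal_add (by positivity) (by positivity), add_mul]

/-- The initial term is a superposition of kernels all issued at time 0; near t₀ a cut-off at
distance t₀/2 is inactive. -/
theorem IsSource.continuousOn_mild
    (hF : IsSource F (fun s => ENNReal.ofReal (B * rate A s)) fun ξ => ‖φ ξ‖ₑ)
    (hk : IsHeatKernel k κ a) (hφ : Measurable φ) (hφ' : ∫⁻ ξ, ‖φ ξ‖ₑ ≠ ∞) (hA : 1 < A)
    (hB : 0 ≤ B) :
    ContinuousOn (fun z : Space N × ℝ => mild k φ F (Ioo 0 z.2) z.1 z.2) (spaceTime N) := by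
  refine ContinuousOn.add ?_ (hF.continuousOn_potential hk hφ.enorm hφ' hA hB)
  rintro ⟨x₀, t₀⟩ (ht₀ : 0 < t₀)
  refine ContinuousAt.continuousWithinAt ?_
  have h1 := hk.continuousAt_superposition (ρ := volume) (y := fun ξ : Space N => ξ)
    (s := fun _ => (0 : ℝ)) measurable_id measurable_const
    (integrable_of_lintegral_ne_top hφ hφ') (half_pos ht₀) (x₀ := x₀) (t₀ := t₀)
    (Eventually.of_forall fun _ => by linarith)
  refine h1.congr ?_
  have h2 : ∀ᶠ z : Space N × ℝ in 𝓝 (x₀, t₀), t₀ / 2 < z.2 :=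
    continuous_snd.continuousAt.eventually_const_lt (by simpa using ht₀)
  filter_upwards [h2] with z hz
  refine integral_congr_ae (Eventually.of_forall fun ξ => ?_)
  have hmem : ξ ∈ {_ω : Space N | (0 : ℝ) ≤ z.2 - t₀ / 2} :=
    show (0 : ℝ) ≤ z.2 - t₀ / 2 by linarith
  rw [indicator_of_mem hmem, sub_zero]

theorem hasGradientAt_initial (hφ : Integrable φ) {t : ℝ} (ht : 0 < t) (x : Space N) :
    HasGradientAt (fun x => ∫ ξ, φ ξ • gaussKernel (x - ξ) t)
      (∫ ξ, φ ξ • gaussGrad (x - ξ) t) x := by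
  have h := hasGradientAt_superposition (ρ := volume) (y := fun ξ : Space N => ξ)
    (s := fun _ => 0) measurable_id measurable_const hφ ht (t := t)
    (Eventually.of_forall fun _ => by linarith) x
  simpa only [sub_zero] using h

theorem IsSource.hasGradientAt_mild
    (hF : IsSource F (fun s => ENNReal.ofReal (B * rate A s)) fun ξ => ‖φ ξ‖ₑ)
    (hφ : Measurable φ) (hφ' : ∫⁻ ξ, ‖φ ξ‖ₑ ≠ ∞) (hA : 1 < A) (hB : 0 ≤ B) {t : ℝ} (ht : 0 < t)
    (x : Space N) :
    HasGradientAt (fun x => mild (fun x t => gaussKernel x t) φ F (Ioo 0 t) x t)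
      (mild (fun x t => gaussGrad x t) φ F (Ioo 0 t) x t) x :=
  (hasGradientAt_initial (integrable_of_lintegral_ne_top hφ hφ') ht x).add_gradient
    (hF.hasGradientAt_potential hφ.enorm hφ' hA hB le_rfl ht x)

theorem IsSource.integrable_mild
    (hF : IsSource F (fun s => ENNReal.ofReal (B * rate A s)) fun ξ => ‖φ ξ‖ₑ)
    (hk : IsHeatKernel k κ a) (hφ : Measurable φ) (hφ' : ∫⁻ ξ, ‖φ ξ‖ₑ ≠ ∞) (hA : 1 < A)
    (hB : 0 ≤ B) [SecondCountableTopology E] {t : ℝ} (ht : 0 < t) :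
    Integrable fun x => mild k φ F (Ioo 0 t) x t := by
  obtain ⟨c, hc, hct⟩ := hF.exists_enorm_mild_le hk hφ hA hB
  have hcont : Continuous fun x => mild k φ F (Ioo 0 t) x t := by
    have := (hF.continuousOn_mild hk hφ hφ' hA hB).comp_continuous
      (by fun_prop : Continuous fun x : Space N => (x, t)) (fun x => ht)
    exact this
  rw [← memLp_one_iff_integrable]
  refine ⟨hcont.aestronglyMeasurable, ?_⟩
  exact (eLpNorm_one_le_of_enorm_le_heat hφ.enorm ht fun x => hct x t ht).trans_lt
    (ENNReal.mul_lt_top ENNReal.ofReal_lt_top hφ'.lt_top)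

theorem setIntegral_univ_prod_symm {G : Space N × ℝ → E} {I : Set ℝ}
    (hG : IntegrableOn G (univ ×ˢ I)) :
    ∫ p in univ ×ˢ I, G p = ∫ s in I, ∫ ξ, G (ξ, s) := by
  rw [IntegrableOn, volume_restrict_univ_prod] at hG
  rw [volume_restrict_univ_prod, integral_prod_symm _ hG]

variable {f : Space N → ℝ → ℝ → Space N → ℝ}

theorem IsSource.isSolution_mild
    (hF : IsSource F (fun s => ENNReal.ofReal (B * rate A s)) fun ξ => ‖φ ξ‖ₑ)
    (hφ : Measurable φ) (hφ' : ∫⁻ ξ, ‖φ ξ‖ₑ ≠ ∞) (hA : 1 < A) (hB : 0 ≤ B)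
    (hFf : ∀ x t, 0 < t → F (x, t) = f x t (mild (fun x t => gaussKernel x t) φ F (Ioo 0 t) x t)
      (mild (fun x t => gaussGrad x t) φ F (Ioo 0 t) x t)) :
    IsSolution f φ (fun t x => mild (fun x t => gaussKernel x t) φ F (Ioo 0 t) x t) := by
  have hk0 := isHeatKernel_gaussKernel N
  have hk1 := isHeatKernel_gaussGrad N
  refine ⟨fun t x => mild (fun x t => gaussGrad x t) φ F (Ioo 0 t) x t,
    ⟨?_, ?_, ?_, ?_⟩, ?_⟩
  · exact (hF.continuousOn_mild hk0 hφ hφ' hA hB).aestronglyMeasurable measurableSet_spaceTime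
  · exact (hF.continuousOn_mild hk1 hφ hφ' hA hB).aestronglyMeasurable measurableSet_spaceTime
  · filter_upwards [ae_restrict_mem measurableSet_Ioi] with t ht
    exact hasW11Gradient_of_hasGradientAt (hF.integrable_mild hk0 hφ hφ' hA hB ht)
      (hF.integrable_mild hk1 hφ hφ' hA hB ht)
      fun x => hF.hasGradientAt_mild hφ hφ' hA hB ht x
  · intro a b ha hab
    obtain ⟨c0, hc0, hct0⟩ := hF.exists_enorm_mild_le hk0 hφ hA hB
    obtain ⟨c1, hc1, hct1⟩ := hF.exists_enorm_mild_le hk1 hφ hA hB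
    have hfin : ENNReal.ofReal c0 * (∫⁻ ξ, ‖φ ξ‖ₑ) +
        ENNReal.ofReal (c1 * a ^ (-(1 / 2 : ℝ))) * ∫⁻ ξ, ‖φ ξ‖ₑ ≠ ∞ :=
      ENNReal.add_ne_top.2 ⟨ENNReal.mul_ne_top ENNReal.ofReal_ne_top hφ',
        ENNReal.mul_ne_top ENNReal.ofReal_ne_top hφ'⟩
    refine ⟨ENNReal.toNNReal (ENNReal.ofReal c0 * (∫⁻ ξ, ‖φ ξ‖ₑ) +
        ENNReal.ofReal (c1 * a ^ (-(1 / 2 : ℝ))) * ∫⁻ ξ, ‖φ ξ‖ₑ), ?_⟩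
    · filter_upwards [ae_restrict_mem measurableSet_Icc] with t ht
      rw [ENNReal.coe_toNNReal hfin]
      have ht0 : 0 < t := ha.trans_le ht.1
      refine add_le_add ?_ ?_
      · refine eLpNorm_one_le_of_enorm_le_heat hφ.enorm ht0 fun x => ?_
        simpa using hct0 x t ht0
      · refine eLpNorm_one_le_of_enorm_le_heat hφ.enorm ht0 fun x => (hct1 x t ht0).trans ?_
        refine mul_le_mul_left (ENNReal.ofReal_le_ofReal ?_) _
        exact mul_le_mul_of_nonneg_left
          (Real.rpow_le_rpow_of_nonpos ha ht.1 (by norm_num)) hc1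
  · filter_upwards [ae_restrict_mem measurableSet_spaceTime] with z hz
    have ht : 0 < z.2 := hz
    have hint := hF.integrableOn_kernel hk0 hφ.enorm hφ' hA hB z.1 ht
    have hφi := integrable_of_lintegral_ne_top hφ hφ'
    have h0 := hk0.integrable_superposition (ρ := volume) (y := fun ξ : Space N => ξ)
      (s := fun _ => 0) measurable_id measurable_const hφi ht (t := z.2)
      (Eventually.of_forall fun _ => by linarith) z.1
    have hcongr : EqOn (fun p : Space N × ℝ => F p • gaussKernel (z.1 - p.1) (z.2 - p.2))
        (fun p => gaussKernel (z.1 - p.1) (z.2 - p.2) * f p.1 p.2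
          (mild (fun x t => gaussKernel x t) φ F (Ioo 0 p.2) p.1 p.2)
          (mild (fun x t => gaussGrad x t) φ F (Ioo 0 p.2) p.1 p.2)) (univ ×ˢ Ioo 0 z.2) := by
      intro p hp
      simp only
      rw [← hFf p.1 p.2 hp.2.1, smul_eq_mul, mul_comm]
    have hS : MeasurableSet ((univ : Set (Space N)) ×ˢ Ioo 0 z.2) :=
      MeasurableSet.univ.prod measurableSet_Ioo
    have hint' := hint.congr_fun hcongr hS
    refine ⟨?_, hint', ?_⟩
    · refine h0.congr (Eventually.of_forall fun ξ => ?_)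
      simp only [sub_zero, smul_eq_mul]; ring
    · have h1 := setIntegral_univ_prod_symm hint'
      rw [← setIntegral_congr_fun hS hcongr] at h1
      simp only at h1
      rw [← h1]
      unfold mild potential
      congr 1
      refine integral_congr_ae (Eventually.of_forall fun ξ => ?_)
      simp only [smul_eq_mul]; ring

/-- Allows the construction to work with a Borel representative of the initial datum. -/
theorem IsSolution.congr_ae {φ' : Space N → ℝ} {u : ℝ → Space N → ℝ} (h : IsSolution f φ u)
    (hφ : φ =ᵐ[volume] φ') : IsSolution f φ' u := by
  obtain ⟨v, hv, h⟩ := h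
  refine ⟨v, hv, ?_⟩
  filter_upwards [h] with z hz
  have h1 : (fun ξ => gaussKernel (z.1 - ξ) z.2 * φ ξ) =ᵐ[volume]
      fun ξ => gaussKernel (z.1 - ξ) z.2 * φ' ξ := by
    filter_upwards [hφ] with ξ hξ
    rw [hξ]
  exact ⟨hz.1.congr h1, hz.2.1, by rw [hz.2.2, integral_congr_ae h1]⟩

end Mild

/-! ### Limit mass and convergence to the Gauss kernel. -/

section Asymptotics

variable {N : ℕ} {E : Type*} [NormedAddCommGroup E] [NormedSpace ℝ E]
  {k : Space N → ℝ → E} {κ a : ℝ} {F : Space N × ℝ → ℝ} {φ : Space N → ℝ} {A B : ℝ}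

theorem IsSource.integrableOn_spaceTime
    (hF : IsSource F (fun s => ENNReal.ofReal (B * rate A s)) fun ξ => ‖φ ξ‖ₑ)
    (hφ : Measurable φ) (hφ' : ∫⁻ ξ, ‖φ ξ‖ₑ ≠ ∞) (hA : 1 < A) : IntegrableOn F (spaceTime N) :=
  hF.integrableOn hφ.enorm measurable_ofReal_rate hφ' (lintegral_ofReal_rate_ne_top hA)

theorem univ_prod_Ioo_subset (r t : ℝ) (hr : 0 ≤ r) :
    (univ : Set (Space N)) ×ˢ Ioo r t ⊆ spaceTime N := fun _ hp => hr.trans_lt hp.2.1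

theorem spaceTime_inter_lt (t : ℝ) :
    spaceTime N ∩ {p : Space N × ℝ | p.2 < t} = univ ×ˢ Ioo 0 t := by
  ext p; simp [spaceTime]

/-- Each Gauss kernel in the superposition has unit mass. -/
theorem IsSource.integral_mild
    (hF : IsSource F (fun s => ENNReal.ofReal (B * rate A s)) fun ξ => ‖φ ξ‖ₑ)
    (hφ : Measurable φ) (hφ' : ∫⁻ ξ, ‖φ ξ‖ₑ ≠ ∞) (hA : 1 < A) {t : ℝ} (ht : 0 < t) :
    ∫ x, mild (fun x t => gaussKernel x t) φ F (Ioo 0 t) x t =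
      (∫ ξ, φ ξ) + ∫ p in univ ×ˢ Ioo 0 t, F p := by
  have hφi := integrable_of_lintegral_ne_top hφ hφ'
  have h1 := integral_superposition (ρ := volume) (y := fun ξ : Space N => ξ)
    (s := fun _ => (0 : ℝ)) measurable_id measurable_const hφi (t := t)
    (Eventually.of_forall fun _ => ht)
  have hS : MeasurableSet ((univ : Set (Space N)) ×ˢ Ioo 0 t) :=
    MeasurableSet.univ.prod measurableSet_Ioo
  have h2 := integral_superposition (ρ := volume.restrict ((univ : Set (Space N)) ×ˢ Ioo 0 t))
    (y := Prod.fst) (s := Prod.snd) measurable_fst measurable_snd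
    ((hF.integrableOn_spaceTime hφ hφ' hA).mono_set (univ_prod_Ioo_subset 0 t le_rfl)) (t := t)
    ((ae_restrict_mem hS).mono fun p hp => hp.2.2)
  simp only [sub_zero] at h1
  unfold mild potential
  rw [integral_add h1.1 h2.1, h1.2, h2.2]

theorem tendsto_setIntegral_Ioo {F : Space N × ℝ → ℝ} (hF : IntegrableOn F (spaceTime N)) :
    Tendsto (fun t : ℝ => ∫ p in univ ×ˢ Ioo 0 t, F p) atTop (𝓝 (∫ p in spaceTime N, F p)) := by
  have hU : ⋃ t : ℝ, (univ : Set (Space N)) ×ˢ Ioo 0 t = spaceTime N := by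
    ext p
    simp only [mem_iUnion, mem_prod, mem_univ, true_and, mem_Ioo, spaceTime, mem_ofPred_eq]
    exact ⟨fun ⟨t, h⟩ => h.1, fun h => ⟨p.2 + 1, h, by linarith⟩⟩
  rw [← hU] at hF ⊢
  exact tendsto_setIntegral_of_monotone (fun t => MeasurableSet.univ.prod measurableSet_Ioo)
    (fun s t hst => prod_mono subset_rfl (Ioo_subset_Ioo_right hst)) hF

/-- Convergence in `L¹` to a multiple of the Gauss kernel. -/
theorem IsSource.tendsto_mild_L1
    (hF : IsSource F (fun s => ENNReal.ofReal (B * rate A s)) fun ξ => ‖φ ξ‖ₑ)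
    (hφ : Measurable φ) (hφ' : ∫⁻ ξ, ‖φ ξ‖ₑ ≠ ∞) (hA : 1 < A) {M : ℝ}
    (hM : M = (∫ ξ, φ ξ) + ∫ p in spaceTime N, F p) :
    Tendsto (fun t : ℝ => ∫⁻ x, ‖mild (fun x t => gaussKernel x t) φ F (Ioo 0 t) x t -
      M * shiftedGauss t x‖ₑ) atTop (𝓝 0) := by
  have hφi := integrable_of_lintegral_ne_top hφ hφ'
  have hFi := hF.integrableOn_spaceTime hφ hφ' hA
  -- Initial datum and source are two superpositions, with total densities the two summands of M.
  have h1 := tendsto_superposition_L1 (ρ := volume) (y := fun ξ : Space N => ξ)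
    (s := fun _ => (0 : ℝ)) measurable_id measurable_const hφi
  have h2 := tendsto_superposition_L1 (ρ := volume.restrict (spaceTime N))
    (y := Prod.fst) (s := Prod.snd) measurable_fst measurable_snd hFi
  have h3 := h1.add h2
  rw [add_zero] at h3
  refine tendsto_of_tendsto_of_tendsto_of_le_of_le' tendsto_const_nhds h3
    (Eventually.of_forall fun _ => zero_le) ?_
  filter_upwards [eventually_gt_atTop 0] with t ht
  have hset : {_ω : Space N | (0 : ℝ) < t} = univ := by simp [ht]
  have hlt : MeasurableSet {p : Space N × ℝ | p.2 < t} :=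
    measurableSet_lt measurable_snd measurable_const
  simp only [sub_zero]
  rw [hset, Measure.restrict_univ, Measure.restrict_restrict hlt, inter_comm, spaceTime_inter_lt]
  rw [← lintegral_add_right']
  · refine lintegral_mono fun x => ?_
    have e : mild (fun x t => gaussKernel x t) φ F (Ioo 0 t) x t - M * shiftedGauss t x =
        ((∫ ξ, φ ξ • gaussKernel (x - ξ) t) - (∫ ξ, φ ξ) * gaussKernel x (1 + t)) +
        ((∫ p in univ ×ˢ Ioo 0 t, F p • gaussKernel (x - p.1) (t - p.2)) -
          (∫ p in spaceTime N, F p) * gaussKernel x (1 + t)) := by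
      rw [hM]; unfold mild potential shiftedGauss; ring
    rw [e]
    exact enorm_add_le _ _
  · have hS : MeasurableSet ((univ : Set (Space N)) ×ˢ Ioo 0 t) :=
      MeasurableSet.univ.prod measurableSet_Ioo
    have h4 := (integral_superposition
      (ρ := volume.restrict ((univ : Set (Space N)) ×ˢ Ioo 0 t))
      (y := Prod.fst) (s := Prod.snd) measurable_fst measurable_snd
      (hFi.mono_set (univ_prod_Ioo_subset 0 t le_rfl)) (t := t)
      ((ae_restrict_mem hS).mono fun p hp => hp.2.2)).1
    exact (h4.sub ((integrable_gaussKernel (show 0 < 1 + t by linarith)).const_mul _)).1.enorm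

theorem potential_Ioc_eq_Ioo (k : Space N → ℝ → E) (F : Space N × ℝ → ℝ) (r τ : ℝ) (x : Space N)
    (t : ℝ) : potential k F (Ioc r τ) x t = potential k F (Ioo r τ) x t := by
  unfold potential
  rw [volume_restrict_univ_prod, volume_restrict_univ_prod, Measure.restrict_congr_set Ioo_ae_eq_Ioc]

/-- The evolution of `u - M g` over the time interval `(τ, t)`. -/
theorem IsSource.mild_sub_eq
    (hF : IsSource F (fun s => ENNReal.ofReal (B * rate A s)) fun ξ => ‖φ ξ‖ₑ)
    (hφ : Measurable φ) (hφ' : ∫⁻ ξ, ‖φ ξ‖ₑ ≠ ∞) (hA : 1 < A) (hB : 0 ≤ B) (M : ℝ) {τ t : ℝ}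
    (hτ : 0 < τ) (hτt : τ < t) (x : Space N) :
    mild (fun x t => gaussKernel x t) φ F (Ioo 0 t) x t - M * shiftedGauss t x =
      (∫ z, (mild (fun x t => gaussKernel x t) φ F (Ioo 0 τ) z τ - M * shiftedGauss τ z) •
        gaussKernel (x - z) (t - τ)) + potential (fun x t => gaussKernel x t) F (Ioo τ t) x t := by
  have hk0 := isHeatKernel_gaussKernel N
  have hφi := integrable_of_lintegral_ne_top hφ hφ'
  have hFi := (hF.integrableOn_spaceTime hφ hφ' hA).mono_set (univ_prod_Ioo_subset 0 τ le_rfl)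
  have hS : MeasurableSet ((univ : Set (Space N)) ×ˢ Ioo 0 τ) :=
    MeasurableSet.univ.prod measurableSet_Ioo
  have hlt : ∀ᵐ p ∂(volume.restrict ((univ : Set (Space N)) ×ˢ Ioo 0 τ)), p.2 < τ :=
    (ae_restrict_mem hS).mono fun p hp => hp.2.2
  have h1 := integral_gaussKernel_mul_superposition (ρ := volume) (y := fun ξ : Space N => ξ)
    (s := fun _ => (0 : ℝ)) measurable_id measurable_const hφi
    (Eventually.of_forall fun _ => hτ) hτt x
  have h2 := integral_gaussKernel_mul_superposition
    (ρ := volume.restrict ((univ : Set (Space N)) ×ˢ Ioo 0 τ))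
    (y := Prod.fst) (s := Prod.snd) measurable_fst measurable_snd hFi hlt hτt x
  -- As g is itself a shifted Gauss kernel, the heat flow carries g(τ) to g(t), so subtracting M g
  -- leaves the source term unchanged.
  have h3 := integral_gaussKernel_mul x 0 (sub_pos.2 hτt) (show 0 < 1 + τ by linarith)
  simp only [sub_zero] at h1 h3
  have hbdd : ∀ {w : Space N → ℝ}, Integrable w →
      Integrable fun z => gaussKernel (x - z) (t - τ) * w z := fun {w} hw => by
    refine hw.bdd_mul (c := (4 * Real.pi * (t - τ)) ^ (-((N : ℝ) / 2))) ?_ ?_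
    · exact (measurable_gaussKernel.comp (by fun_prop : Measurable fun z : Space N =>
          (x - z, t - τ))).aestronglyMeasurable
    · refine Eventually.of_forall fun z => ?_
      rw [Real.norm_of_nonneg (gaussKernel_nonneg _ _ (sub_pos.2 hτt))]
      exact gaussKernel_le _ (sub_pos.2 hτt)
  have i1 : Integrable fun z => ∫ ξ, φ ξ • gaussKernel (z - ξ) τ := by
    have := (integral_superposition (ρ := volume) (y := fun ξ : Space N => ξ)
      (s := fun _ => (0 : ℝ)) measurable_id measurable_const hφi (t := τ)
      (Eventually.of_forall fun _ => hτ)).1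
    simpa only [sub_zero] using this
  have i2 := (integral_superposition
    (ρ := volume.restrict ((univ : Set (Space N)) ×ˢ Ioo 0 τ))
    (y := Prod.fst) (s := Prod.snd) measurable_fst measurable_snd hFi (t := τ) hlt).1
  have i3 : Integrable fun z : Space N => gaussKernel z (1 + τ) :=
    integrable_gaussKernel (by linarith)
  have e : ∀ z, (mild (fun x t => gaussKernel x t) φ F (Ioo 0 τ) z τ - M * shiftedGauss τ z) •
      gaussKernel (x - z) (t - τ) =
      gaussKernel (x - z) (t - τ) * (∫ ξ, φ ξ • gaussKernel (z - ξ) τ) +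
      gaussKernel (x - z) (t - τ) *
        (∫ p in univ ×ˢ Ioo 0 τ, F p • gaussKernel (z - p.1) (τ - p.2)) -
      M * (gaussKernel (x - z) (t - τ) * gaussKernel z (1 + τ)) := by
    intro z; unfold mild potential shiftedGauss; rw [smul_eq_mul]; ring
  simp_rw [e]
  have i12 : Integrable fun z => gaussKernel (x - z) (t - τ) *
      (∫ ξ, φ ξ • gaussKernel (z - ξ) τ) + gaussKernel (x - z) (t - τ) *
        (∫ p in univ ×ˢ Ioo 0 τ, F p • gaussKernel (z - p.1) (τ - p.2)) :=
    (hbdd i1).add (hbdd i2)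
  rw [integral_sub i12 ((hbdd i3).const_mul M),
    integral_add (hbdd i1) (hbdd i2), integral_const_mul, h1, h2, h3]
  have e1 : t - τ + (1 + τ) = 1 + t := by ring
  rw [e1]
  unfold mild shiftedGauss
  rw [potential_split hF hk0 hφ.enorm hφ' hA hB x le_rfl hτ.le hτt, potential_Ioc_eq_Ioo]
  unfold potential
  ring

theorem IsSource.integrable_mild_sub
    (hF : IsSource F (fun s => ENNReal.ofReal (B * rate A s)) fun ξ => ‖φ ξ‖ₑ)
    (hφ : Measurable φ) (hφ' : ∫⁻ ξ, ‖φ ξ‖ₑ ≠ ∞) (hA : 1 < A) (hB : 0 ≤ B) (M : ℝ) {t : ℝ}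
    (ht : 0 < t) :
    Integrable fun x => mild (fun x t => gaussKernel x t) φ F (Ioo 0 t) x t -
      M * shiftedGauss t x :=
  (hF.integrable_mild (isHeatKernel_gaussKernel N) hφ hφ' hA hB ht).sub
    ((integrable_gaussKernel (show 0 < 1 + t by linarith)).const_mul M)

/-- Differentiating the restarted formula puts the gradient on the kernel, so no information on the
gradient of u - M g at time τ is needed. -/
theorem IsSource.hasGradientAt_mild_sub
    (hF : IsSource F (fun s => ENNReal.ofReal (B * rate A s)) fun ξ => ‖φ ξ‖ₑ)
    (hφ : Measurable φ) (hφ' : ∫⁻ ξ, ‖φ ξ‖ₑ ≠ ∞) (hA : 1 < A) (hB : 0 ≤ B) (M : ℝ) {τ t : ℝ}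
    (hτ : 0 < τ) (hτt : τ < t) (x : Space N) :
    HasGradientAt (fun x => mild (fun x t => gaussKernel x t) φ F (Ioo 0 t) x t -
        M * shiftedGauss t x)
      ((∫ z, (mild (fun x t => gaussKernel x t) φ F (Ioo 0 τ) z τ - M * shiftedGauss τ z) •
        gaussGrad (x - z) (t - τ)) + potential (fun x t => gaussGrad x t) F (Ioo τ t) x t) x := by
  have h1 := (hasGradientAt_initial (hF.integrable_mild_sub hφ hφ' hA hB M hτ)
    (sub_pos.2 hτt) x).add_gradient
    (hF.hasGradientAt_potential hφ.enorm hφ' hA hB hτ.le hτt x)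
  have h2 : (fun x => mild (fun x t => gaussKernel x t) φ F (Ioo 0 t) x t -
      M * shiftedGauss t x) = _ := funext fun x => hF.mild_sub_eq hφ hφ' hA hB M hτ hτt x
  rw [h2]
  exact h1

/-- Decay of functions of the form `k * θ(t/2) + (Duhamel integral over (t/2, t))` when
`θ → 0` in `L¹`. -/
theorem IsSource.tendsto_eLpNorm_zero
    (hF : IsSource F (fun s => ENNReal.ofReal (B * rate A s)) fun ξ => ‖φ ξ‖ₑ)
    (hk : IsHeatKernel k κ a) (hφ : Measurable φ) (hφ' : ∫⁻ ξ, ‖φ ξ‖ₑ ≠ ∞) (hA : 1 < A)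
    (hB : 0 ≤ B) {θ : ℝ → Space N → ℝ} (hθm : ∀ t, 0 < t → Measurable (θ t))
    (hθ : Tendsto (fun t => ∫⁻ x, ‖θ t x‖ₑ) atTop (𝓝 0)) {w : ℝ → Space N → E}
    (hw : ∀ t x, 0 < t → w t x = (∫ z, θ (t / 2) z • k (x - z) (t - t / 2)) +
      potential k F (Ioo (t / 2) t) x t) {q : ℝ≥0∞} (hq : 1 ≤ q) :
    Tendsto (fun t => ENNReal.ofReal (t ^ (decayRate N q + a)) * eLpNorm (w t) q volume) atTop
      (𝓝 0) := by
  obtain ⟨η, hη, hη0, hηt⟩ := hF.exists_tendsto_lintegral_half hk hφ.enorm hA hB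
  have hκ := hk.const_nonneg
  have hhalf : Tendsto (fun t : ℝ => t / 2) atTop atTop := tendsto_id.atTop_div_const two_pos
  -- After multiplication by t^(decayRate + a), smoothing from t/2 to t bounds the first term by a
  -- constant times the L¹ norm of θ(t/2). The Duhamel term over (t/2,t) is bounded by η(t) times
  -- the L¹ norm of φ.
  have hlim : Tendsto (fun t : ℝ => ENNReal.ofReal (2 ^ (decayRate N q + a) * κ) *
      (∫⁻ x, ‖θ (t / 2) x‖ₑ) + ENNReal.ofReal (η t) * ∫⁻ ξ, ‖φ ξ‖ₑ) atTop (𝓝 0) := by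
    have h1 := ENNReal.Tendsto.const_mul (a := ENNReal.ofReal (2 ^ (decayRate N q + a) * κ))
      (hθ.comp hhalf) (Or.inr ENNReal.ofReal_ne_top)
    have h2 := ENNReal.Tendsto.mul_const (b := ∫⁻ ξ, ‖φ ξ‖ₑ) (ENNReal.tendsto_ofReal hη)
      (Or.inr hφ')
    have h3 := h1.add h2
    rw [ENNReal.ofReal_zero, mul_zero, zero_mul, add_zero] at h3
    exact h3
  refine tendsto_of_tendsto_of_tendsto_of_le_of_le' tendsto_const_nhds hlim
    (Eventually.of_forall fun _ => zero_le) ?_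
  filter_upwards [eventually_gt_atTop 0] with t ht
  have ht2 : 0 < t / 2 := half_pos ht
  have htt : t - t / 2 = t / 2 := by ring
  have hθ2 := (hθm _ ht2).enorm
  have hb1 : ∀ x, ‖∫ z, θ (t / 2) z • k (x - z) (t - t / 2)‖ₑ ≤
      ENNReal.ofReal (κ * (t / 2) ^ (-a)) * heat (2 * (t / 2)) (fun z => ‖θ (t / 2) z‖ₑ) x :=
    fun x => by
      rw [htt]
      exact (enorm_integral_le_lintegral_enorm _).trans (hk.enorm_initial_le _ x ht2)
  have hb2 : ∀ x, ‖potential k F (Ioo (t / 2) t) x t‖ₑ ≤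
      ENNReal.ofReal (η t * t ^ (-a)) * heat (2 * t) (fun ξ => ‖φ ξ‖ₑ) x := fun x =>
    (enorm_potential_le _ _ _ _ _).trans (hηt x t ht)
  have hm1 : Measurable fun x : Space N => ENNReal.ofReal (κ * (t / 2) ^ (-a)) *
      heat (2 * (t / 2)) (fun z => ‖θ (t / 2) z‖ₑ) x :=
    (measurable_heat_comp hθ2 measurable_const measurable_id).const_mul _
  have hm2 : Measurable fun x : Space N => ENNReal.ofReal (η t * t ^ (-a)) *
      heat (2 * t) (fun ξ => ‖φ ξ‖ₑ) x :=
    (measurable_heat_comp hφ.enorm measurable_const measurable_id).const_mul _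
  have hsum : eLpNorm (w t) q volume ≤
      eLpNorm (fun x => ENNReal.ofReal (κ * (t / 2) ^ (-a)) *
        heat (2 * (t / 2)) (fun z => ‖θ (t / 2) z‖ₑ) x) q volume +
      eLpNorm (fun x => ENNReal.ofReal (η t * t ^ (-a)) *
        heat (2 * t) (fun ξ => ‖φ ξ‖ₑ) x) q volume := by
    refine le_trans (eLpNorm_mono_enorm fun x => ?_)
      (eLpNorm_add_le hm1.aestronglyMeasurable hm2.aestronglyMeasurable hq)
    rw [enorm_eq_self, hw t x ht]
    exact (enorm_add_le _ _).trans (add_le_add (hb1 x) (hb2 x))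
  have hd := decayRate_nonneg N hq
  have hta : t ^ a * t ^ (-a) = 1 := by rw [← Real.rpow_add ht]; simp
  have hta2 : (t / 2) ^ a * (t / 2) ^ (-a) = 1 := by rw [← Real.rpow_add ht2]; simp
  refine (mul_le_mul_right hsum _).trans ?_
  rw [mul_add]
  refine add_le_add ?_ ?_
  · have e : ENNReal.ofReal (t ^ (decayRate N q + a)) ≤
        ENNReal.ofReal (2 ^ (decayRate N q + a) * (t / 2) ^ a) *
          ENNReal.ofReal ((2 * (t / 2)) ^ decayRate N q) := by
      rw [← ENNReal.ofReal_mul (by positivity)]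
      refine ENNReal.ofReal_le_ofReal ?_
      have e2 : t ^ (decayRate N q + a) =
          2 ^ (decayRate N q + a) * (t / 2) ^ (decayRate N q + a) := by
        rw [← Real.mul_rpow (by norm_num) ht2.le]; congr 1; ring
      rw [e2, Real.rpow_add ht2, mul_assoc]
      refine mul_le_mul_of_nonneg_left ?_ (by positivity)
      rw [mul_comm]
      refine mul_le_mul_of_nonneg_left ?_ (by positivity)
      exact Real.rpow_le_rpow ht2.le (by linarith) hd
    refine (mul_le_mul_left e _).trans ?_
    rw [mul_assoc]
    refine (mul_le_mul_right (eLpNorm_mul_heat_le hθ2 (by linarith) hq) _).trans (le_of_eq ?_)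
    rw [← mul_assoc, ← ENNReal.ofReal_mul (by positivity)]
    congr 2
    linear_combination (2 ^ (decayRate N q + a) * κ) * hta2
  · have e : ENNReal.ofReal (t ^ (decayRate N q + a)) ≤
        ENNReal.ofReal (t ^ a) * ENNReal.ofReal ((2 * t) ^ decayRate N q) := by
      rw [← ENNReal.ofReal_mul (by positivity)]
      refine ENNReal.ofReal_le_ofReal ?_
      rw [Real.rpow_add ht, mul_comm]
      refine mul_le_mul_of_nonneg_left ?_ (by positivity)
      exact Real.rpow_le_rpow ht.le (by linarith) hd
    refine (mul_le_mul_left e _).trans ?_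
    rw [mul_assoc]
    refine (mul_le_mul_right (eLpNorm_mul_heat_le hφ.enorm (by linarith) hq) _).trans
      (le_of_eq ?_)
    rw [← mul_assoc, ← ENNReal.ofReal_mul (by positivity)]
    congr 2
    linear_combination (η t) * hta

end Asymptotics

/-! ### Uniform-in-time estimates and assembly of the theorem. -/

theorem ofReal_sqrt_mul {t c : ℝ} (ht : 0 < t) (I : ℝ≥0∞) :
    ENNReal.ofReal (t ^ (1 / 2 : ℝ)) * (ENNReal.ofReal (c * t ^ (-(1 / 2 : ℝ))) * I) =
      ENNReal.ofReal c * I := by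
  rw [← mul_assoc, ← ENNReal.ofReal_mul (by positivity)]
  congr 2
  have h : t ^ (1 / 2 : ℝ) * t ^ (-(1 / 2 : ℝ)) = 1 := by rw [← Real.rpow_add ht]; simp
  linear_combination c * h

variable {N : ℕ} {u : ℝ → Space N → ℝ} {v : ℝ → Space N → Space N} {φ : Space N → ℝ} {c₀ c₁ : ℝ}

theorem iSup_decay_lt_top (hφ : Measurable φ) (hφ' : ∫⁻ ξ, ‖φ ξ‖ₑ ≠ ∞)
    (hu : ∀ x t, 0 < t → ‖u t x‖ₑ ≤ ENNReal.ofReal c₀ * heat (2 * t) (fun ξ => ‖φ ξ‖ₑ) x)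
    (hv : ∀ x t, 0 < t → ‖v t x‖ₑ ≤
      ENNReal.ofReal (c₁ * t ^ (-(1 / 2 : ℝ))) * heat (2 * t) (fun ξ => ‖φ ξ‖ₑ) x)
    {q : ℝ≥0∞} (hq : 1 ≤ q) :
    (⨆ t : Ioi (0 : ℝ), ENNReal.ofReal ((t : ℝ) ^ decayRate N q) *
      (eLpNorm (u t) q volume +
        ENNReal.ofReal ((t : ℝ) ^ (1 / 2 : ℝ)) * eLpNorm (v t) q volume)) < ∞ := by
  refine lt_of_le_of_lt (iSup_le fun t => ?_)
    (ENNReal.add_lt_top.2 ⟨ENNReal.mul_lt_top (ENNReal.ofReal_lt_top (r := c₀)) hφ'.lt_top,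
      ENNReal.mul_lt_top (ENNReal.ofReal_lt_top (r := c₁)) hφ'.lt_top⟩)
  have ht : 0 < (t : ℝ) := t.2
  rw [mul_add, mul_left_comm]
  refine add_le_add (eLpNorm_le_of_enorm_le_heat hφ.enorm ht hq fun x => hu x t ht) ?_
  refine (mul_le_mul_right
    (eLpNorm_le_of_enorm_le_heat hφ.enorm ht hq fun x => hv x t ht) _).trans ?_
  rw [ofReal_sqrt_mul ht]

theorem iSup_growth_lt_top (hφ : Measurable φ) {l : ℝ} (hl : 0 ≤ l)
    (hφ' : weightedL1Norm l φ < ∞)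
    (hu : ∀ x t, 0 < t → ‖u t x‖ₑ ≤ ENNReal.ofReal c₀ * heat (2 * t) (fun ξ => ‖φ ξ‖ₑ) x)
    (hv : ∀ x t, 0 < t → ‖v t x‖ₑ ≤
      ENNReal.ofReal (c₁ * t ^ (-(1 / 2 : ℝ))) * heat (2 * t) (fun ξ => ‖φ ξ‖ₑ) x) :
    (⨆ t : Ioi (0 : ℝ), ENNReal.ofReal ((1 + (t : ℝ)) ^ (-(l / 2))) *
      (weightedL1Norm l (u t) +
        ENNReal.ofReal ((t : ℝ) ^ (1 / 2 : ℝ)) * weightedL1Norm l (v t))) < ∞ := by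
  obtain ⟨b, hb, hbl⟩ := weightedL1Norm_le_of_enorm_le_heat N hl
  have hfin : ∀ c : ℝ, ENNReal.ofReal c * (ENNReal.ofReal b * weightedL1Norm l φ) < ∞ := fun c =>
    ENNReal.mul_lt_top ENNReal.ofReal_lt_top (ENNReal.mul_lt_top ENNReal.ofReal_lt_top hφ')
  refine lt_of_le_of_lt (iSup_le fun t => ?_) (ENNReal.add_lt_top.2 ⟨hfin c₀, hfin c₁⟩)
  have ht : 0 < (t : ℝ) := t.2
  have hcancel : ∀ c : ℝ, ENNReal.ofReal ((1 + (t : ℝ)) ^ (-(l / 2))) *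
      (ENNReal.ofReal c * (ENNReal.ofReal (b * (1 + t) ^ (l / 2)) * weightedL1Norm l φ)) =
      ENNReal.ofReal c * (ENNReal.ofReal b * weightedL1Norm l φ) := by
    intro c
    rw [mul_left_comm, ← mul_assoc (ENNReal.ofReal ((1 + (t : ℝ)) ^ (-(l / 2)))),
      ← ENNReal.ofReal_mul (by positivity)]
    congr 3
    have h : (1 + (t : ℝ)) ^ (-(l / 2)) * (1 + (t : ℝ)) ^ (l / 2) = 1 := by
      rw [← Real.rpow_add (by positivity)]; simp
    linear_combination b * h
  rw [mul_add]
  refine add_le_add ?_ ?_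
  · rw [← hcancel]
    exact mul_le_mul_right (hbl hφ ht fun x => hu x t ht) _
  · rw [← hcancel]
    refine mul_le_mul_right ((mul_le_mul_right (hbl hφ ht fun x => hv x t ht) _).trans ?_) _
    rw [ofReal_sqrt_mul ht]

end SemilinearHeat

theorem theorem3p1 (N : ℕ) (hN : 1 ≤ N)
    (f : SemilinearHeat.Space N → ℝ → ℝ → SemilinearHeat.Space N → ℝ)
    (hf : ContinuousOn
      (fun z : SemilinearHeat.Space N × ℝ × ℝ × SemilinearHeat.Space N =>
        f z.1 z.2.1 z.2.2.1 z.2.2.2) {z | 0 < z.2.1})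
    (C A : ℝ) (hC : 0 < C) (hA : 1 < A)
    (hfbound : ∀ (x : SemilinearHeat.Space N) (t : ℝ) (p : ℝ) (q : SemilinearHeat.Space N),
      0 < t → |f x t p q| ≤ C * (1 + t) ^ (-A) * (|p| + (1 + t) ^ (1 / 2 : ℝ) * ‖q‖))
    (K : ℝ) (hK : 0 ≤ K) (φ : SemilinearHeat.Space N → ℝ)
    (hφ : SemilinearHeat.MemWeightedL1 K φ) :
    ∃ u : ℝ → SemilinearHeat.Space N → ℝ,
      SemilinearHeat.IsSolution f φ u ∧
      -- continuity of `u` and of its spatial gradient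
      (ContinuousOn (fun z : SemilinearHeat.Space N × ℝ => u z.2 z.1)
          (SemilinearHeat.spaceTime N) ∧
        (∀ t : ℝ, 0 < t → Differentiable ℝ (u t)) ∧
        ContinuousOn (fun z : SemilinearHeat.Space N × ℝ => gradient (u z.2) z.1)
          (SemilinearHeat.spaceTime N)) ∧
      -- decay of the Lebesgue norms
      (∀ q : ℝ≥0∞, 1 ≤ q →
        (⨆ t : Ioi (0 : ℝ), ENNReal.ofReal ((t : ℝ) ^ SemilinearHeat.decayRate N q) *
          (eLpNorm (u t) q volume +
            ENNReal.ofReal ((t : ℝ) ^ (1 / 2 : ℝ)) * eLpNorm (gradient (u t)) q volume)) < ∞) ∧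
      -- growth of the weighted norms
      (∀ l : ℝ, 0 ≤ l → l ≤ K →
        (⨆ t : Ioi (0 : ℝ), ENNReal.ofReal ((1 + (t : ℝ)) ^ (-(l / 2))) *
          (SemilinearHeat.weightedL1Norm l (u t) +
            ENNReal.ofReal ((t : ℝ) ^ (1 / 2 : ℝ)) *
              SemilinearHeat.weightedL1Norm l (gradient (u t)))) < ∞) ∧
      -- the limit mass and the convergence to the Gauss kernel
      IntegrableOn
        (fun z : SemilinearHeat.Space N × ℝ => f z.1 z.2 (u z.2 z.1) (gradient (u z.2) z.1))
        (SemilinearHeat.spaceTime N) ∧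
      ∃ M : ℝ,
        Tendsto (fun t : ℝ => ∫ x, u t x) atTop (𝓝 M) ∧
        M = (∫ x, φ x) + ∫ t in Ioi (0 : ℝ), ∫ x, f x t (u t x) (gradient (u t) x) ∧
        ∀ q : ℝ≥0∞, 1 ≤ q →
          Tendsto (fun t : ℝ => ENNReal.ofReal (t ^ SemilinearHeat.decayRate N q) *
              eLpNorm (fun x => u t x - M * SemilinearHeat.shiftedGauss t x) q volume)
            atTop (𝓝 0) ∧
          Tendsto (fun t : ℝ =>
              ENNReal.ofReal (t ^ (SemilinearHeat.decayRate N q + 1 / 2)) *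
              eLpNorm (gradient (fun x => u t x - M * SemilinearHeat.shiftedGauss t x)) q volume)
            atTop (𝓝 0) := by
  open SemilinearHeat in
  obtain ⟨hφi, hφK⟩ := hφ
  -- A Borel representative is used throughout; the integral equation, the weighted norm and M
  -- depend only on its class.
  obtain ⟨φ', hφm, hφφ'⟩ : ∃ φ' : Space N → ℝ, Measurable φ' ∧ φ =ᵐ[volume] φ' :=
    ⟨hφi.1.mk φ, hφi.1.stronglyMeasurable_mk.measurable, hφi.1.ae_eq_mk⟩
  have hφ' : ∫⁻ ξ, ‖φ' ξ‖ₑ ≠ ∞ := (hφi.congr hφφ').2.ne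
  have hφK' : weightedL1Norm K φ' < ∞ := by
    refine lt_of_eq_of_lt (lintegral_congr_ae ?_) hφK
    filter_upwards [hφφ'] with x hx
    rw [hx]
  obtain ⟨F, B, hB, hF, hFf⟩ := exists_mild_source hf hC hA hfbound hφm hφ'
  have hk0 := isHeatKernel_gaussKernel N
  have hk1 := isHeatKernel_gaussGrad N
  let u : ℝ → Space N → ℝ := fun t x => mild (fun x t => gaussKernel x t) φ' F (Ioo 0 t) x t
  let v : ℝ → Space N → Space N := fun t x => mild (fun x t => gaussGrad x t) φ' F (Ioo 0 t) x t
  have hgrad : ∀ t x, 0 < t → HasGradientAt (u t) (v t x) x := fun t x ht =>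
    hF.hasGradientAt_mild hφm hφ' hA hB ht x
  have hgrad' : ∀ t, 0 < t → gradient (u t) = v t := fun t ht => gradient_eq fun x => hgrad t x ht
  obtain ⟨c₀, -, hu⟩ := hF.exists_enorm_mild_le hk0 hφm hA hB
  obtain ⟨c₁, -, hv⟩ := hF.exists_enorm_mild_le hk1 hφm hA hB
  simp only [neg_zero, Real.rpow_zero, mul_one] at hu
  have hFi := hF.integrableOn_spaceTime hφm hφ' hA
  have hFf' : ∀ x t, 0 < t → F (x, t) = f x t (u t x) (gradient (u t) x) := fun x t ht => by
    rw [hgrad' t ht]; exact hFf x t ht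
  have hM0 : ∫ p in spaceTime N, F p =
      ∫ t in Ioi (0 : ℝ), ∫ x, f x t (u t x) (gradient (u t) x) := by
    rw [spaceTime_eq_prod] at hFi ⊢
    rw [setIntegral_univ_prod_symm hFi]
    refine setIntegral_congr_fun measurableSet_Ioi fun t ht => ?_
    exact integral_congr_ae (Eventually.of_forall fun x => hFf' x t ht)
  refine ⟨u, (hF.isSolution_mild hφm hφ' hA hB hFf).congr_ae hφφ'.symm,
    ⟨hF.continuousOn_mild hk0 hφm hφ' hA hB, fun t ht x => (hgrad t x ht).differentiableAt, ?_⟩,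
    fun q hq => ?_, fun l hl hlK => ?_, ?_,
    (∫ ξ, φ' ξ) + ∫ p in spaceTime N, F p, ?_, ?_, fun q hq => ?_⟩
  · refine (hF.continuousOn_mild hk1 hφm hφ' hA hB).congr fun z hz => ?_
    exact congrFun (hgrad' z.2 hz) z.1
  · refine lt_of_eq_of_lt ?_ (iSup_decay_lt_top hφm hφ' hu hv hq)
    exact iSup_congr fun t => by rw [hgrad' t t.2]
  · refine lt_of_eq_of_lt ?_ (iSup_growth_lt_top hφm hl
      ((weightedL1Norm_mono hlK φ').trans_lt hφK') hu hv)
    exact iSup_congr fun t => by rw [hgrad' t t.2]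
  · exact hFi.congr_fun (fun p hp => hFf' p.1 p.2 hp) measurableSet_spaceTime
  · refine ((tendsto_setIntegral_Ioo hFi).const_add (∫ ξ, φ' ξ)).congr' ?_
    filter_upwards [eventually_gt_atTop 0] with t ht
    exact (hF.integral_mild hφm hφ' hA ht).symm
  · rw [hM0, integral_congr_ae hφφ']
  · set M : ℝ := (∫ ξ, φ' ξ) + ∫ p in spaceTime N, F p with hM
    have hθ := hF.tendsto_mild_L1 hφm hφ' hA hM
    have hθm : ∀ t, 0 < t → Measurable fun x => u t x - M * shiftedGauss t x := fun t ht => by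
      have h1 : Measurable (u t) :=
        (Differentiable.continuous fun x => (hgrad t x ht).differentiableAt).measurable
      have h2 : Measurable fun x : Space N => shiftedGauss t x :=
        measurable_gaussKernel.comp (by fun_prop : Measurable fun x : Space N => (x, 1 + t))
      exact h1.sub (h2.const_mul M)
    refine ⟨?_, ?_⟩
    -- Both limits restart at time t/2 from the same L¹-small θ; only the kernel, hence the exponent
    -- a, differs.
    · have h := hF.tendsto_eLpNorm_zero hk0 hφm hφ' hA hB
        (θ := fun t x => u t x - M * shiftedGauss t x) hθm hθ
        (w := fun t x => u t x - M * shiftedGauss t x)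
        (fun t x ht => hF.mild_sub_eq hφm hφ' hA hB M (half_pos ht) (half_lt_self ht) x) hq
      simpa only [add_zero] using h
    · exact hF.tendsto_eLpNorm_zero hk1 hφm hφ' hA hB
        (θ := fun t x => u t x - M * shiftedGauss t x) hθm hθ
        (w := fun t => gradient fun x => u t x - M * shiftedGauss t x)
        (fun t x ht => (hF.hasGradientAt_mild_sub hφm hφ' hA hB M (half_pos ht)
          (half_lt_self ht) x).gradient) hq
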